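/- Let $K$ be a field of characteristic zero, $n\ge 0$, $P_n=K[x_1,\dots,x_n]$ and $\partial_i=\partial/\partial x_i$. Write $x_i$ also for the operator of multiplication by $x_i$ on $P_n$, and put $H_i=\partial_i x_i\in\operatorname{End}_K(P_n)$; thus $H_i(x^\alpha)=(\alpha_i+1)x^\alpha$, so $H_i$ is invertible. The Jacobian algebra $\mathbb{A}_n$ is the $K$-subalgebra of $\operatorname{End}_K(P_n)$ generated by $x_1,\dots,x_n,\partial_1,\dots,\partial_n,H_1^{-1},\dots,H_n^{-1}$. Put $y_i=H_i^{-1}\partial_i$, let $\mathbb{A}_1(i)$ be the subalgebra of $\mathbb{A}_n$ generated by $x_i,\partial_i,H_i^{-1}$ (so $\mathbb{A}_n=\bigotimes_{i=1}^n\mathbb{A}_1(i)$), and let $\mathbb{G}_n=\operatorname{Aut}_{K\text{-alg}}(\mathbb{A}_n)$. Consider the following subgroups of $\mathbb{G}_n$. * $S_n$: the symmetric group, acting faithfully on $\mathbb{A}_n$ by $\tau(x_i)=x_{\tau(i)}$, $\tau(y_i)=y_{\tau(i)}$, $\tau(H_i^{\pm1})=H_{\tau(i)}^{\pm1}$. *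 $\mathbb{T}^n=\{t_\lambda\mid\lambda\in(K^*)^n\}$: the torus, acting faithfully on $\mathbb{A}_n$ by $t_\lambda(x_i)=\lambda_i x_i$, $t_\lambda(y_i)=\lambda_i^{-1}y_i$, $t_\lambda(H_i^{\pm1})=H_i^{\pm1}$. * $\Xi_n=\langle \eta_1\theta_1,\dots,\eta_n\theta_n\rangle$. Here $\eta_i$ and $\theta_i$ are the involutions ($K$-linear anti-automorphisms equal to their own inverses) of $\mathbb{A}_1(i)$ given by $\eta_i: x_i\mapsto y_i,\ y_i\mapsto x_i,\ H_i^{\pm1}\mapsto H_i^{\pm1}$ and $\theta_i: x_i\mapsto \partial_i,\ \partial_i\mapsto x_i,\ H_i^{\pm1}\mapsto H_i^{\pm1}$, and the automorphism $\eta_i\theta_i$ (first $\theta_i$, then $\eta_i$) of $\mathbb{A}_1(i)$ is extended to $\mathbb{A}_n$ by the identity on $\mathbb{A}_1(j)$, $j\ne i$. Thus $\eta_i\theta_i: x_i\mapsto x_iH_i,\ y_i\mapsto H_i^{-1}y_i,\ H_i^{\pm1}\mapsto H_i^{\pm1}$. * $\operatorname{Inn}(\mathbb{A}_n)$: the group of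 inner automorphisms $a\mapsto uau^{-1}$, where $u$ is a unit of $\mathbb{A}_n$. Then $\Xi_n\simeq\mathbb{Z}^n$ is free abelian with basis $\eta_1\theta_1,\dots,\eta_n\theta_n$, and $$\mathbb{G}_n=S_n\ltimes(\mathbb{T}^n\times\Xi_n)\ltimes\operatorname{Inn}(\mathbb{A}_n).$$ Here the products are internal and $H_1\ltimes H_2\ltimes H_3$ means $H_1\ltimes(H_2\ltimes H_3)$, with the right-hand factor of each $\ltimes$ being the normal one. -/

import Mathlib

namespace JacobianAlgebra

open MvPolynomial

/-! ### Operators on the polynomial algebra `P_n = K[x_1, …, x_n]` -/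

/-- The linear operator on `P_n` that multiplies each monomial `x^α` by the scalar `c α`. -/
noncomputable def diagOp {K : Type*} [Field K] {n : ℕ} (c : (Fin n →₀ ℕ) → K) :
    Module.End K (MvPolynomial (Fin n) K) :=
  (basisMonomials (Fin n) K).constr K fun α => monomial α (c α)

/-- Multiplication by the variable `x_i`. -/
noncomputable def opX (K : Type*) [Field K] {n : ℕ} (i : Fin n) :
    Module.End K (MvPolynomial (Fin n) K) :=
  LinearMap.mulLeft K (X i)

/-- The partial derivative `∂_i`. -/
noncomputable def opD (K : Type*) [Field K] {n : ℕ} (i : Fin n) :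
    Module.End K (MvPolynomial (Fin n) K) :=
  (pderiv i).toLinearMap

/-- The operator `H_i = ∂_i x_i`. -/
noncomputable def opH (K : Type*) [Field K] {n : ℕ} (i : Fin n) :
    Module.End K (MvPolynomial (Fin n) K) :=
  opD K i * opX K i

/-- The operator `x^α ↦ (α_i + 1)⁻¹ x^α`; it is the inverse of `H_i` in characteristic zero, see
`opHinv_mul_opH` and `opH_mul_opHinv`. -/
noncomputable def opHinv (K : Type*) [Field K] {n : ℕ} (i : Fin n) :
    Module.End K (MvPolynomial (Fin n) K) :=
  diagOp fun α => ((α i : K) + 1)⁻¹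

/-- The Jacobian algebra `𝔸_n`: the subalgebra of `End_K(P_n)` generated by the Weyl algebra
`A_n = K⟨x_1, …, x_n, ∂_1, …, ∂_n⟩` and `H_1⁻¹, …, H_n⁻¹`. -/
noncomputable def JacobianAlg (K : Type*) [Field K] (n : ℕ) :
    Subalgebra K (Module.End K (MvPolynomial (Fin n) K)) :=
  Algebra.adjoin K (Set.range (opX K) ∪ Set.range (opD K) ∪ Set.range (opHinv K))

section basic

variable {K : Type*} [Field K] {n : ℕ}

theorem end_ext {f g : Module.End K (MvPolynomial (Fin n) K)}
    (h : ∀ α, f (monomial α 1) = g (monomial α 1)) : f = g :=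
  (basisMonomials (Fin n) K).ext fun α => by simpa using h α

@[simp] theorem diagOp_monomial (c : (Fin n →₀ ℕ) → K) (α : Fin n →₀ ℕ) (a : K) :
    diagOp c (monomial α a) = monomial α (c α * a) := by
  have h : diagOp c (monomial α 1) = monomial α (c α) := by
    have := (basisMonomials (Fin n) K).constr_basis K
      (fun α => (monomial α (c α) : MvPolynomial (Fin n) K)) α
    simpa [diagOp] using this
  have h2 : (monomial α a : MvPolynomial (Fin n) K) = a • monomial α 1 := by
    simp [smul_monomial]
  rw [h2, map_smul, h, smul_monomial, smul_eq_mul, mul_comm]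

@[simp] theorem opX_monomial (i : Fin n) (α : Fin n →₀ ℕ) (a : K) :
    opX K i (monomial α a) = monomial (α + Finsupp.single i 1) a := by
  simp [opX, X, monomial_mul, add_comm]

@[simp] theorem opD_monomial (i : Fin n) (α : Fin n →₀ ℕ) (a : K) :
    opD K i (monomial α a) = monomial (α - Finsupp.single i 1) (a * α i) := by
  simp [opD, pderiv_monomial]

@[simp] theorem opH_monomial (i : Fin n) (α : Fin n →₀ ℕ) (a : K) :
    opH K i (monomial α a) = monomial α (a * (α i + 1)) := by
  simp [opH]

@[simp] theorem opHinv_monomial (i : Fin n) (α : Fin n →₀ ℕ) (a : K) :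
    opHinv K i (monomial α a) = monomial α ((α i + 1 : K)⁻¹ * a) := by
  simp [opHinv]

theorem opH_mul_opHinv [CharZero K] (i : Fin n) : opH K i * opHinv K i = 1 :=
  end_ext fun α => by
    have : (α i + 1 : K) ≠ 0 := Nat.cast_add_one_ne_zero _
    simp [this]

theorem opHinv_mul_opH [CharZero K] (i : Fin n) : opHinv K i * opH K i = 1 :=
  end_ext fun α => by
    have : (α i + 1 : K) ≠ 0 := Nat.cast_add_one_ne_zero _
    rw [Module.End.mul_apply, opH_monomial, opHinv_monomial, one_mul, inv_mul_cancel₀ this]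
    rfl

theorem opX_mem (i : Fin n) : opX K i ∈ JacobianAlg K n :=
  Algebra.subset_adjoin (Or.inl (Or.inl ⟨i, rfl⟩))

theorem opD_mem (i : Fin n) : opD K i ∈ JacobianAlg K n :=
  Algebra.subset_adjoin (Or.inl (Or.inr ⟨i, rfl⟩))

theorem opHinv_mem (i : Fin n) : opHinv K i ∈ JacobianAlg K n :=
  Algebra.subset_adjoin (Or.inr ⟨i, rfl⟩)

theorem opH_mem (i : Fin n) : opH K i ∈ JacobianAlg K n :=
  mul_mem (opD_mem i) (opX_mem i)

end basic

/-! ### The elements `x_i`, `∂_i`, `H_i`, `H_i⁻¹`, `y_i = H_i⁻¹ ∂_i` of `𝔸_n` -/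

/-- The element `x_i` of `𝔸_n`. -/
noncomputable def x (K : Type*) [Field K] {n : ℕ} (i : Fin n) : JacobianAlg K n :=
  ⟨opX K i, opX_mem i⟩

/-- The element `∂_i` of `𝔸_n`. -/
noncomputable def der (K : Type*) [Field K] {n : ℕ} (i : Fin n) : JacobianAlg K n :=
  ⟨opD K i, opD_mem i⟩

/-- The element `H_i` of `𝔸_n`. -/
noncomputable def h (K : Type*) [Field K] {n : ℕ} (i : Fin n) : JacobianAlg K n :=
  ⟨opH K i, opH_mem i⟩

/-- The element `H_i⁻¹` of `𝔸_n`. -/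
noncomputable def hinv (K : Type*) [Field K] {n : ℕ} (i : Fin n) : JacobianAlg K n :=
  ⟨opHinv K i, opHinv_mem i⟩

/-- The element `y_i = H_i⁻¹ ∂_i` of `𝔸_n`. -/
noncomputable def y (K : Type*) [Field K] {n : ℕ} (i : Fin n) : JacobianAlg K n :=
  hinv K i * der K i

/-- The group `𝔾_n` of `K`-algebra automorphisms of `𝔸_n` (the product is composition). -/
abbrev 𝔾 (K : Type*) [Field K] (n : ℕ) : Type _ := JacobianAlg K n ≃ₐ[K] JacobianAlg K n

/-! ### Automorphisms of `𝔸_n` given by conjugation in `End_K(P_n)` -/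

section conj

variable {K : Type*} [Field K] {n : ℕ}

theorem conj_map_le (φ : MvPolynomial (Fin n) K ≃ₗ[K] MvPolynomial (Fin n) K)
    (hX : ∀ i, φ.conjAlgEquiv K (opX K i) ∈ JacobianAlg K n)
    (hD : ∀ i, φ.conjAlgEquiv K (opD K i) ∈ JacobianAlg K n)
    (hH : ∀ i, φ.conjAlgEquiv K (opHinv K i) ∈ JacobianAlg K n) :
    ∀ a ∈ JacobianAlg K n, φ.conjAlgEquiv K a ∈ JacobianAlg K n := by
  have : JacobianAlg K n ≤
      (JacobianAlg K n).comap (φ.conjAlgEquiv K : Module.End K _ →ₐ[K] Module.End K _) := by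
    refine Algebra.adjoin_le ?_
    rintro _ ((⟨i, rfl⟩ | ⟨i, rfl⟩) | ⟨i, rfl⟩)
    exacts [hX i, hD i, hH i]
  exact fun a ha => this ha

/-- The automorphism `a ↦ φ a φ⁻¹` of `𝔸_n`, for an invertible linear operator `φ` on `P_n` such
that `φ 𝔸_n φ⁻¹ = 𝔸_n`. -/
noncomputable def conjAut (φ : MvPolynomial (Fin n) K ≃ₗ[K] MvPolynomial (Fin n) K)
    (h₁ : ∀ a ∈ JacobianAlg K n, φ.conjAlgEquiv K a ∈ JacobianAlg K n)
    (h₂ : ∀ a ∈ JacobianAlg K n, φ.symm.conjAlgEquiv K a ∈ JacobianAlg K n) : 𝔾 K n :=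
  AlgEquiv.ofAlgHom
    (((φ.conjAlgEquiv K).toAlgHom.comp (JacobianAlg K n).val).codRestrict (JacobianAlg K n)
      fun a => h₁ a a.2)
    (((φ.symm.conjAlgEquiv K).toAlgHom.comp (JacobianAlg K n).val).codRestrict (JacobianAlg K n)
      fun a => h₂ a a.2)
    (by
      ext a : 2
      exact (φ.conjAlgEquiv K).apply_symm_apply _)
    (by
      ext a : 2
      exact (φ.conjAlgEquiv K).symm_apply_apply _)

theorem conjAut_coe (φ : MvPolynomial (Fin n) K ≃ₗ[K] MvPolynomial (Fin n) K)
    (h₁ : ∀ a ∈ JacobianAlg K n, φ.conjAlgEquiv K a ∈ JacobianAlg K n)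
    (h₂ : ∀ a ∈ JacobianAlg K n, φ.symm.conjAlgEquiv K a ∈ JacobianAlg K n)
    (a : JacobianAlg K n) :
    (conjAut φ h₁ h₂ a : Module.End K (MvPolynomial (Fin n) K)) = φ.conjAlgEquiv K a := rfl

theorem conjAut_eq_one (φ : MvPolynomial (Fin n) K ≃ₗ[K] MvPolynomial (Fin n) K)
    (h₁ : ∀ a ∈ JacobianAlg K n, φ.conjAlgEquiv K a ∈ JacobianAlg K n)
    (h₂ : ∀ a ∈ JacobianAlg K n, φ.symm.conjAlgEquiv K a ∈ JacobianAlg K n)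
    (hφ : ∀ α, φ (monomial α 1) = monomial α 1) : conjAut φ h₁ h₂ = 1 := by
  have : φ = LinearEquiv.refl K _ :=
    LinearEquiv.toLinearMap_injective (end_ext (g := 1) hφ)
  subst this
  rfl

theorem conjAut_eq_mul (φ ψ χ : MvPolynomial (Fin n) K ≃ₗ[K] MvPolynomial (Fin n) K)
    (h₁ : ∀ a ∈ JacobianAlg K n, φ.conjAlgEquiv K a ∈ JacobianAlg K n)
    (h₂ : ∀ a ∈ JacobianAlg K n, φ.symm.conjAlgEquiv K a ∈ JacobianAlg K n)
    (h₃ : ∀ a ∈ JacobianAlg K n, ψ.conjAlgEquiv K a ∈ JacobianAlg K n)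
    (h₄ : ∀ a ∈ JacobianAlg K n, ψ.symm.conjAlgEquiv K a ∈ JacobianAlg K n)
    (h₅ : ∀ a ∈ JacobianAlg K n, χ.conjAlgEquiv K a ∈ JacobianAlg K n)
    (h₆ : ∀ a ∈ JacobianAlg K n, χ.symm.conjAlgEquiv K a ∈ JacobianAlg K n)
    (hφ : ∀ α, φ (monomial α 1) = ψ (χ (monomial α 1))) :
    conjAut φ h₁ h₂ = conjAut ψ h₃ h₄ * conjAut χ h₅ h₆ := by
  have : φ = χ.trans ψ :=
    LinearEquiv.toLinearMap_injective
      (end_ext (f := φ.toLinearMap) (g := (χ.trans ψ).toLinearMap) hφ)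
  subst this
  rfl

/-- Equality `φ a φ⁻¹ = b` in the form `φ a = b φ`, checked on monomials. -/
theorem conj_eq_of (φ : MvPolynomial (Fin n) K ≃ₗ[K] MvPolynomial (Fin n) K)
    {a b : Module.End K (MvPolynomial (Fin n) K)}
    (hab : ∀ α, φ (a (monomial α 1)) = b (φ (monomial α 1))) : φ.conjAlgEquiv K a = b := by
  have key : φ.toLinearMap ∘ₗ a = b ∘ₗ φ.toLinearMap := end_ext hab
  refine LinearMap.ext fun p => ?_
  have := LinearMap.congr_fun key (φ.symm p)
  simpa [LinearEquiv.conjAlgEquiv_apply] using this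

/-- The invertible diagonal operator `x^α ↦ c(α) x^α`, for nonzero scalars `c(α)`. -/
noncomputable def diagEquiv (c : (Fin n →₀ ℕ) → Kˣ) :
    MvPolynomial (Fin n) K ≃ₗ[K] MvPolynomial (Fin n) K :=
  LinearEquiv.ofLinearMap (diagOp fun α => (c α : K)) (diagOp fun α => ((c α)⁻¹ : Kˣ))
    (end_ext fun α => by simp) (end_ext fun α => by simp)

@[simp] theorem diagEquiv_monomial (c : (Fin n →₀ ℕ) → Kˣ) (α : Fin n →₀ ℕ) (a : K) :
    diagEquiv c (monomial α a) = monomial α (c α * a) := diagOp_monomial _ α a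

theorem diagEquiv_symm (c : (Fin n →₀ ℕ) → Kˣ) :
    (diagEquiv c).symm = diagEquiv fun α => (c α)⁻¹ := by
  ext1 p
  rfl

end conj

/-! ### The symmetric group `S_n` -/

section perm

variable {K : Type*} [Field K] {n : ℕ}

theorem perm_opX (τ : Equiv.Perm (Fin n)) (i : Fin n) :
    (renameEquiv K τ).toLinearEquiv.conjAlgEquiv K (opX K i) = opX K (τ i) :=
  conj_eq_of _ fun α => by
    simp [rename_monomial, Finsupp.mapDomain_add, Finsupp.mapDomain_single]

theorem perm_opD (τ : Equiv.Perm (Fin n)) (i : Fin n) :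
    (renameEquiv K τ).toLinearEquiv.conjAlgEquiv K (opD K i) = opD K (τ i) :=
  conj_eq_of _ fun α => by
    have h1 : Finsupp.mapDomain τ (α - Finsupp.single i 1) =
        Finsupp.mapDomain τ α - Finsupp.single (τ i) 1 := by
      ext j
      obtain ⟨j, rfl⟩ := τ.surjective j
      simp [Finsupp.mapDomain_apply τ.injective, Finsupp.single_apply]
    simp [rename_monomial, h1, Finsupp.mapDomain_apply τ.injective]

theorem perm_opHinv (τ : Equiv.Perm (Fin n)) (i : Fin n) :
    (renameEquiv K τ).toLinearEquiv.conjAlgEquiv K (opHinv K i) = opHinv K (τ i) :=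
  conj_eq_of _ fun α => by
    simp [rename_monomial, Finsupp.mapDomain_apply τ.injective]

theorem perm_mem (τ : Equiv.Perm (Fin n)) :
    ∀ a ∈ JacobianAlg K n,
      (renameEquiv K τ).toLinearEquiv.conjAlgEquiv K a ∈ JacobianAlg K n :=
  conj_map_le _ (fun i => by rw [perm_opX]; exact opX_mem _)
    (fun i => by rw [perm_opD]; exact opD_mem _)
    (fun i => by rw [perm_opHinv]; exact opHinv_mem _)

/-- The action of `S_n` on `𝔸_n` by permuting the variables: conjugation by the substitution
`x_i ↦ x_{τ(i)}` of `P_n`. -/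
noncomputable def permHom (K : Type*) [Field K] (n : ℕ) : Equiv.Perm (Fin n) →* 𝔾 K n where
  toFun τ := conjAut (renameEquiv K τ).toLinearEquiv (perm_mem τ) (perm_mem τ.symm)
  map_one' := conjAut_eq_one _ _ _ fun α => by
    simp [Equiv.Perm.coe_one]
  map_mul' σ τ := conjAut_eq_mul _ _ _ _ _ _ _ _ _ fun α => by
    simp [rename_monomial, Equiv.Perm.coe_mul, Finsupp.mapDomain_comp]

end perm

/-! ### The torus `𝕋^n` -/

section torus

variable {K : Type*} [Field K] {n : ℕ}

/-- The scalars `λ^α = ∏ λ_i^{α_i}`. -/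
def torusWeight (t : Fin n → Kˣ) (α : Fin n →₀ ℕ) : Kˣ := ∏ i, t i ^ α i

theorem torusWeight_add (t : Fin n → Kˣ) (α β : Fin n →₀ ℕ) :
    torusWeight t (α + β) = torusWeight t α * torusWeight t β := by
  simp [torusWeight, pow_add, Finset.prod_mul_distrib]

theorem torusWeight_single (t : Fin n → Kˣ) (i : Fin n) :
    torusWeight t (Finsupp.single i 1) = t i := by
  simp [torusWeight, Finsupp.single_apply]

theorem torus_opX (t : Fin n → Kˣ) (i : Fin n) :
    (diagEquiv (torusWeight t)).conjAlgEquiv K (opX K i) = (t i : K) • opX K i :=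
  conj_eq_of _ fun α => by
    simp [torusWeight_add, torusWeight_single, smul_monomial, mul_comm]

theorem torus_opD (t : Fin n → Kˣ) (i : Fin n) :
    (diagEquiv (torusWeight t)).conjAlgEquiv K (opD K i) = ((t i)⁻¹ : K) • opD K i :=
  conj_eq_of _ fun α => by
    by_cases hα : α i = 0
    · simp [hα]
    · have h1 : α = (α - Finsupp.single i 1) + Finsupp.single i 1 := by
        ext j
        by_cases hj : i = j
        · subst hj; simp; omega
        · simp [hj]
      have h2 : torusWeight t α = torusWeight t (α - Finsupp.single i 1) * t i := by
        conv_lhs => rw [h1, torusWeight_add, torusWeight_single]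
      simp only [opD_monomial, diagEquiv_monomial, LinearMap.smul_apply, h2, smul_monomial,
        Units.val_mul, smul_eq_mul]
      congr 1
      field_simp

theorem diag_opHinv (c : (Fin n →₀ ℕ) → Kˣ) (i : Fin n) :
    (diagEquiv c).conjAlgEquiv K (opHinv K i) = opHinv K i :=
  conj_eq_of _ fun α => by simp [mul_comm]

theorem torus_mem (t : Fin n → Kˣ) :
    ∀ a ∈ JacobianAlg K n, (diagEquiv (torusWeight t)).conjAlgEquiv K a ∈ JacobianAlg K n :=
  conj_map_le _ (fun i => by rw [torus_opX]; exact Subalgebra.smul_mem _ (opX_mem _) _)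
    (fun i => by rw [torus_opD]; exact Subalgebra.smul_mem _ (opD_mem _) _)
    (fun i => by rw [diag_opHinv]; exact opHinv_mem _)

theorem torus_symm (t : Fin n → Kˣ) :
    (diagEquiv (torusWeight t)).symm = diagEquiv (torusWeight t⁻¹) := by
  rw [diagEquiv_symm]
  congr 1
  ext α : 1
  simp [torusWeight]

/-- The action of the torus `(K^*)^n` on `𝔸_n` by rescaling: `t_λ` is conjugation by the
substitution `x_i ↦ λ_i x_i` of `P_n`, that is by `x^α ↦ λ^α x^α`. -/
noncomputable def torusHom (K : Type*) [Field K] (n : ℕ) : (Fin n → Kˣ) →* 𝔾 K n where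
  toFun t := conjAut (diagEquiv (torusWeight t)) (torus_mem t)
    (by rw [torus_symm]; exact torus_mem _)
  map_one' := conjAut_eq_one _ _ _ fun α => by simp [torusWeight]
  map_mul' s t := conjAut_eq_mul _ _ _ _ _ _ _ _ _ fun α => by
    simp [torusWeight, mul_pow, Finset.prod_mul_distrib]

end torus

/-! ### The automorphisms `η_i θ_i` and the group `Ξ_n` -/

section xi

variable {K : Type*} [Field K] [CharZero K] {n : ℕ}

/-- The scalars `α_i !`. -/
noncomputable def factWeight (K : Type*) [Field K] [CharZero K] {n : ℕ} (i : Fin n)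
    (α : Fin n →₀ ℕ) : Kˣ :=
  Units.mk0 ((α i).factorial : K) (Nat.cast_ne_zero.2 (Nat.factorial_ne_zero _))

theorem fact_opX_self (i : Fin n) :
    (diagEquiv (factWeight K i)).conjAlgEquiv K (opX K i) = opX K i * opH K i :=
  conj_eq_of _ fun α => by
    simp [factWeight, Nat.factorial_succ, mul_comm]

theorem fact_opX_of_ne {i j : Fin n} (hij : i ≠ j) :
    (diagEquiv (factWeight K i)).conjAlgEquiv K (opX K j) = opX K j :=
  conj_eq_of _ fun α => by
    simp [factWeight, Finsupp.single_eq_of_ne hij]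

theorem fact_opD_self (i : Fin n) :
    (diagEquiv (factWeight K i)).conjAlgEquiv K (opD K i) = opHinv K i * opD K i :=
  conj_eq_of _ fun α => by
    rcases hα : α i with _ | k
    · simp [hα]
    · have : (k + 1 : K) ≠ 0 := Nat.cast_add_one_ne_zero _
      simp [factWeight, hα, Nat.factorial_succ]
      rw [← map_add]
      congr 1
      field_simp

theorem fact_opD_of_ne {i j : Fin n} (hij : i ≠ j) :
    (diagEquiv (factWeight K i)).conjAlgEquiv K (opD K j) = opD K j :=
  conj_eq_of _ fun α => by
    simp [factWeight, Finsupp.single_eq_of_ne hij, mul_comm]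

theorem fact_symm_opX (i j : Fin n) :
    (diagEquiv (factWeight K i)).symm.conjAlgEquiv K (opX K j) ∈ JacobianAlg K n := by
  by_cases hij : i = j
  · subst hij
    have : (diagEquiv (factWeight K i)).symm.conjAlgEquiv K (opX K i) =
        opX K i * opHinv K i := by
      rw [diagEquiv_symm]
      refine conj_eq_of _ fun α => ?_
      simp [factWeight, Nat.factorial_succ]
      rw [mul_comm]
    rw [this]
    exact mul_mem (opX_mem _) (opHinv_mem _)
  · have : (diagEquiv (factWeight K i)).symm.conjAlgEquiv K (opX K j) = opX K j := by
      rw [← LinearEquiv.symm_conjAlgEquiv, AlgEquiv.symm_apply_eq, fact_opX_of_ne hij]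
    rw [this]
    exact opX_mem _

theorem fact_symm_opD (i j : Fin n) :
    (diagEquiv (factWeight K i)).symm.conjAlgEquiv K (opD K j) ∈ JacobianAlg K n := by
  by_cases hij : i = j
  · subst hij
    have : (diagEquiv (factWeight K i)).symm.conjAlgEquiv K (opD K i) =
        opH K i * opD K i := by
      rw [diagEquiv_symm]
      refine conj_eq_of _ fun α => ?_
      rcases hα : α i with _ | k
      · simp [hα]
      · have : (k + 1 : K) ≠ 0 := Nat.cast_add_one_ne_zero _
        simp [factWeight, hα, Nat.factorial_succ]
        field_simp
        rw [← map_add]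
        congr 1
        field_simp
    rw [this]
    exact mul_mem (opH_mem _) (opD_mem _)
  · have : (diagEquiv (factWeight K i)).symm.conjAlgEquiv K (opD K j) = opD K j := by
      rw [← LinearEquiv.symm_conjAlgEquiv, AlgEquiv.symm_apply_eq, fact_opD_of_ne hij]
    rw [this]
    exact opD_mem _

/-- The automorphism `η_i θ_i` of `𝔸_n`. It sends `x_i ↦ x_i H_i`, `y_i ↦ H_i⁻¹ y_i`, `H_i ↦ H_i`
and fixes `x_j`, `y_j`, `H_j` for `j ≠ i`; it is realised as conjugation by `x^α ↦ α_i! x^α`. -/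
noncomputable def etaTheta (K : Type*) [Field K] [CharZero K] {n : ℕ} (i : Fin n) : 𝔾 K n :=
  conjAut (diagEquiv (factWeight K i))
    (conj_map_le _
      (fun j => by
        by_cases hij : i = j
        · subst hij; rw [fact_opX_self]; exact mul_mem (opX_mem _) (opH_mem _)
        · rw [fact_opX_of_ne hij]; exact opX_mem _)
      (fun j => by
        by_cases hij : i = j
        · subst hij; rw [fact_opD_self]; exact mul_mem (opHinv_mem _) (opD_mem _)
        · rw [fact_opD_of_ne hij]; exact opD_mem _)
      (fun j => by rw [diag_opHinv]; exact opHinv_mem _))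
    (conj_map_le _ (fact_symm_opX i) (fact_symm_opD i)
      (fun j => by rw [diagEquiv_symm, diag_opHinv]; exact opHinv_mem _))

end xi

/-- The tensor factor `𝔸_1(i) = K⟨x_i, ∂_i, H_i⁻¹⟩` of `𝔸_n`. -/
noncomputable def factor (K : Type*) [Field K] {n : ℕ} (i : Fin n) :
    Subalgebra K (JacobianAlg K n) :=
  Algebra.adjoin K {x K i, der K i, hinv K i}

/-- The element `x_i` of `𝔸_1(i)`. -/
noncomputable def factorX (K : Type*) [Field K] {n : ℕ} (i : Fin n) : factor K i :=
  ⟨x K i, Algebra.subset_adjoin (by simp)⟩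

/-- The element `∂_i` of `𝔸_1(i)`. -/
noncomputable def factorDer (K : Type*) [Field K] {n : ℕ} (i : Fin n) : factor K i :=
  ⟨der K i, Algebra.subset_adjoin (by simp)⟩

/-- The element `H_i⁻¹` of `𝔸_1(i)`. -/
noncomputable def factorHinv (K : Type*) [Field K] {n : ℕ} (i : Fin n) : factor K i :=
  ⟨hinv K i, Algebra.subset_adjoin (by simp)⟩

/-- The element `H_i = ∂_i x_i` of `𝔸_1(i)`. -/
noncomputable def factorH (K : Type*) [Field K] {n : ℕ} (i : Fin n) : factor K i :=
  factorDer K i * factorX K i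

/-- The element `y_i = H_i⁻¹ ∂_i` of `𝔸_1(i)`. -/
noncomputable def factorY (K : Type*) [Field K] {n : ℕ} (i : Fin n) : factor K i :=
  factorHinv K i * factorDer K i

/-- `η` is the involution `η_i` of `𝔸_1(i)`: the `K`-linear anti-automorphism with
`x_i ↦ y_i`, `y_i ↦ x_i`, `H_i^{±1} ↦ H_i^{±1}`. -/
def IsEta {K : Type*} [Field K] {n : ℕ} (i : Fin n) (η : factor K i ≃ₗ[K] factor K i) : Prop :=
  (∀ a b, η (a * b) = η b * η a) ∧ (∀ a, η (η a) = a) ∧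
    η (factorX K i) = factorY K i ∧ η (factorY K i) = factorX K i ∧
    η (factorH K i) = factorH K i ∧ η (factorHinv K i) = factorHinv K i

/-- `θ` is the involution `θ_i` of `𝔸_1(i)`: the `K`-linear anti-automorphism with
`x_i ↦ ∂_i`, `∂_i ↦ x_i`, `H_i^{±1} ↦ H_i^{±1}`. -/
def IsTheta {K : Type*} [Field K] {n : ℕ} (i : Fin n) (θ : factor K i ≃ₗ[K] factor K i) : Prop :=
  (∀ a b, θ (a * b) = θ b * θ a) ∧ (∀ a, θ (θ a) = a) ∧
    θ (factorX K i) = factorDer K i ∧ θ (factorDer K i) = factorX K i ∧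
    θ (factorH K i) = factorH K i ∧ θ (factorHinv K i) = factorHinv K i

/-! ### The subgroups `S_n`, `𝕋^n`, `Ξ_n`, `Inn(𝔸_n)` of `𝔾_n` -/

/-- The subgroup `S_n` of `𝔾_n`. -/
noncomputable def symmSubgroup (K : Type*) [Field K] (n : ℕ) : Subgroup (𝔾 K n) :=
  (permHom K n).range

/-- The subgroup `𝕋^n` of `𝔾_n`. -/
noncomputable def torusSubgroup (K : Type*) [Field K] (n : ℕ) : Subgroup (𝔾 K n) :=
  (torusHom K n).range

/-- The subgroup `Ξ_n` of `𝔾_n` generated by `η_1 θ_1, …, η_n θ_n`. -/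
noncomputable def xiSubgroup (K : Type*) [Field K] [CharZero K] (n : ℕ) : Subgroup (𝔾 K n) :=
  Subgroup.closure (Set.range fun i : Fin n => etaTheta K i)

/-- The subgroup `Inn(𝔸_n)` of inner automorphisms `a ↦ u a u⁻¹`, for `u` a unit of `𝔸_n`. -/
def innSubgroup (K : Type*) [Field K] (n : ℕ) : Subgroup (𝔾 K n) where
  carrier := {σ | ∃ u : (JacobianAlg K n)ˣ, ∀ a, σ a = u * a * (u⁻¹ : (JacobianAlg K n)ˣ)}
  one_mem' := ⟨1, fun a => by simp⟩
  mul_mem' := by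
    rintro σ τ ⟨u, hu⟩ ⟨v, hv⟩
    exact ⟨u * v, fun a => by simp [hu, hv, mul_assoc]⟩
  inv_mem' := by
    rintro σ ⟨u, hu⟩
    refine ⟨u⁻¹, fun a => σ.injective ?_⟩
    have h1 : σ (σ⁻¹ a) = a := σ.apply_symm_apply a
    rw [h1, hu]
    simp [mul_assoc]

/-! ### Internal products of subgroups -/

/-- `G = A ⋉ B` as an internal semidirect product of subgroups of a group: `A` and `B` are
subgroups of `G`, `B` is normal in `G`, every element of `G` is a product of an element of `A` and
an element of `B`, and `A ∩ B` is trivial. -/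
def IsSemidirect {Γ : Type*} [Group Γ] (G A B : Subgroup Γ) : Prop :=
  A ≤ G ∧ B ≤ G ∧ (∀ g ∈ G, ∀ b ∈ B, g * b * g⁻¹ ∈ B) ∧
    (∀ g ∈ G, ∃ a ∈ A, ∃ b ∈ B, g = a * b) ∧ A ⊓ B = ⊥

/-- `G = A × B` as an internal direct product of subgroups of a group: the subgroups `A` and `B` of
`G` commute elementwise, every element of `G` is a product of an element of `A` and an element of
`B`, and `A ∩ B` is trivial. -/
def IsDirect {Γ : Type*} [Group Γ] (G A B : Subgroup Γ) : Prop :=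
  A ≤ G ∧ B ≤ G ∧ (∀ a ∈ A, ∀ b ∈ B, a * b = b * a) ∧
    (∀ g ∈ G, ∃ a ∈ A, ∃ b ∈ B, g = a * b) ∧ A ⊓ B = ⊥

end JacobianAlgebra

namespace JacobianAlgebra

open MvPolynomial

/-! ### Values of the three families of automorphisms on the generators. -/

section generators

variable {K : Type*} [Field K] {n : ℕ}

/-! Everything rests on watching operators on monomials `x^α` with all `α_i` large ("far out", the
filter `atTop` on `ℤ^n`). Three facts carry the proof.

(a) Every automorphism `σ` is conjugation by a linear bijection `φ` of `P_n` (`exists_conj`),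
because `𝔸_n` contains the rank-one projector onto the constants and moves any nonzero polynomial to
`1`. Such a `φ` is unique up to a scalar (`eq_smul_of_conj_eq`).

(b) Far out every element of `𝔸_n` is a finite sum of shifts `x^α ↦ f_β(α) x^{α+β}` with `f_β`
rational and with denominators that are products of forms `α_k + m`, `m ∈ ℤ` (`exists_hasSymbol`).
Rational functions have no zero divisors and `ℤ^n` has unique extremal sums, so a left-invertible
element is a single weighted shift far out (`exists_homogeneous_of_mul_eq_one`). Applied to `σ(H_i)`
and `σ(H_i + 1)`, this makes `σ(H_i)` diagonal far out, so `φ⁻¹` sends `x^α` to a multiple of some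
`x^{γ(α)}`. Applied to `σ(x_i)`, it gives vectors along which `γ` grows by a basis vector. The same
holds for `φ`, and the two resulting integer matrices are mutually inverse and nonnegative. Hence
they are permutation matrices, and `γ` is a permutation of coordinates plus a translation
(`InversePair.exists_perm`).

(c) Once the permutation is removed, `φ⁻¹ x^α = d(α) x^{α+κ}`, where the ratios `d(α + e_i)/d(α)`
and their inverses are rational. Such a ratio is a product of one-variable functions built from
linear factors. Commutation of the steps `e_i`, `e_k` makes its off-diagonal factors constant, and
each diagonal factor is `t (s+1)^m G(s+1)/G(s)`. So `d` is `∏ t_i^{α_i} (α_i!)^{m_i}`, the weight of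
an element of `𝕋^n × Ξ_n`, times the diagonal of a unit far out (`exists_weight`). After division by
that weight, `φ` agrees far out with an element of `𝔸_n`, hence lies in `𝔸_n`
(`Implements.mem_of_eventually`), and the automorphism is inner.

The factors are independent for reasons of growth. A weight `∏ t_i^{α_i} (α_i!)^{m_i}` is rational
far out only if it is trivial, and a nontrivial permutation of exponents moves monomials by
infinitely many different vectors, which no element of `𝔸_n` can do. -/

theorem alg_induction {p : JacobianAlg K n → Prop} (hx : ∀ i, p (x K i)) (hd : ∀ i, p (der K i))
    (hh : ∀ i, p (hinv K i)) (hc : ∀ c : K, p (algebraMap K _ c))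
    (ha : ∀ a b, p a → p b → p (a + b)) (hm : ∀ a b, p a → p b → p (a * b)) (a) : p a := by
  obtain ⟨a, h⟩ := a
  induction h using Algebra.adjoin_induction with
  | mem a h =>
    rcases h with (⟨i, rfl⟩ | ⟨i, rfl⟩) | ⟨i, rfl⟩
    exacts [hx i, hd i, hh i]
  | algebraMap c => exact hc c
  | add a b h₁ h₂ h₃ h₄ => exact ha ⟨a, h₁⟩ ⟨b, h₂⟩ h₃ h₄
  | mul a b h₁ h₂ h₃ h₄ => exact hm ⟨a, h₁⟩ ⟨b, h₂⟩ h₃ h₄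

theorem h_eq (i : Fin n) : h K i = der K i * x K i := rfl

theorem hinv_mul_h [CharZero K] (i : Fin n) : hinv K i * h K i = 1 :=
  Subtype.ext (opHinv_mul_opH i)

theorem h_mul_hinv [CharZero K] (i : Fin n) : h K i * hinv K i = 1 :=
  Subtype.ext (opH_mul_opHinv i)

theorem h_mul_y [CharZero K] (i : Fin n) : h K i * y K i = der K i := by
  rw [y, ← mul_assoc, h_mul_hinv, one_mul]

theorem y_mul_x [CharZero K] (i : Fin n) : y K i * x K i = 1 := by
  rw [y, mul_assoc, ← h_eq, hinv_mul_h]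

theorem permHom_x (τ : Equiv.Perm (Fin n)) (i : Fin n) : permHom K n τ (x K i) = x K (τ i) :=
  Subtype.ext (perm_opX τ i)

theorem permHom_der (τ : Equiv.Perm (Fin n)) (i : Fin n) :
    permHom K n τ (der K i) = der K (τ i) :=
  Subtype.ext (perm_opD τ i)

theorem permHom_hinv (τ : Equiv.Perm (Fin n)) (i : Fin n) :
    permHom K n τ (hinv K i) = hinv K (τ i) :=
  Subtype.ext (perm_opHinv τ i)

theorem torusHom_x (t : Fin n → Kˣ) (i : Fin n) :
    torusHom K n t (x K i) = (t i : K) • x K i :=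
  Subtype.ext (torus_opX t i)

theorem torusHom_der (t : Fin n → Kˣ) (i : Fin n) :
    torusHom K n t (der K i) = ((t i)⁻¹ : K) • der K i :=
  Subtype.ext (torus_opD t i)

theorem torusHom_hinv (t : Fin n → Kˣ) (i : Fin n) : torusHom K n t (hinv K i) = hinv K i :=
  Subtype.ext (diag_opHinv _ i)

theorem torusHom_h (t : Fin n → Kˣ) (i : Fin n) : torusHom K n t (h K i) = h K i := by
  rw [h_eq, map_mul, torusHom_x, torusHom_der, smul_mul_smul_comm,
    inv_mul_cancel₀ (t i).ne_zero, one_smul]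

theorem torusHom_y (t : Fin n → Kˣ) (i : Fin n) :
    torusHom K n t (y K i) = ((t i)⁻¹ : K) • y K i := by
  rw [y, map_mul, torusHom_hinv, torusHom_der, mul_smul_comm]

theorem x_mem_factor (i : Fin n) : x K i ∈ factor K i := (factorX K i).2

theorem hinv_mem_factor (i : Fin n) : hinv K i ∈ factor K i := (factorHinv K i).2

theorem h_mem_factor (i : Fin n) : h K i ∈ factor K i := (factorH K i).2

theorem y_mem_factor (i : Fin n) : y K i ∈ factor K i := (factorY K i).2

variable [CharZero K]

theorem etaTheta_x (i : Fin n) : etaTheta K i (x K i) = x K i * h K i :=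
  Subtype.ext (fact_opX_self i)

theorem etaTheta_x_of_ne {i j : Fin n} (hij : i ≠ j) : etaTheta K i (x K j) = x K j :=
  Subtype.ext (fact_opX_of_ne hij)

theorem etaTheta_der (i : Fin n) : etaTheta K i (der K i) = y K i :=
  Subtype.ext (fact_opD_self i)

theorem etaTheta_der_of_ne {i j : Fin n} (hij : i ≠ j) : etaTheta K i (der K j) = der K j :=
  Subtype.ext (fact_opD_of_ne hij)

theorem etaTheta_hinv (i j : Fin n) : etaTheta K i (hinv K j) = hinv K j :=
  Subtype.ext (diag_opHinv _ j)

theorem etaTheta_h (i : Fin n) : etaTheta K i (h K i) = h K i := by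
  rw [h_eq, map_mul, etaTheta_x, etaTheta_der, ← mul_assoc, y_mul_x, one_mul, h_eq]

theorem etaTheta_y (i : Fin n) : etaTheta K i (y K i) = hinv K i * y K i := by
  conv_lhs => rw [y, map_mul, etaTheta_hinv, etaTheta_der]

theorem etaTheta_factor_of_ne {i j : Fin n} (hij : i ≠ j) (a : factor K j) :
    etaTheta K i (a : JacobianAlg K n) = a := by
  have : factor K j ≤ AlgHom.equalizer (etaTheta K i : JacobianAlg K n →ₐ[K] JacobianAlg K n)
      (AlgHom.id K _) := by
    refine Algebra.adjoin_le ?_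
    rintro _ (rfl | rfl | rfl)
    exacts [etaTheta_x_of_ne hij, etaTheta_der_of_ne hij, etaTheta_hinv i j]
  exact this a.2

end generators

/-! ### Transposition with respect to the monomial basis -/

section transpose

variable {K : Type*} [Field K] {n : ℕ}

/-- The bilinear form on `P_n` for which the monomials are orthonormal. -/
noncomputable def monForm (K : Type*) [Field K] (n : ℕ) :
    MvPolynomial (Fin n) K →ₗ[K] MvPolynomial (Fin n) K →ₗ[K] K :=
  (basisMonomials (Fin n) K).constr K fun α => lcoeff K α

@[simp] theorem monForm_monomial (α : Fin n →₀ ℕ) (q : MvPolynomial (Fin n) K) :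
    monForm K n (monomial α 1) q = coeff α q := by
  have := (basisMonomials (Fin n) K).constr_basis K (fun α => lcoeff K (σ := Fin n) α) α
  rw [coe_basisMonomials] at this
  rw [monForm, this]
  rfl

/-- `b` is the transpose of `a` in the basis of monomials. -/
def IsTranspose (a b : Module.End K (MvPolynomial (Fin n) K)) : Prop :=
  ∀ p q, monForm K n (a p) q = monForm K n p (b q)

theorem isTranspose_of_monomial {a b : Module.End K (MvPolynomial (Fin n) K)}
    (hab : ∀ α γ, monForm K n (a (monomial α 1)) (monomial γ 1) =
      coeff α (b (monomial γ 1))) : IsTranspose a b := by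
  have key : (monForm K n).compl₁₂ a LinearMap.id = (monForm K n).compl₁₂ LinearMap.id b := by
    refine (basisMonomials (Fin n) K).ext fun α => (basisMonomials (Fin n) K).ext fun γ => ?_
    simpa using hab α γ
  exact fun p q => LinearMap.congr_fun (LinearMap.congr_fun key p) q

theorem IsTranspose.unique {a b b' : Module.End K (MvPolynomial (Fin n) K)}
    (h₁ : IsTranspose a b) (h₂ : IsTranspose a b') : b = b' := by
  refine LinearMap.ext fun q => MvPolynomial.ext _ _ fun α => ?_
  rw [← monForm_monomial, ← monForm_monomial, ← h₁, ← h₂]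

theorem monForm_comm (p q : MvPolynomial (Fin n) K) : monForm K n p q = monForm K n q p := by
  have key : monForm K n = (monForm K n).flip := by
    refine (basisMonomials (Fin n) K).ext fun α => (basisMonomials (Fin n) K).ext fun γ => ?_
    simp [coeff_monomial, eq_comm]
  exact LinearMap.congr_fun (LinearMap.congr_fun key p) q

theorem IsTranspose.symm {a b : Module.End K (MvPolynomial (Fin n) K)}
    (h₁ : IsTranspose a b) : IsTranspose b a := fun p q => by
  rw [monForm_comm, ← h₁, monForm_comm]

theorem IsTranspose.mul {a b a' b' : Module.End K (MvPolynomial (Fin n) K)}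
    (h₁ : IsTranspose a b) (h₂ : IsTranspose a' b') : IsTranspose (a * a') (b' * b) :=
  fun p q => by simp [h₁ _ _, h₂ _ _]

theorem IsTranspose.add {a b a' b' : Module.End K (MvPolynomial (Fin n) K)}
    (h₁ : IsTranspose a b) (h₂ : IsTranspose a' b') : IsTranspose (a + a') (b + b') :=
  fun p q => by simp [h₁ _ _, h₂ _ _]

theorem IsTranspose.smul {a b : Module.End K (MvPolynomial (Fin n) K)} (c : K)
    (h₁ : IsTranspose a b) : IsTranspose (c • a) (c • b) :=
  fun p q => by simp [h₁ _ _]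

theorem isTranspose_one : IsTranspose (1 : Module.End K (MvPolynomial (Fin n) K)) 1 :=
  fun _ _ => rfl

theorem isTranspose_opHinv (i : Fin n) : IsTranspose (opHinv K i) (opHinv K i) :=
  isTranspose_of_monomial fun α γ => by
    have : (monomial α ((α i + 1 : K)⁻¹ * 1) : MvPolynomial (Fin n) K) =
        ((α i + 1 : K)⁻¹) • monomial α 1 := by simp [smul_monomial]
    rw [opHinv_monomial, opHinv_monomial, this, map_smul, LinearMap.smul_apply, monForm_monomial]
    simp only [coeff_monomial, smul_eq_mul, mul_one]
    split_ifs with h1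
    · simp [h1]
    · simp

variable [CharZero K]

/-- The factor `α_i` produced by `∂_i` is cancelled by `H_i⁻¹`, so `y_i` lowers exponents without
any scalar. The case distinction is needed because subtraction of exponents truncates. -/
theorem opY_monomial (i : Fin n) (α : Fin n →₀ ℕ) (a : K) :
    (opHinv K i * opD K i) (monomial α a) =
      if α i = 0 then 0 else monomial (α - Finsupp.single i 1) a := by
  split_ifs with h1
  · simp [h1]
  · obtain ⟨k, hk⟩ := Nat.exists_eq_succ_of_ne_zero h1
    have : (k + 1 : K) ≠ 0 := Nat.cast_add_one_ne_zero _
    simp [hk]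
    congr 1
    field_simp

theorem isTranspose_opX (i : Fin n) : IsTranspose (opX K i) (opHinv K i * opD K i) :=
  isTranspose_of_monomial fun α γ => by
    rw [opY_monomial, opX_monomial, monForm_monomial, coeff_monomial]
    by_cases h0 : γ i = 0
    · have : γ ≠ α + Finsupp.single i 1 := fun h1 => by simp [h1] at h0
      simp [h0, this]
    · rw [if_neg h0, coeff_monomial]
      have h2 : γ = (γ - Finsupp.single i 1) + Finsupp.single i 1 := by
        ext j
        by_cases hj : i = j
        · subst hj; simp; omega
        · simp [hj]
      have : γ = α + Finsupp.single i 1 ↔ γ - Finsupp.single i 1 = α := by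
        constructor
        · rintro rfl; simp
        · intro h3; rw [← h3, ← h2]
      simp [this]

/-- Transposition in the monomial basis is what realises every `η_i`: the raising operator `x_i` and
the lowering operator `y_i` are transposes of each other, and `H_i` is diagonal. From `∂_i = H_i
y_i` the transpose of `∂_i` is `x_i H_i`, so transposition does not leave `𝔸_n`. -/
theorem exists_isTranspose (a : JacobianAlg K n) :
    ∃ b : JacobianAlg K n, IsTranspose (a : Module.End K (MvPolynomial (Fin n) K)) b := by
  induction a using alg_induction with
  | hx i => exact ⟨y K i, isTranspose_opX i⟩
  | hd i =>
    refine ⟨x K i * h K i, ?_⟩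
    rw [← h_mul_y, h_eq, ← h_mul_y]
    have h1 := isTranspose_opHinv (K := K) i
    have h2 := isTranspose_opX (K := K) i
    have h3 : IsTranspose (opH K i) (opH K i) := by
      refine isTranspose_of_monomial fun α γ => ?_
      have : (monomial α (1 * (α i + 1 : K)) : MvPolynomial (Fin n) K) =
          ((α i + 1 : K)) • monomial α 1 := by simp [smul_monomial]
      rw [opH_monomial, opH_monomial, this, map_smul, LinearMap.smul_apply, monForm_monomial]
      simp only [coeff_monomial, smul_eq_mul, one_mul]
      split_ifs with h1
      · simp [h1]
      · simp
    have h4 := h3.mul h2.symm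
    rw [h_mul_y]
    exact h4
  | hh i => exact ⟨hinv K i, isTranspose_opHinv i⟩
  | hc c =>
    refine ⟨algebraMap K _ c, ?_⟩
    rw [Algebra.algebraMap_eq_smul_one]
    exact isTranspose_one.smul c
  | ha a b h₁ h₂ =>
    obtain ⟨a', h₁⟩ := h₁
    obtain ⟨b', h₂⟩ := h₂
    exact ⟨a' + b', h₁.add h₂⟩
  | hm a b h₁ h₂ =>
    obtain ⟨a', h₁⟩ := h₁
    obtain ⟨b', h₂⟩ := h₂
    exact ⟨b' * a', h₁.mul h₂⟩

/-- Transposition, as a linear map from `𝔸_n` to itself. -/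
noncomputable def transpose (K : Type*) [Field K] [CharZero K] (n : ℕ) :
    JacobianAlg K n →ₗ[K] JacobianAlg K n where
  toFun a := (exists_isTranspose a).choose
  map_add' a b := Subtype.ext <| (exists_isTranspose (a + b)).choose_spec.unique
    ((exists_isTranspose a).choose_spec.add (exists_isTranspose b).choose_spec)
  map_smul' c a := Subtype.ext <| (exists_isTranspose (c • a)).choose_spec.unique
    ((exists_isTranspose a).choose_spec.smul c)

theorem transpose_spec (a : JacobianAlg K n) :
    IsTranspose (a : Module.End K (MvPolynomial (Fin n) K)) (transpose K n a) :=
  (exists_isTranspose a).choose_spec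

theorem transpose_eq {a b : JacobianAlg K n}
    (hab : IsTranspose (a : Module.End K (MvPolynomial (Fin n) K)) b) : transpose K n a = b :=
  Subtype.ext ((transpose_spec a).unique hab)

theorem transpose_mul (a b : JacobianAlg K n) :
    transpose K n (a * b) = transpose K n b * transpose K n a :=
  transpose_eq ((transpose_spec a).mul (transpose_spec b))

theorem transpose_transpose (a : JacobianAlg K n) : transpose K n (transpose K n a) = a :=
  transpose_eq (transpose_spec a).symm

theorem transpose_algebraMap (c : K) :
    transpose K n (algebraMap K _ c) = algebraMap K _ c := by
  rw [Algebra.algebraMap_eq_smul_one, map_smul, transpose_eq (a := 1) (b := 1) isTranspose_one]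

theorem transpose_x (i : Fin n) : transpose K n (x K i) = y K i :=
  transpose_eq (isTranspose_opX i)

theorem transpose_y (i : Fin n) : transpose K n (y K i) = x K i := by
  rw [← transpose_x, transpose_transpose]

theorem transpose_hinv (i : Fin n) : transpose K n (hinv K i) = hinv K i :=
  transpose_eq (isTranspose_opHinv i)

theorem transpose_h (i : Fin n) : transpose K n (h K i) = h K i := by
  have h1 := congrArg (transpose K n) (h_mul_hinv (K := K) i)
  rw [transpose_mul, transpose_hinv, transpose_eq (a := 1) (b := 1) isTranspose_one] at h1
  calc _ = h K i * (hinv K i * transpose K n (h K i)) := by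
        rw [← mul_assoc, h_mul_hinv, one_mul]
    _ = _ := by rw [h1, mul_one]

theorem transpose_der (i : Fin n) : transpose K n (der K i) = x K i * h K i := by
  rw [← h_mul_y, transpose_mul, transpose_y, transpose_h]

/-- This allows `θ_i` to be defined as transposition after `etaTheta`. Since transposition squares
to the identity, `η_i` after `θ_i` is then `etaTheta` automatically. -/
theorem transpose_etaTheta_involutive (i : Fin n) (a : JacobianAlg K n) :
    transpose K n (etaTheta K i (transpose K n (etaTheta K i a))) = a := by
  induction a using alg_induction with
  | hx j =>
    by_cases hij : i = j
    · subst hij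
      rw [etaTheta_x, transpose_mul, transpose_h, transpose_x, h_mul_y, etaTheta_der, transpose_y]
    · have : etaTheta K i (y K j) = y K j := by
        rw [y, map_mul, etaTheta_hinv, etaTheta_der_of_ne hij]
      rw [etaTheta_x_of_ne hij, transpose_x, this, transpose_y]
  | hd j =>
    by_cases hij : i = j
    · subst hij
      rw [etaTheta_der, transpose_y, etaTheta_x, transpose_mul, transpose_h, transpose_x, h_mul_y]
    · have : etaTheta K i (h K j) = h K j := by
        rw [h_eq, map_mul, etaTheta_x_of_ne hij, etaTheta_der_of_ne hij]
      rw [etaTheta_der_of_ne hij, transpose_der, map_mul, this, etaTheta_x_of_ne hij,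
        ← transpose_der, transpose_transpose]
  | hh j => rw [etaTheta_hinv, transpose_hinv, etaTheta_hinv, transpose_hinv]
  | hc c => rw [AlgEquiv.commutes, transpose_algebraMap, AlgEquiv.commutes, transpose_algebraMap]
  | ha a b h₁ h₂ => simp only [map_add, h₁, h₂]
  | hm a b h₁ h₂ => simp only [map_mul, transpose_mul, h₁, h₂]

theorem transpose_mem_factor {i : Fin n} {a : JacobianAlg K n} (ha : a ∈ factor K i) :
    transpose K n a ∈ factor K i := by
  induction ha using Algebra.adjoin_induction with
  | mem a ha =>
    rcases ha with rfl | rfl | rfl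
    · rw [transpose_x]; exact y_mem_factor i
    · rw [transpose_der]; exact mul_mem (x_mem_factor i) (h_mem_factor i)
    · rw [transpose_hinv]; exact hinv_mem_factor i
  | algebraMap c => rw [transpose_algebraMap]; exact Subalgebra.algebraMap_mem _ c
  | add a b _ _ h₁ h₂ => rw [map_add]; exact add_mem h₁ h₂
  | mul a b _ _ h₁ h₂ => rw [transpose_mul]; exact mul_mem h₂ h₁

theorem etaTheta_mem_factor {i : Fin n} {a : JacobianAlg K n} (ha : a ∈ factor K i) :
    etaTheta K i a ∈ factor K i := by
  induction ha using Algebra.adjoin_induction with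
  | mem a ha =>
    rcases ha with rfl | rfl | rfl
    · rw [etaTheta_x]; exact mul_mem (x_mem_factor i) (h_mem_factor i)
    · rw [etaTheta_der]; exact y_mem_factor i
    · rw [etaTheta_hinv]; exact hinv_mem_factor i
  | algebraMap c => rw [AlgEquiv.commutes]; exact Subalgebra.algebraMap_mem _ c
  | add a b _ _ h₁ h₂ => rw [map_add]; exact add_mem h₁ h₂
  | mul a b _ _ h₁ h₂ => rw [map_mul]; exact mul_mem h₁ h₂

/-- The involution `η_i` of `𝔸_1(i)`. -/
noncomputable def eta (K : Type*) [Field K] [CharZero K] {n : ℕ} (i : Fin n) :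
    factor K i ≃ₗ[K] factor K i :=
  LinearEquiv.ofInvolutive
    ((transpose K n).restrict (p := (factor K i).toSubmodule) (q := (factor K i).toSubmodule)
      fun _ ha => transpose_mem_factor ha)
    fun _ => Subtype.ext (transpose_transpose _)

/-- The involution `θ_i` of `𝔸_1(i)`. -/
noncomputable def theta (K : Type*) [Field K] [CharZero K] {n : ℕ} (i : Fin n) :
    factor K i ≃ₗ[K] factor K i :=
  LinearEquiv.ofInvolutive
    (((transpose K n).comp (etaTheta K i).toLinearMap).restrict (p := (factor K i).toSubmodule)
      (q := (factor K i).toSubmodule) fun _ ha => transpose_mem_factor (etaTheta_mem_factor ha))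
    fun _ => Subtype.ext (transpose_etaTheta_involutive i _)

theorem eta_coe {i : Fin n} (a : factor K i) :
    (eta K i a : JacobianAlg K n) = transpose K n a := rfl

theorem theta_coe {i : Fin n} (a : factor K i) :
    (theta K i a : JacobianAlg K n) = transpose K n (etaTheta K i a) := rfl

theorem isEta_eta (i : Fin n) : IsEta i (eta K i) :=
  ⟨fun _ _ => Subtype.ext (transpose_mul _ _), fun _ => Subtype.ext (transpose_transpose _),
    Subtype.ext (transpose_x i), Subtype.ext (transpose_y i), Subtype.ext (transpose_h i),
    Subtype.ext (transpose_hinv i)⟩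

theorem isTheta_theta (i : Fin n) : IsTheta i (theta K i) := by
  refine ⟨fun a b => Subtype.ext ?_, fun a => Subtype.ext ?_, Subtype.ext ?_, Subtype.ext ?_,
    Subtype.ext ?_, Subtype.ext ?_⟩
  · change transpose K n (etaTheta K i ((a : JacobianAlg K n) * b)) = _
    rw [map_mul, transpose_mul]
    rfl
  · exact transpose_etaTheta_involutive i _
  · change transpose K n (etaTheta K i (x K i)) = der K i
    rw [etaTheta_x, transpose_mul, transpose_h, transpose_x, h_mul_y]
  · change transpose K n (etaTheta K i (der K i)) = x K i
    rw [etaTheta_der, transpose_y]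
  · change transpose K n (etaTheta K i (h K i)) = h K i
    rw [etaTheta_h, transpose_h]
  · change transpose K n (etaTheta K i (hinv K i)) = hinv K i
    rw [etaTheta_hinv, transpose_hinv]

theorem etaTheta_eq_eta_theta {i : Fin n} (a : factor K i) :
    etaTheta K i (a : JacobianAlg K n) = eta K i (theta K i a) := by
  rw [eta_coe, theta_coe, transpose_transpose]

end transpose

end JacobianAlgebra

namespace JacobianAlgebra

open MvPolynomial

/-! ### Conjugation determines an operator up to a scalar -/

section commutant

variable {K : Type*} [Field K] [CharZero K] {n : ℕ}

theorem eq_C_of_pderiv_eq_zero {g : MvPolynomial (Fin n) K} (hg : ∀ i, pderiv i g = 0) :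
    g = C (coeff 0 g) := by
  ext α
  rw [coeff_C]
  split_ifs with h0
  · rw [h0]
  · obtain ⟨i, hi⟩ : ∃ i, α i ≠ 0 := by
      by_contra! hc
      exact h0 (Finsupp.ext fun i => (hc i).symm)
    have h1 : (α - Finsupp.single i 1) + Finsupp.single i 1 = α := by
      ext j
      by_cases hj : i = j
      · subst hj; simp; omega
      · simp [hj]
    have h2 := coeff_pderiv (i := i) g (α - Finsupp.single i 1)
    rw [hg i, h1, coeff_zero] at h2
    exact (mul_eq_zero.1 h2.symm).resolve_right (Nat.cast_add_one_ne_zero _)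

/-- Commuting with all `∂_i` forces `f 1` to be a constant, and commuting with all `x_i` makes `f`
multiplication by `f 1`. -/
theorem eq_smul_of_commute {f : Module.End K (MvPolynomial (Fin n) K)}
    (hX : ∀ i, f * opX K i = opX K i * f) (hD : ∀ i, f * opD K i = opD K i * f) :
    ∃ c : K, ∀ p, f p = c • p := by
  have h1 : f 1 = C (coeff 0 (f 1)) := eq_C_of_pderiv_eq_zero fun i => by
    have := LinearMap.congr_fun (hD i) 1
    simpa [opD] using this.symm
  refine ⟨coeff 0 (f 1), fun p => ?_⟩
  rw [← C_mul', ← h1]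
  induction p using MvPolynomial.induction_on with
  | C a => rw [C_eq_smul_one, map_smul, mul_smul_comm, mul_one]
  | add p q hp hq => rw [map_add, hp, hq, mul_add]
  | mul_X p i hp =>
    have := LinearMap.congr_fun (hX i) p
    simp only [opX, Module.End.mul_apply, LinearMap.mulLeft_apply] at this
    rw [mul_comm p, this, hp]
    ring

/-- `ψ⁻¹ φ` centralises `𝔸_n`, which contains all `x_i` and `∂_i`. This lets two descriptions of one
automorphism be compared as operators. -/
theorem eq_smul_of_conj_eq (φ ψ : MvPolynomial (Fin n) K ≃ₗ[K] MvPolynomial (Fin n) K)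
    (hφψ : ∀ a ∈ JacobianAlg K n, φ.conjAlgEquiv K a = ψ.conjAlgEquiv K a) :
    ∃ c : Kˣ, ∀ p, φ p = (c : K) • ψ p := by
  have key : ∀ a ∈ JacobianAlg K n, (φ.trans ψ.symm).toLinearMap * a =
      a * (φ.trans ψ.symm).toLinearMap := by
    intro a ha
    refine LinearMap.ext fun p => ?_
    have := LinearMap.congr_fun (hφψ a ha) (φ p)
    simp only [LinearEquiv.conjAlgEquiv_apply, LinearMap.comp_apply, LinearEquiv.coe_coe,
      LinearEquiv.symm_apply_apply] at this
    simp [this]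
  obtain ⟨c, hc⟩ := eq_smul_of_commute (fun i => key _ (opX_mem i)) (fun i => key _ (opD_mem i))
  have h0 : c ≠ 0 := by
    rintro rfl
    have h1 := hc 1
    simp at h1
  refine ⟨Units.mk0 c h0, fun p => ?_⟩
  have := congrArg ψ (hc p)
  simpa using this

end commutant

/-! ### Automorphisms given by conjugation with diagonal operators -/

section diag

variable {K : Type*} [Field K] {n : ℕ}

theorem diagEquiv_mul (c d : (Fin n →₀ ℕ) → Kˣ) :
    diagEquiv (c * d) = (diagEquiv d).trans (diagEquiv c) :=
  LinearEquiv.toLinearMap_injective (end_ext fun α => by simp)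

theorem diagEquiv_one : diagEquiv (1 : (Fin n →₀ ℕ) → Kˣ) = LinearEquiv.refl K _ :=
  LinearEquiv.toLinearMap_injective (end_ext fun α => by simp)

theorem conjAlgEquiv_trans_apply (φ ψ : MvPolynomial (Fin n) K ≃ₗ[K] MvPolynomial (Fin n) K)
    (a : Module.End K (MvPolynomial (Fin n) K)) :
    (φ.trans ψ).conjAlgEquiv K a = ψ.conjAlgEquiv K (φ.conjAlgEquiv K a) :=
  LinearMap.ext fun p => by simp [LinearEquiv.conjAlgEquiv_apply]

/-- The group of weights `c` such that conjugation by `x^α ↦ c(α) x^α` preserves `𝔸_n`. -/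
def diagNormalizer (K : Type*) [Field K] (n : ℕ) : Subgroup ((Fin n →₀ ℕ) → Kˣ) where
  carrier := {c | ∀ a ∈ JacobianAlg K n, (diagEquiv c).conjAlgEquiv K a ∈ JacobianAlg K n ∧
    (diagEquiv c).symm.conjAlgEquiv K a ∈ JacobianAlg K n}
  one_mem' a ha := by rw [diagEquiv_one]; exact ⟨ha, ha⟩
  mul_mem' {c d} hc hd a ha := by
    rw [diagEquiv_mul, LinearEquiv.trans_symm, conjAlgEquiv_trans_apply, conjAlgEquiv_trans_apply]
    exact ⟨(hc _ (hd a ha).1).1, (hd _ (hc a ha).2).2⟩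
  inv_mem' {c} hc a ha := by
    have h1 : (diagEquiv c).symm = diagEquiv c⁻¹ := diagEquiv_symm c
    rw [← h1]
    exact ⟨(hc a ha).2, (hc a ha).1⟩

/-- Conjugation by diagonal operators. -/
noncomputable def diagAut (K : Type*) [Field K] (n : ℕ) : diagNormalizer K n →* 𝔾 K n where
  toFun c := conjAut (diagEquiv c) (fun a ha => (c.2 a ha).1) (fun a ha => (c.2 a ha).2)
  map_one' := conjAut_eq_one _ _ _ fun α => by simp
  map_mul' c d := conjAut_eq_mul _ _ _ _ _ _ _ _ _ fun α => by simp

theorem torusWeight_mem (t : Fin n → Kˣ) : torusWeight t ∈ diagNormalizer K n := fun a ha =>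
  ⟨torus_mem t a ha, by rw [torus_symm]; exact torus_mem _ a ha⟩

theorem torusHom_eq_diagAut (t : Fin n → Kˣ) :
    torusHom K n t = diagAut K n ⟨torusWeight t, torusWeight_mem t⟩ := rfl

theorem permHom_injective : Function.Injective (permHom K n) := by
  intro σ τ hστ
  ext i : 1
  have := AlgEquiv.congr_fun hστ (x K i)
  rw [permHom_x, permHom_x] at this
  have h1 := LinearMap.congr_fun (congrArg Subtype.val this) (1 : MvPolynomial (Fin n) K)
  simpa [x, opX] using h1

theorem permHom_conj_torusHom (τ : Equiv.Perm (Fin n)) (t : Fin n → Kˣ) :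
    permHom K n τ * torusHom K n t * (permHom K n τ)⁻¹ = torusHom K n (t ∘ τ.symm) := by
  rw [mul_inv_eq_iff_eq_mul]
  refine AlgEquiv.ext fun a => ?_
  rw [AlgEquiv.mul_apply, AlgEquiv.mul_apply]
  induction a using alg_induction with
  | hx i => simp [torusHom_x, permHom_x]
  | hd i => simp [torusHom_der, permHom_der]
  | hh i => simp [torusHom_hinv, permHom_hinv]
  | hc c => simp only [AlgEquiv.commutes]
  | ha a b h₁ h₂ => simp only [map_add, h₁, h₂]
  | hm a b h₁ h₂ => simp only [map_mul, h₁, h₂]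

theorem conj_mem_inn (g : 𝔾 K n) {σ : 𝔾 K n} (hσ : σ ∈ innSubgroup K n) :
    g * σ * g⁻¹ ∈ innSubgroup K n := by
  obtain ⟨u, hu⟩ := hσ
  refine ⟨Units.map (g : JacobianAlg K n →* JacobianAlg K n) u, fun a => ?_⟩
  have h1 : g (g⁻¹ a) = a := g.apply_symm_apply a
  rw [AlgEquiv.mul_apply, AlgEquiv.mul_apply, hu, map_mul, map_mul, h1]
  rfl

instance : (innSubgroup K n).Normal := ⟨fun _ hσ g => conj_mem_inn g hσ⟩

variable [CharZero K]

theorem diagAut_eq_iff {c d : diagNormalizer K n} (hcd : diagAut K n c = diagAut K n d) :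
    ∃ k : Kˣ, ∀ α, (c : (Fin n →₀ ℕ) → Kˣ) α = k * (d : (Fin n →₀ ℕ) → Kˣ) α := by
  obtain ⟨k, hk⟩ := eq_smul_of_conj_eq (diagEquiv (c : (Fin n →₀ ℕ) → Kˣ)) (diagEquiv d)
    fun a ha => by
      have := congrArg Subtype.val (AlgEquiv.congr_fun hcd ⟨a, ha⟩)
      exact this
  refine ⟨k, fun α => Units.ext ?_⟩
  have := congrArg (coeff α) (hk (monomial α 1))
  simpa [smul_monomial] using this

theorem factWeight_mem (i : Fin n) : factWeight K i ∈ diagNormalizer K n := fun a ha =>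
  ⟨(etaTheta K i ⟨a, ha⟩).2, ((etaTheta K i).symm ⟨a, ha⟩).2⟩

/-- The weight `α ↦ α_i!` as an element of `diagNormalizer`. -/
noncomputable def factElt (K : Type*) [Field K] [CharZero K] {n : ℕ} (i : Fin n) :
    diagNormalizer K n :=
  ⟨factWeight K i, factWeight_mem i⟩

theorem etaTheta_eq_diagAut (i : Fin n) : etaTheta K i = diagAut K n (factElt K i) := rfl

/-- The weights `α ↦ ∏ α_i! ^ m_i`. -/
noncomputable def xiWeight (K : Type*) [Field K] [CharZero K] (n : ℕ) :
    Multiplicative (Fin n → ℤ) →* diagNormalizer K n where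
  toFun m := ∏ i, factElt K i ^ (m.toAdd i)
  map_one' := by simp
  map_mul' m m' := by simp [zpow_add, Finset.prod_mul_distrib]

theorem xiWeight_apply (m : Multiplicative (Fin n → ℤ)) (α : Fin n →₀ ℕ) :
    (xiWeight K n m : (Fin n →₀ ℕ) → Kˣ) α = ∏ i, factWeight K i α ^ (m.toAdd i) := by
  simp [xiWeight, factElt]

theorem xiWeight_single (i : Fin n) :
    xiWeight K n (Multiplicative.ofAdd (Pi.single i 1)) = factElt K i := by
  change ∏ j, factElt K j ^ ((Pi.single i 1 : Fin n → ℤ) j) = _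
  rw [Finset.prod_eq_single i]
  · simp
  · intro j _ hj; simp [hj]
  · simp

/-- The parametrisation of `Ξ_n` by `ℤ^n`. -/
noncomputable def xiHom (K : Type*) [Field K] [CharZero K] (n : ℕ) :
    Multiplicative (Fin n → ℤ) →* 𝔾 K n :=
  (diagAut K n).comp (xiWeight K n)

theorem xiHom_single (i : Fin n) :
    xiHom K n (Multiplicative.ofAdd (Pi.single i 1)) = etaTheta K i := by
  rw [xiHom, MonoidHom.comp_apply, xiWeight_single, etaTheta_eq_diagAut]

theorem range_xiHom : (xiHom K n).range = xiSubgroup K n := by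
  refine le_antisymm ?_ ?_
  · rintro _ ⟨m, rfl⟩
    have h1 : ∏ i, factElt K i ^ (m.toAdd i) ∈
        Subgroup.closure (Set.range (factElt K (n := n))) :=
      Subgroup.prod_mem _ fun i _ =>
        Subgroup.zpow_mem _ (Subgroup.subset_closure (Set.mem_range_self i)) _
    have h2 := Subgroup.mem_map_of_mem (diagAut K n) h1
    rw [MonoidHom.map_closure, ← Set.range_comp] at h2
    exact h2
  · rw [xiSubgroup, Subgroup.closure_le]
    rintro _ ⟨i, rfl⟩
    exact ⟨Multiplicative.ofAdd (Pi.single i 1), xiHom_single i⟩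

theorem torus_xi_unique {t : Fin n → Kˣ} {m : Multiplicative (Fin n → ℤ)}
    (htm : torusHom K n t = xiHom K n m) : t = 1 ∧ m = 1 := by
  rw [torusHom_eq_diagAut, xiHom, MonoidHom.comp_apply] at htm
  obtain ⟨k, hk⟩ := diagAut_eq_iff htm
  simp only [xiWeight_apply] at hk
  -- Three test exponents decide everything: at `0` both weights are `1`, at `e_i` all factorials
  -- are `1` and only `t_i` survives, and at `2 e_i` what remains is `2 ^ m_i = 1`.
  have h0 : k = 1 := by
    have := hk 0
    simp [torusWeight, factWeight] at this
    exact this.symm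
  have h1 : ∀ i, t i = 1 := fun i => by
    have := hk (Finsupp.single i 1)
    rw [torusWeight_single, h0, one_mul] at this
    rw [this]
    refine Finset.prod_eq_one fun j _ => ?_
    have : factWeight K j (Finsupp.single i 1) = 1 := Units.ext <| by
      by_cases hj : i = j
      · subst hj; simp [factWeight]
      · simp [factWeight, hj]
    rw [this, one_zpow]
  refine ⟨funext h1, ?_⟩
  have h2 : ∀ i, m.toAdd i = 0 := fun i => by
    have := hk (Finsupp.single i 2)
    have ht : torusWeight t (Finsupp.single i 2) = 1 := by simp [torusWeight, h1]
    rw [ht, h0, one_mul, Finset.prod_eq_single i] at this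
    · have h3 := congrArg Units.val this
      have h4 : ((factWeight K i (Finsupp.single i 2) : Kˣ) : K) = ((2 : ℚ) : K) := by
        simp [factWeight]
      rw [Units.val_zpow_eq_zpow_val, h4] at h3
      -- The equation is pulled back to `ℚ`, where the order shows that `2 ^ m = 1` only for `m =
      -- 0`.
      have h5 : (1 : ℚ) = 2 ^ (m.toAdd i) := by
        apply Rat.cast_injective (α := K)
        push_cast
        push_cast at h3
        exact_mod_cast h3
      exact (zpow_eq_one_iff_right₀ (by norm_num) (by norm_num)).1 h5.symm
    · intro j _ hj
      have : factWeight K j (Finsupp.single i 2) = 1 := Units.ext <| by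
        simp [factWeight, hj]
      rw [this, one_zpow]
    · simp
  exact Multiplicative.toAdd.injective (funext h2)

theorem torusHom_injective : Function.Injective (torusHom K n) :=
  (injective_iff_map_eq_one _).2 fun _ ht =>
    (torus_xi_unique (m := 1) (ht.trans (map_one _).symm)).1

theorem xiHom_injective : Function.Injective (xiHom K n) :=
  (injective_iff_map_eq_one _).2 fun _ hm =>
    (torus_xi_unique (t := 1) ((map_one _).trans hm.symm)).2

theorem exists_xiEquiv : ∃ e : Multiplicative (Fin n → ℤ) ≃* xiSubgroup K n,
    ∀ i : Fin n, (e (Multiplicative.ofAdd (Pi.single i 1)) : 𝔾 K n) = etaTheta K i :=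
  ⟨(MonoidHom.ofInjective xiHom_injective).trans (MulEquiv.subgroupCongr range_xiHom),
    fun i => xiHom_single i⟩

theorem torusHom_mul_xiHom_comm (t : Fin n → Kˣ) (m : Multiplicative (Fin n → ℤ)) :
    torusHom K n t * xiHom K n m = xiHom K n m * torusHom K n t := by
  rw [torusHom_eq_diagAut, xiHom, MonoidHom.comp_apply, ← map_mul, ← map_mul, mul_comm]

theorem mem_torus_sup_xi {g : 𝔾 K n} :
    g ∈ torusSubgroup K n ⊔ xiSubgroup K n ↔ ∃ t m, g = torusHom K n t * xiHom K n m := by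
  rw [← range_xiHom]
  constructor
  · intro hg
    let f : (Fin n → Kˣ) × Multiplicative (Fin n → ℤ) →* 𝔾 K n :=
      (torusHom K n).noncommCoprod (xiHom K n) torusHom_mul_xiHom_comm
    have h1 : torusSubgroup K n ⊔ (xiHom K n).range ≤ f.range := by
      refine sup_le ?_ ?_
      · rintro _ ⟨t, rfl⟩; exact ⟨(t, 1), by
        change torusHom K n t * xiHom K n 1 = _
        rw [map_one, mul_one]⟩
      · rintro _ ⟨m, rfl⟩; exact ⟨(1, m), by
        change torusHom K n 1 * xiHom K n m = _
        rw [map_one, one_mul]⟩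
    obtain ⟨⟨t, m⟩, rfl⟩ := h1 hg
    exact ⟨t, m, rfl⟩
  · rintro ⟨t, m, rfl⟩
    exact mul_mem (Subgroup.mem_sup_left ⟨t, rfl⟩) (Subgroup.mem_sup_right ⟨m, rfl⟩)

theorem isDirect_torus_xi :
    IsDirect (torusSubgroup K n ⊔ xiSubgroup K n) (torusSubgroup K n) (xiSubgroup K n) := by
  refine ⟨le_sup_left, le_sup_right, ?_, ?_, ?_⟩
  · rintro _ ⟨t, rfl⟩ b hb
    rw [← range_xiHom] at hb
    obtain ⟨m, rfl⟩ := hb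
    exact torusHom_mul_xiHom_comm t m
  · intro g hg
    obtain ⟨t, m, rfl⟩ := mem_torus_sup_xi.1 hg
    exact ⟨_, ⟨t, rfl⟩, _, range_xiHom.le ⟨m, rfl⟩, rfl⟩
  · rw [eq_bot_iff]
    rintro g ⟨⟨t, rfl⟩, hg⟩
    obtain ⟨m, hm⟩ := range_xiHom.ge hg
    rw [(torus_xi_unique hm.symm).1, map_one]
    exact Subgroup.mem_bot.2 rfl

theorem permHom_conj_etaTheta (τ : Equiv.Perm (Fin n)) (i : Fin n) :
    permHom K n τ * etaTheta K i * (permHom K n τ)⁻¹ = etaTheta K (τ i) := by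
  rw [mul_inv_eq_iff_eq_mul]
  refine AlgEquiv.ext fun a => ?_
  rw [AlgEquiv.mul_apply, AlgEquiv.mul_apply]
  induction a using alg_induction with
  | hx j =>
    by_cases hij : i = j
    · subst hij
      simp only [permHom_x, etaTheta_x, map_mul, h_eq, permHom_der]
    · rw [permHom_x, etaTheta_x_of_ne hij, etaTheta_x_of_ne (τ.injective.ne hij), permHom_x]
  | hd j =>
    by_cases hij : i = j
    · subst hij
      simp only [permHom_der, etaTheta_der, map_mul, y, permHom_hinv]
    · rw [permHom_der, etaTheta_der_of_ne hij, etaTheta_der_of_ne (τ.injective.ne hij), permHom_der]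
  | hh j => simp only [permHom_hinv, etaTheta_hinv]
  | hc c => simp only [AlgEquiv.commutes]
  | ha a b h₁ h₂ => simp only [map_add, h₁, h₂]
  | hm a b h₁ h₂ => simp only [map_mul, h₁, h₂]

theorem permHom_conj_mem (τ : Equiv.Perm (Fin n)) {g : 𝔾 K n}
    (hg : g ∈ torusSubgroup K n ⊔ xiSubgroup K n ⊔ innSubgroup K n) :
    permHom K n τ * g * (permHom K n τ)⁻¹ ∈
      torusSubgroup K n ⊔ xiSubgroup K n ⊔ innSubgroup K n := by
  have : torusSubgroup K n ⊔ xiSubgroup K n ⊔ innSubgroup K n ≤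
      (torusSubgroup K n ⊔ xiSubgroup K n ⊔ innSubgroup K n).comap
        (MulAut.conj (permHom K n τ)).toMonoidHom := by
    refine sup_le (sup_le ?_ ?_) ?_
    · rintro _ ⟨t, rfl⟩
      refine Subgroup.mem_sup_left (Subgroup.mem_sup_left ⟨t ∘ τ.symm, ?_⟩)
      exact (permHom_conj_torusHom τ t).symm
    · rw [xiSubgroup, Subgroup.closure_le]
      rintro _ ⟨i, rfl⟩
      refine Subgroup.mem_sup_left (Subgroup.mem_sup_right (Subgroup.subset_closure ⟨τ i, ?_⟩))
      exact (permHom_conj_etaTheta τ i).symm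
    · intro g hg
      exact Subgroup.mem_sup_right (conj_mem_inn _ hg)
  exact this hg

end diag

end JacobianAlgebra

namespace JacobianAlgebra

open MvPolynomial

/-! ### Every automorphism of `𝔸_n` is conjugation by an operator on `P_n` -/

section implement

variable {K : Type*} [Field K] {n : ℕ}

/-- Diagonal operators form a commutative algebra. -/
noncomputable def diagHom (K : Type*) [Field K] (n : ℕ) :
    ((Fin n →₀ ℕ) → K) →ₐ[K] Module.End K (MvPolynomial (Fin n) K) :=
  AlgHom.ofLinearMap
    { toFun := diagOp
      map_add' := fun c d => end_ext fun α => by simp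
      map_smul' := fun c d => end_ext fun α => by simp [smul_monomial] }
    (end_ext fun α => by simp) (fun c d => end_ext fun α => by simp)

theorem mulLeft_mem (f : MvPolynomial (Fin n) K) : LinearMap.mulLeft K f ∈ JacobianAlg K n := by
  induction f using MvPolynomial.induction_on with
  | C a =>
    convert Subalgebra.algebraMap_mem (JacobianAlg K n) a using 1
    exact LinearMap.ext fun p => by simp [C_mul']
  | add p q hp hq =>
    convert add_mem hp hq using 1
    exact LinearMap.ext fun r => add_mul p q r
  | mul_X p i hp => rw [LinearMap.mulLeft_mul]; exact mul_mem hp (opX_mem i)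

/-- Multiplication by a polynomial, as an element of `𝔸_n`. -/
noncomputable def mulElt (f : MvPolynomial (Fin n) K) : JacobianAlg K n :=
  ⟨LinearMap.mulLeft K f, mulLeft_mem f⟩

/-- The projection of `P_n` onto the constants along the other monomials. -/
noncomputable def constProj (K : Type*) [Field K] (n : ℕ) :
    Module.End K (MvPolynomial (Fin n) K) :=
  diagOp fun α => ∏ i, if α i = 0 then 1 else 0

theorem constProj_monomial (α : Fin n →₀ ℕ) :
    constProj K n (monomial α 1) = if α = 0 then 1 else 0 := by
  rw [constProj, diagOp_monomial, mul_one]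
  split_ifs with h0
  · subst h0; simp
  · obtain ⟨i, hi⟩ : ∃ i, α i ≠ 0 := by
      by_contra! hc
      exact h0 (Finsupp.ext hc)
    rw [Finset.prod_eq_zero (Finset.mem_univ i) (if_neg hi), monomial_zero]

theorem constProj_apply (p : MvPolynomial (Fin n) K) : constProj K n p = C (coeff 0 p) := by
  have : constProj K n =
      (Algebra.linearMap K (MvPolynomial (Fin n) K)).comp (lcoeff K 0) :=
    end_ext fun α => by
      rw [constProj_monomial]
      simp [coeff_monomial, algebraMap_eq, apply_ite]
  rw [this]
  rfl

variable [CharZero K]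

/-- The projector is the product over `i` of the commuting diagonal projectors `1 - x_i y_i` onto
the monomials free of `x_i`; `diagHom` turns the product of operators into a product of scalar
functions. -/
theorem constProj_mem : constProj K n ∈ JacobianAlg K n := by
  have h1 : (∏ i : Fin n, fun α : Fin n →₀ ℕ => if α i = 0 then (1 : K) else 0) ∈
      (JacobianAlg K n).comap (diagHom K n) := by
    refine prod_mem fun i _ => ?_
    have : diagOp (fun α : Fin n →₀ ℕ => if α i = 0 then (1 : K) else 0) =
        1 - opX K i * (opHinv K i * opD K i) := end_ext fun α => by
      rw [diagOp_monomial, LinearMap.sub_apply, Module.End.mul_apply, opY_monomial]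
      split_ifs with h0
      · simp
      · have h2 : (α - Finsupp.single i 1) + Finsupp.single i 1 = α := by
          ext j
          by_cases hj : i = j
          · subst hj; simp; omega
          · simp [hj]
        simp [h2]
    change diagOp (fun α : Fin n →₀ ℕ => if α i = 0 then (1 : K) else 0) ∈ JacobianAlg K n
    rw [this]
    exact sub_mem (one_mem _) (mul_mem (opX_mem i) (mul_mem (opHinv_mem i) (opD_mem i)))
  have h2 : (∏ i : Fin n, fun α : Fin n →₀ ℕ => if α i = 0 then (1 : K) else 0) =
      fun α => ∏ i, if α i = 0 then 1 else 0 := by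
    ext α; simp
  rw [h2] at h1
  exact h1

/-- Lowering operators: `x^γ ↦ x^{γ - α}`, which is zero unless `α ≤ γ`. -/
theorem exists_lowering (α : Fin n →₀ ℕ) : ∃ a ∈ JacobianAlg K n, ∀ γ,
    a (monomial γ 1) = if α ≤ γ then monomial (γ - α) 1 else 0 := by
  induction α using Finsupp.induction_linear with
  | zero => exact ⟨1, one_mem _, fun γ => by simp⟩
  | add α β hα hβ =>
    obtain ⟨a, ha, haγ⟩ := hα
    obtain ⟨b, hb, hbγ⟩ := hβ
    refine ⟨b * a, mul_mem hb ha, fun γ => ?_⟩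
    rw [Module.End.mul_apply, haγ]
    by_cases h1 : α ≤ γ
    · rw [if_pos h1, hbγ, tsub_tsub]
      have : β ≤ γ - α ↔ α + β ≤ γ := le_tsub_iff_left h1
      simp [this]
    · have : ¬ α + β ≤ γ := fun h2 => h1 (le_self_add.trans h2)
      simp [h1, this]
  | single i k =>
    induction k with
    | zero => exact ⟨1, one_mem _, fun γ => by simp⟩
    | succ k ih =>
      obtain ⟨a, ha, haγ⟩ := ih
      refine ⟨(opHinv K i * opD K i) * a, mul_mem (mul_mem (opHinv_mem i) (opD_mem i)) ha,
        fun γ => ?_⟩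
      rw [Module.End.mul_apply, haγ]
      simp only [Finsupp.single_le_iff]
      by_cases h1 : k ≤ γ i
      · rw [if_pos h1, opY_monomial, tsub_tsub, ← Finsupp.single_add]
        by_cases h2 : k + 1 ≤ γ i
        · rw [if_pos h2, if_neg]
          simp; omega
        · rw [if_neg h2, if_pos]
          simp; omega
      · rw [if_neg h1, map_zero, if_neg (by omega)]

/-- Lower by an exponent `α` in the support of `f`, project onto constants, and rescale: only the
`α`-term contributes. This is the simplicity of `P_n` as an `𝔸_n`-module in explicit form. -/
theorem exists_apply_eq_one {f : MvPolynomial (Fin n) K} (hf : f ≠ 0) :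
    ∃ a : JacobianAlg K n, (a : Module.End K (MvPolynomial (Fin n) K)) f = 1 := by
  obtain ⟨α, hα⟩ := MvPolynomial.ne_zero_iff.1 hf
  obtain ⟨b, hb, hbγ⟩ := exists_lowering (K := K) α
  have h1 : (lcoeff K 0).comp b = lcoeff (R := K) α := by
    refine (basisMonomials (Fin n) K).ext fun γ => ?_
    simp only [coe_basisMonomials, LinearMap.comp_apply, hbγ, lcoeff_apply, coeff_monomial]
    by_cases h2 : γ = α
    · subst h2; simp
    · rw [if_neg h2]
      split_ifs with h3
      · rw [coeff_monomial, if_neg]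
        intro h4
        exact h2 (le_antisymm (tsub_eq_zero_iff_le.1 h4) h3)
      · simp
  refine ⟨(coeff α f)⁻¹ • (⟨constProj K n, constProj_mem⟩ * ⟨b, hb⟩), ?_⟩
  have h2 : coeff 0 (b f) = coeff α f := LinearMap.congr_fun h1 f
  change (coeff α f)⁻¹ • constProj K n (b f) = 1
  rw [constProj_apply, h2, smul_eq_C_mul, ← C_mul, inv_mul_cancel₀ hα, C_1]

/-- With `e` the projector onto constants, `f ↦ f e` identifies `P_n` with the left ideal `𝔸_n e`.
The twisted module is reached by choosing `v ≠ 0` in the image of `σ e` and sending `f` to `σ(f) v`;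
bijectivity comes from moving a nonzero `f`, respectively `v`, to `1`. -/
theorem exists_conj (σ : 𝔾 K n) :
    ∃ φ : MvPolynomial (Fin n) K ≃ₗ[K] MvPolynomial (Fin n) K, ∀ a : JacobianAlg K n,
      (σ a : Module.End K (MvPolynomial (Fin n) K)) = φ.conjAlgEquiv K a := by
  let e : JacobianAlg K n := ⟨constProj K n, constProj_mem⟩
  have he0 : e ≠ 0 := fun h0 => by
    have := LinearMap.congr_fun (congrArg Subtype.val h0) (1 : MvPolynomial (Fin n) K)
    change constProj K n 1 = 0 at this
    simp [constProj_apply] at this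
  have hp0 : (σ e : Module.End K (MvPolynomial (Fin n) K)) ≠ 0 := fun h0 =>
    he0 (σ.injective ((Subtype.ext h0).trans (map_zero σ).symm))
  obtain ⟨w, hw⟩ : ∃ w, (σ e : Module.End K (MvPolynomial (Fin n) K)) w ≠ 0 := by
    by_contra! hc
    exact hp0 (LinearMap.ext hc)
  let v := (σ e : Module.End K (MvPolynomial (Fin n) K)) w
  have hmul : ∀ (a b : JacobianAlg K n) (p : MvPolynomial (Fin n) K),
      ((a * b : JacobianAlg K n) : Module.End K (MvPolynomial (Fin n) K)) p =
        (a : Module.End K (MvPolynomial (Fin n) K)) ((b : Module.End K _) p) :=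
    fun a b p => rfl
  let Φ : MvPolynomial (Fin n) K →ₗ[K] MvPolynomial (Fin n) K :=
    { toFun := fun f => (σ (mulElt f) : Module.End K (MvPolynomial (Fin n) K)) v
      map_add' := fun f g => by
        have : mulElt (f + g) = mulElt f + mulElt g :=
          Subtype.ext (LinearMap.ext fun p => add_mul f g p)
        rw [this, map_add]
        rfl
      map_smul' := fun c f => by
        have : mulElt (c • f) = c • mulElt f :=
          Subtype.ext (LinearMap.ext fun p => smul_mul_assoc c f p)
        rw [this, map_smul]
        rfl }
  have hΦ : ∀ (a : JacobianAlg K n) (f : MvPolynomial (Fin n) K),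
      Φ ((a : Module.End K (MvPolynomial (Fin n) K)) f) =
        (σ a : Module.End K (MvPolynomial (Fin n) K)) (Φ f) := by
    intro a f
    -- The image of `e` consists of constants, which pass through `a`; this is why `Φ` intertwines
    -- `a` with `σ a`.
    have h1 : a * mulElt f * e = mulElt ((a : Module.End K (MvPolynomial (Fin n) K)) f) * e := by
      refine Subtype.ext (LinearMap.ext fun p => ?_)
      change (a : Module.End K (MvPolynomial (Fin n) K)) (f * constProj K n p) =
        (a : Module.End K (MvPolynomial (Fin n) K)) f * constProj K n p
      rw [constProj_apply, mul_comm f, C_mul', map_smul, mul_comm, C_mul']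
    have h2 := LinearMap.congr_fun (congrArg Subtype.val (congrArg σ h1)) w
    rw [map_mul, map_mul, map_mul, hmul, hmul, hmul] at h2
    exact h2.symm
  have hΦ1 : Φ 1 = v := by
    have : mulElt (1 : MvPolynomial (Fin n) K) = 1 :=
      Subtype.ext (LinearMap.ext fun p => one_mul p)
    change (σ (mulElt 1) : Module.End K (MvPolynomial (Fin n) K)) v = v
    rw [this, map_one]
    rfl
  have hinj : Function.Injective Φ := by
    refine (injective_iff_map_eq_zero Φ).2 fun f hf => ?_
    by_contra h0
    obtain ⟨a, ha⟩ := exists_apply_eq_one h0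
    have := hΦ a f
    rw [ha, hf, map_zero, hΦ1] at this
    exact hw this
  have hsurj : Function.Surjective Φ := by
    intro q
    obtain ⟨a, ha⟩ := exists_apply_eq_one hw
    refine ⟨((σ.symm (mulElt q * a) : JacobianAlg K n) :
      Module.End K (MvPolynomial (Fin n) K)) 1, ?_⟩
    rw [hΦ, hΦ1, AlgEquiv.apply_symm_apply, hmul, ha]
    exact mul_one q
  refine ⟨LinearEquiv.ofBijective Φ ⟨hinj, hsurj⟩, fun a => LinearMap.ext fun p => ?_⟩
  obtain ⟨f, rfl⟩ := hsurj p
  rw [← hΦ]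
  have h1 : (LinearEquiv.ofBijective Φ ⟨hinj, hsurj⟩).symm (Φ f) = f :=
    LinearEquiv.ofBijective_symm_apply_apply _ _
  rw [LinearEquiv.conjAlgEquiv_apply]
  change _ = Φ ((a : Module.End K (MvPolynomial (Fin n) K))
    ((LinearEquiv.ofBijective Φ ⟨hinj, hsurj⟩).symm (Φ f)))
  rw [h1]

end implement

end JacobianAlgebra

namespace JacobianAlgebra

open MvPolynomial Filter

/-! ### Monomials indexed by `ℤ^n` -/

section monZ

variable {K : Type*} [Field K] {n : ℕ}

/-- The exponent with coordinates `max (γ_i) 0`. -/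
noncomputable def natExp (γ : Fin n → ℤ) : Fin n →₀ ℕ :=
  Finsupp.equivFunOnFinite.symm fun i => (γ i).toNat

@[simp] theorem natExp_apply (γ : Fin n → ℤ) (i : Fin n) : natExp γ i = (γ i).toNat := rfl

/-- The monomial `x^γ` for `γ ∈ ℤ^n`, with the convention that it is zero unless `0 ≤ γ`. -/
noncomputable def monZ (K : Type*) [Field K] {n : ℕ} (γ : Fin n → ℤ) : MvPolynomial (Fin n) K :=
  open Classical in if 0 ≤ γ then monomial (natExp γ) 1 else 0

theorem monZ_of_nonneg {γ : Fin n → ℤ} (hγ : 0 ≤ γ) : monZ K γ = monomial (natExp γ) 1 :=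
  if_pos hγ

theorem monZ_of_not {γ : Fin n → ℤ} (hγ : ¬ 0 ≤ γ) : monZ K γ = 0 := if_neg hγ

theorem natExp_natCast (α : Fin n →₀ ℕ) : natExp (fun i => (α i : ℤ)) = α := by
  ext i; simp

theorem monomial_eq_monZ (α : Fin n →₀ ℕ) : monomial α (1 : K) = monZ K fun i => (α i : ℤ) := by
  rw [monZ_of_nonneg (fun i => by simp), natExp_natCast]

theorem natExp_inj {γ δ : Fin n → ℤ} (hγ : 0 ≤ γ) (hδ : 0 ≤ δ) (hγδ : natExp γ = natExp δ) :
    γ = δ := by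
  ext i
  have h1 := DFunLike.congr_fun hγδ i
  have h2 := hγ i
  have h3 := hδ i
  simp at h1 h2 h3
  omega

theorem coeff_monZ {δ : Fin n → ℤ} (hδ : 0 ≤ δ) (γ : Fin n → ℤ) :
    coeff (natExp δ) (monZ K γ) = if γ = δ then 1 else 0 := by
  by_cases hγ : 0 ≤ γ
  · rw [monZ_of_nonneg hγ, coeff_monomial]
    exact if_congr ⟨natExp_inj hγ hδ, congrArg _⟩ rfl rfl
  · rw [monZ_of_not hγ, coeff_zero, if_neg]
    rintro rfl
    exact hγ hδ

theorem monZ_ne_zero {γ : Fin n → ℤ} (hγ : 0 ≤ γ) : monZ K γ ≠ 0 := by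
  rw [monZ_of_nonneg hγ]; simp

theorem monZ_smul_inj {γ δ : Fin n → ℤ} {c d : K} (hγ : 0 ≤ γ) (hc : c ≠ 0)
    (hcd : c • monZ K γ = d • monZ K δ) : γ = δ ∧ c = d := by
  have h1 := congrArg (coeff (natExp γ)) hcd
  rw [coeff_smul, coeff_smul, coeff_monZ hγ, coeff_monZ hγ, if_pos rfl, smul_eq_mul, mul_one] at h1
  by_cases h2 : δ = γ
  · exact ⟨h2.symm, by simpa [h2] using h1⟩
  · simp [h2, hc] at h1

/-- Nonnegativity matters here: if `γ_i = -1` the left side is zero while `γ + e_i` may be a genuine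
exponent. -/
theorem opX_monZ (i : Fin n) {γ : Fin n → ℤ} (hγ : 0 ≤ γ) :
    opX K i (monZ K γ) = monZ K (γ + Pi.single i 1) := by
  have h1 : 0 ≤ γ + Pi.single i 1 := add_nonneg hγ (by simp)
  rw [monZ_of_nonneg hγ, monZ_of_nonneg h1, opX_monomial]
  congr 2
  ext j
  have := hγ j
  by_cases hj : i = j
  · subst hj; simp at this ⊢; omega
  · simp [hj]

/-- No sign condition is needed: when lowering leaves the nonnegative cone, the coefficient `γ_i`
vanishes. -/
theorem opD_monZ (i : Fin n) (γ : Fin n → ℤ) :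
    opD K i (monZ K γ) = (γ i : K) • monZ K (γ - Pi.single i 1) := by
  by_cases hγ : 0 ≤ γ
  · rw [monZ_of_nonneg hγ, opD_monomial]
    have h2 := hγ i
    simp only [Pi.zero_apply] at h2
    by_cases h0 : γ i = 0
    · simp [h0]
    · have h1 : 0 ≤ γ - Pi.single i 1 := fun j => by
        have := hγ j
        by_cases hj : i = j
        · subst hj; simp at this ⊢; omega
        · simpa [hj] using this
      have h3 : ((γ i).toNat : K) = (γ i : K) := by
        rw [← Int.cast_natCast, Int.toNat_of_nonneg h2]
      rw [monZ_of_nonneg h1, smul_monomial, natExp_apply, h3, one_mul, smul_eq_mul, mul_one]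
      congr 1
      refine congrArg _ (Finsupp.ext fun j => ?_)
      by_cases hj : i = j
      · subst hj; simp
      · simp [hj]
  · rw [monZ_of_not hγ, map_zero, monZ_of_not, smul_zero]
    intro h1
    exact hγ (h1.trans (by simp))

theorem opHinv_monZ (i : Fin n) (γ : Fin n → ℤ) :
    opHinv K i (monZ K γ) = ((γ i : K) + 1)⁻¹ • monZ K γ := by
  by_cases hγ : 0 ≤ γ
  · have h2 := hγ i
    have h3 : ((γ i).toNat : K) = (γ i : K) := by
      rw [← Int.cast_natCast, Int.toNat_of_nonneg h2]
    rw [monZ_of_nonneg hγ, opHinv_monomial, smul_monomial, natExp_apply, h3, smul_eq_mul]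
  · rw [monZ_of_not hγ, map_zero, smul_zero]

end monZ

/-! ### Eventually rational functions on `ℤ^n` -/

section rational

theorem eventually_shift {n : ℕ} {p : (Fin n → ℤ) → Prop} (hp : ∀ᶠ α in atTop, p α)
    (β : Fin n → ℤ) : ∀ᶠ α in atTop, p (α + β) :=
  (tendsto_atTop_add_const_right atTop β tendsto_id).eventually hp

variable {K : Type*} [Field K] {n : ℕ}

/-- Products of linear forms `x_k + m` with `m ∈ ℤ`. -/
noncomputable def linForms (K : Type*) [Field K] (n : ℕ) : Submonoid (MvPolynomial (Fin n) K) :=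
  Submonoid.closure {p | ∃ (k : Fin n) (m : ℤ), p = X k + C (m : K)}

/-- Evaluation at an integral point. -/
noncomputable def evalZ (K : Type*) [Field K] {n : ℕ} (α : Fin n → ℤ) :
    MvPolynomial (Fin n) K →+* K :=
  eval fun i => (α i : K)

/-- `f` agrees far out with a rational function whose denominator is a product of forms `x_k + m`
with `m ∈ ℤ`. -/
def IsRat (f : (Fin n → ℤ) → K) : Prop :=
  ∃ p, ∃ q ∈ linForms K n, ∀ᶠ α in atTop, evalZ K α q * f α = evalZ K α p

theorem IsRat.congr {f g : (Fin n → ℤ) → K} (hf : IsRat f) (hfg : ∀ᶠ α in atTop, f α = g α) :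
    IsRat g := by
  obtain ⟨p, q, hq, h1⟩ := hf
  refine ⟨p, q, hq, ?_⟩
  filter_upwards [h1, hfg] with α h1 h2
  rw [← h2, h1]

theorem isRat_evalZ (p : MvPolynomial (Fin n) K) : IsRat fun α => evalZ K α p :=
  ⟨p, 1, one_mem _, by simp⟩

theorem isRat_const (c : K) : IsRat fun _ : Fin n → ℤ => c := by
  simpa [evalZ] using isRat_evalZ (n := n) (C c)

theorem IsRat.add {f g : (Fin n → ℤ) → K} (hf : IsRat f) (hg : IsRat g) :
    IsRat fun α => f α + g α := by
  obtain ⟨p, q, hq, h1⟩ := hf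
  obtain ⟨p', q', hq', h2⟩ := hg
  refine ⟨q' * p + q * p', q * q', mul_mem hq hq', ?_⟩
  filter_upwards [h1, h2] with α h1 h2
  rw [map_add, map_mul, map_mul, map_mul, ← h1, ← h2]
  ring

theorem IsRat.mul {f g : (Fin n → ℤ) → K} (hf : IsRat f) (hg : IsRat g) :
    IsRat fun α => f α * g α := by
  obtain ⟨p, q, hq, h1⟩ := hf
  obtain ⟨p', q', hq', h2⟩ := hg
  refine ⟨p * p', q * q', mul_mem hq hq', ?_⟩
  filter_upwards [h1, h2] with α h1 h2
  rw [map_mul, map_mul, ← h1, ← h2]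
  ring

theorem isRat_sum {ι : Type*} (s : Finset ι) {f : ι → (Fin n → ℤ) → K}
    (hf : ∀ i ∈ s, IsRat (f i)) : IsRat fun α => ∑ i ∈ s, f i α := by
  classical
  induction s using Finset.induction_on with
  | empty => simpa using isRat_const (n := n) (0 : K)
  | insert a s ha ih =>
    simp only [Finset.sum_insert ha]
    exact (hf a (by simp)).add (ih fun i hi => hf i (by simp [hi]))

theorem IsRat.shift {f : (Fin n → ℤ) → K} (hf : IsRat f) (β : Fin n → ℤ) :
    IsRat fun α => f (α + β) := by
  obtain ⟨p, q, hq, h1⟩ := hf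
  let T : MvPolynomial (Fin n) K →ₐ[K] MvPolynomial (Fin n) K :=
    aeval fun i => X i + C (β i : K)
  have hT : ∀ (α) (r : MvPolynomial (Fin n) K), evalZ K α (T r) = evalZ K (α + β) r := by
    intro α r
    induction r using MvPolynomial.induction_on with
    | C a => simp [T, evalZ]
    | add r s hr hs => simp only [map_add, hr, hs]
    | mul_X r i hr => rw [map_mul, map_mul, map_mul, hr]; simp [T, evalZ]
  refine ⟨T p, T q, ?_, ?_⟩
  · have : linForms K n ≤ (linForms K n).comap T := by
      rw [linForms, Submonoid.closure_le]
      rintro _ ⟨k, m, rfl⟩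
      refine Submonoid.subset_closure ⟨k, β k + m, ?_⟩
      simp [T, add_assoc]
    exact this hq
  · filter_upwards [eventually_shift h1 β] with α h1
    rw [hT, hT, h1]

variable [CharZero K]

theorem isRat_inv (k : Fin n) (m : ℤ) : IsRat fun α : Fin n → ℤ => ((α k : K) + m)⁻¹ := by
  refine ⟨1, X k + C (m : K), Submonoid.subset_closure ⟨k, m, rfl⟩, ?_⟩
  filter_upwards [eventually_ge_atTop fun _ => 1 - m] with α hα
  have h1 : (α k : K) + m ≠ 0 := by
    have : 1 - m ≤ α k := hα k
    have : α k + m ≠ 0 := by omega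
    exact_mod_cast this
  simp [evalZ, h1]

/-- The reason for restricting denominators: a form such as `x_1 - x_2` has zeros arbitrarily far
out, whereas `x_k + m` is nonzero as soon as `α_k ≥ 1 - m`. -/
theorem evalZ_linForms_ne_zero {q : MvPolynomial (Fin n) K} (hq : q ∈ linForms K n) :
    ∀ᶠ α in atTop, evalZ K α q ≠ 0 := by
  induction hq using Submonoid.closure_induction with
  | mem q hq =>
    obtain ⟨k, m, rfl⟩ := hq
    filter_upwards [eventually_ge_atTop fun _ => 1 - m] with α hα
    have : 1 - m ≤ α k := hα k
    have : α k + m ≠ 0 := by omega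
    simp only [evalZ, map_add, eval_X, eval_C]
    exact_mod_cast this
  | one => simp
  | mul p q _ _ hp hq =>
    filter_upwards [hp, hq] with α hp hq
    rw [map_mul]
    exact mul_ne_zero hp hq

theorem eq_zero_of_evalZ {p : MvPolynomial (Fin n) K} (hp : ∀ᶠ α in atTop, evalZ K α p = 0) :
    p = 0 := by
  obtain ⟨c, hc⟩ := eventually_atTop.1 hp
  refine funext_set (fun i => (fun m : ℤ => (m : K)) '' Set.Ici (c i)) ?_ ?_
  · intro i
    exact (Set.Ici_infinite (c i)).image (Int.cast_injective.injOn)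
  · intro v hv
    choose α hα using fun i => hv i (Set.mem_univ i)
    have : v = fun i => (α i : K) := funext fun i => (hα i).2.symm
    rw [this, map_zero]
    exact hc α fun i => (hα i).1

/-- A polynomial vanishing far out vanishes on a product of infinite sets, hence is zero. So the
numerators multiply to zero in a domain. -/
theorem IsRat.eventually_zero_or {f g : (Fin n → ℤ) → K} (hf : IsRat f) (hg : IsRat g)
    (hfg : ∀ᶠ α in atTop, f α * g α = 0) :
    (∀ᶠ α in atTop, f α = 0) ∨ ∀ᶠ α in atTop, g α = 0 := by
  obtain ⟨p, q, hq, h1⟩ := hf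
  obtain ⟨p', q', hq', h2⟩ := hg
  have h3 : p * p' = 0 := eq_zero_of_evalZ <| by
    filter_upwards [h1, h2, hfg] with α h1 h2 h3
    rw [map_mul, ← h1, ← h2, mul_mul_mul_comm, h3, mul_zero]
  rcases mul_eq_zero.1 h3 with rfl | rfl
  · left
    filter_upwards [h1, evalZ_linForms_ne_zero hq] with α h1 h4
    rw [map_zero] at h1
    exact (mul_eq_zero.1 h1).resolve_left h4
  · right
    filter_upwards [h2, evalZ_linForms_ne_zero hq'] with α h1 h4
    rw [map_zero] at h1
    exact (mul_eq_zero.1 h1).resolve_left h4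

end rational

/-! ### Symbols: the behaviour of elements of `𝔸_n` far out -/

section symbol

variable {K : Type*} [Field K] {n : ℕ}

/-- Far out, `a` acts by `x^α ↦ ∑ f_β(α) x^{α + β}`. -/
def HasSymbol (a : Module.End K (MvPolynomial (Fin n) K)) (S : Finset (Fin n → ℤ))
    (f : (Fin n → ℤ) → (Fin n → ℤ) → K) : Prop :=
  (∀ β, IsRat (f β)) ∧
    ∀ᶠ α in atTop, a (monZ K α) = ∑ β ∈ S, f β α • monZ K (α + β)

theorem exists_hasSymbol_of_sum {a : Module.End K (MvPolynomial (Fin n) K)} {ι : Type*}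
    (s : Finset ι) (b : ι → Fin n → ℤ) (f : ι → (Fin n → ℤ) → K) (hf : ∀ i, IsRat (f i))
    (ha : ∀ᶠ α in atTop, a (monZ K α) = ∑ i ∈ s, f i α • monZ K (α + b i)) :
    ∃ S g, HasSymbol a S g := by
  classical
  refine ⟨s.image b, fun β α => ∑ i ∈ s with b i = β, f i α, fun β => isRat_sum _ fun i _ => hf i, ?_⟩
  filter_upwards [ha] with α ha
  rw [ha, ← Finset.sum_fiberwise_of_maps_to (g := b) (t := s.image b)
    (fun i hi => Finset.mem_image_of_mem b hi)]
  refine Finset.sum_congr rfl fun β _ => ?_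
  rw [Finset.sum_smul]
  refine Finset.sum_congr rfl fun i hi => ?_
  rw [(Finset.mem_filter.1 hi).2]

theorem exists_hasSymbol_single {a : Module.End K (MvPolynomial (Fin n) K)} (β : Fin n → ℤ)
    {f : (Fin n → ℤ) → K} (hf : IsRat f)
    (ha : ∀ᶠ α in atTop, a (monZ K α) = f α • monZ K (α + β)) : ∃ S g, HasSymbol a S g :=
  exists_hasSymbol_of_sum (Finset.univ : Finset Unit) (fun _ => β) (fun _ => f) (fun _ => hf)
    (by simpa using ha)

/-- Comparison of the coefficients of `x^{α+δ}` in `a b x^α = x^α`, for `α` so far out that `α + δ`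
is still nonnegative. -/
theorem HasSymbol.mul_eq_one {a b : Module.End K (MvPolynomial (Fin n) K)}
    {S T : Finset (Fin n → ℤ)} {f g : (Fin n → ℤ) → (Fin n → ℤ) → K} (ha : HasSymbol a S f)
    (hb : HasSymbol b T g) (hab : a * b = 1) (δ : Fin n → ℤ) :
    ∀ᶠ α in atTop, ∑ p ∈ S ×ˢ T with p.1 + p.2 = δ, f p.1 (α + p.2) * g p.2 α =
      if δ = 0 then 1 else 0 := by
  have h3 : ∀ᶠ α in atTop, ∀ β ∈ T, a (monZ K (α + β)) =
      ∑ γ ∈ S, f γ (α + β) • monZ K (α + β + γ) :=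
    (Finset.eventually_all T).2 fun β _ => eventually_shift ha.2 β
  filter_upwards [hb.2, h3, eventually_shift (eventually_ge_atTop 0) δ] with α h2 h3 h4
  have h5 : a (b (monZ K α)) = monZ K α := LinearMap.congr_fun hab _
  rw [h2, map_sum] at h5
  have h6 := congrArg (coeff (natExp (α + δ))) h5
  rw [coeff_monZ h4, coeff_sum] at h6
  have h7 : (α = α + δ) ↔ δ = 0 := by simp
  rw [if_congr h7 rfl rfl] at h6
  rw [← h6, Finset.sum_filter, Finset.sum_product_right]
  refine Finset.sum_congr rfl fun β hβ => ?_
  rw [map_smul, h3 β hβ, coeff_smul, coeff_sum, smul_eq_mul, Finset.mul_sum]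
  refine Finset.sum_congr rfl fun γ _ => ?_
  rw [coeff_smul, coeff_monZ h4]
  have h8 : α + β + γ = α + δ ↔ γ + β = δ := by rw [add_assoc, add_right_inj, add_comm]
  rw [if_congr h8 rfl rfl]
  split_ifs
  · rw [smul_eq_mul, mul_one, mul_comm]
  · rw [smul_zero, mul_zero]

variable [CharZero K]

theorem exists_hasSymbol (a : JacobianAlg K n) :
    ∃ S f, HasSymbol (a : Module.End K (MvPolynomial (Fin n) K)) S f := by
  induction a using alg_induction with
  | hx i =>
    refine exists_hasSymbol_single (Pi.single i 1) (isRat_const 1) ?_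
    filter_upwards [eventually_ge_atTop 0] with α hα
    rw [one_smul]
    exact opX_monZ i hα
  | hd i =>
    refine exists_hasSymbol_single (-Pi.single i 1) (isRat_evalZ (X i)) (.of_forall fun α => ?_)
    rw [← sub_eq_add_neg, evalZ, eval_X]
    exact opD_monZ i α
  | hh i =>
    refine exists_hasSymbol_single 0 (isRat_inv i 1) (.of_forall fun α => ?_)
    rw [add_zero, Int.cast_one]
    exact opHinv_monZ i α
  | hc c =>
    refine exists_hasSymbol_single 0 (isRat_const c) (.of_forall fun α => ?_)
    rw [add_zero]
    rfl
  | ha a b h₁ h₂ =>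
    obtain ⟨S, f, hf, h₁⟩ := h₁
    obtain ⟨T, g, hg, h₂⟩ := h₂
    refine exists_hasSymbol_of_sum (S.disjSum T) (Sum.elim id id) (Sum.elim f g)
      (by rintro (i | i); exacts [hf i, hg i]) ?_
    filter_upwards [h₁, h₂] with α h₁ h₂
    rw [Finset.sum_disjSum]
    exact congrArg₂ (· + ·) h₁ h₂
  | hm a b h₁ h₂ =>
    obtain ⟨S, f, hf, h₁⟩ := h₁
    obtain ⟨T, g, hg, h₂⟩ := h₂
    refine exists_hasSymbol_of_sum (T ×ˢ S) (fun p => p.1 + p.2)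
      (fun p α => g p.1 α * f p.2 (α + p.1)) (fun p => (hg p.1).mul ((hf p.2).shift p.1)) ?_
    have h3 : ∀ᶠ α in atTop, ∀ β ∈ T, (a : Module.End K (MvPolynomial (Fin n) K))
        (monZ K (α + β)) = ∑ γ ∈ S, f γ (α + β) • monZ K (α + β + γ) :=
      (Finset.eventually_all T).2 fun β _ => eventually_shift h₁ β
    filter_upwards [h₂, h3] with α h₂ h3
    change (a : Module.End K (MvPolynomial (Fin n) K))
      ((b : Module.End K (MvPolynomial (Fin n) K)) (monZ K α)) = _
    rw [h₂, map_sum, Finset.sum_product]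
    refine Finset.sum_congr rfl fun β hβ => ?_
    rw [map_smul, h3 β hβ, Finset.smul_sum]
    refine Finset.sum_congr rfl fun γ _ => ?_
    rw [smul_smul, add_assoc]

theorem exists_reduced_symbol (a : JacobianAlg K n) :
    ∃ S f, HasSymbol (a : Module.End K (MvPolynomial (Fin n) K)) S f ∧
      ∀ β ∈ S, ¬ ∀ᶠ α in atTop, f β α = 0 := by
  classical
  obtain ⟨S, f, hf, h1⟩ := exists_hasSymbol a
  refine ⟨S.filter fun β => ¬ ∀ᶠ α in atTop, f β α = 0, f, ⟨hf, ?_⟩,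
    fun β hβ => (Finset.mem_filter.1 hβ).2⟩
  have h2 : ∀ᶠ α in atTop, ∀ β ∈ S.filter (fun β => ∀ᶠ α in atTop, f β α = 0), f β α = 0 :=
    (Finset.eventually_all _).2 fun β hβ => (Finset.mem_filter.1 hβ).2
  filter_upwards [h1, h2] with α h1 h2
  rw [h1, ← Finset.sum_filter_not_add_sum_filter S fun β => ∀ᶠ α in atTop, f β α = 0]
  rw [Finset.sum_eq_zero (s := S.filter fun β => ∀ᶠ α in atTop, f β α = 0), add_zero]
  intro β hβ
  rw [h2 β hβ, zero_smul]

/-- If a product with reduced symbols is `1`, then the symbols have at most one term. -/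
theorem HasSymbol.card_mul_card_le_one {a b : Module.End K (MvPolynomial (Fin n) K)}
    {S T : Finset (Fin n → ℤ)} {f g : (Fin n → ℤ) → (Fin n → ℤ) → K} (ha : HasSymbol a S f)
    (hb : HasSymbol b T g) (hS : ∀ β ∈ S, ¬ ∀ᶠ α in atTop, f β α = 0)
    (hT : ∀ β ∈ T, ¬ ∀ᶠ α in atTop, g β α = 0) (hab : a * b = 1) : S.card * T.card ≤ 1 := by
  by_contra! hc
  -- `ℤ^n` has two unique sums: with more than one pair available, two different pairs have a sum
  -- attained by no other pair.
  obtain ⟨p₁, hp₁, p₂, hp₂, hne, hu₁, hu₂⟩ := TwoUniqueSums.uniqueAdd_of_one_lt_card hc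
  -- At a uniquely attained sum `δ ≠ 0` the coefficient is a single product of nonzero rational
  -- functions, which cannot vanish far out. Hence both unique pairs have sum `0`, and uniqueness
  -- makes them equal.
  have main : ∀ p ∈ S ×ˢ T, UniqueAdd S T p.1 p.2 → p.1 + p.2 = 0 := by
    intro p hp hu
    by_contra h0
    have h4 : ∀ᶠ α in atTop, f p.1 (α + p.2) * g p.2 α = 0 := by
      filter_upwards [ha.mul_eq_one hb hab (p.1 + p.2)] with α h4
      rw [if_neg h0, Finset.sum_eq_single p] at h4
      · exact h4
      · intro q hq hqp
        rw [Finset.mem_filter, Finset.mem_product] at hq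
        exact absurd (Prod.ext_iff.2 (hu hq.1.1 hq.1.2 hq.2)) hqp
      · intro h5
        rw [Finset.mem_filter] at h5
        exact absurd ⟨hp, rfl⟩ h5
    rw [Finset.mem_product] at hp
    rcases ((ha.1 p.1).shift p.2).eventually_zero_or (hb.1 p.2) h4 with h5 | h5
    · refine hS p.1 hp.1 ?_
      filter_upwards [eventually_shift h5 (-p.2)] with α h5
      rwa [neg_add_cancel_right] at h5
    · exact hT p.2 hp.2 h5
  have e1 := main p₁ hp₁ hu₁
  have e2 := main p₂ hp₂ hu₂
  rw [Finset.mem_product] at hp₂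
  exact hne (Prod.ext_iff.2 (hu₁ hp₂.1 hp₂.2 (e2.trans e1.symm))).symm

/-- Elements with a left inverse in `𝔸_n` act homogeneously far out. -/
theorem exists_homogeneous_of_mul_eq_one {a b : JacobianAlg K n} (hab : a * b = 1) :
    ∃ (β : Fin n → ℤ) (f : (Fin n → ℤ) → K), ∀ᶠ α in atTop, f α ≠ 0 ∧
      (b : Module.End K (MvPolynomial (Fin n) K)) (monZ K α) = f α • monZ K (α + β) := by
  obtain ⟨S, f, ha, hS⟩ := exists_reduced_symbol a
  obtain ⟨T, g, hb, hT⟩ := exists_reduced_symbol b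
  have hab' := congrArg Subtype.val hab
  have hle := ha.card_mul_card_le_one hb hS hT hab'
  have key := ha.mul_eq_one hb hab' 0
  -- An empty symbol would make the coefficient at `δ = 0` an empty sum, but it equals `1`.
  have hpos : S.card * T.card ≠ 0 := by
    intro h0
    obtain ⟨α, hα⟩ := key.exists
    rw [← Finset.card_product, Finset.card_eq_zero] at h0
    rw [h0, if_pos rfl, Finset.filter_empty, Finset.sum_empty] at hα
    exact zero_ne_one hα
  have hc1 : S.card * T.card = 1 := by omega
  obtain ⟨hS1, hT1⟩ := mul_eq_one.1 hc1
  obtain ⟨β, rfl⟩ := Finset.card_eq_one.1 hS1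
  obtain ⟨γ, rfl⟩ := Finset.card_eq_one.1 hT1
  refine ⟨γ, g γ, ?_⟩
  filter_upwards [key, hb.2] with α h4 h5
  rw [Finset.sum_singleton] at h5
  refine ⟨fun h6 => ?_, h5⟩
  rw [if_pos rfl, Finset.sum_eq_zero] at h4
  · exact zero_ne_one h4
  · intro p hp
    rw [Finset.singleton_product_singleton, Finset.mem_filter, Finset.mem_singleton] at hp
    rw [hp.1, h6, mul_zero]

end symbol

end JacobianAlgebra

namespace JacobianAlgebra

open MvPolynomial Filter

/-! ### Eventually affine maps of `ℤ^n` -/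

section lattice

variable {n : ℕ}

theorem sum_toNat_smul_single {v : Fin n → ℤ} (hv : 0 ≤ v) :
    ∑ k, (v k).toNat • (Pi.single k 1 : Fin n → ℤ) = v := by
  ext j
  rw [Finset.sum_apply, Finset.sum_eq_single j]
  · simpa using hv j
  · intro k _ hk
    simp [hk.symm]
  · simp

theorem eventually_const_of_single {M : Type*} {F : (Fin n → ℤ) → M}
    (hF : ∀ᶠ α in atTop, ∀ k, F (α + Pi.single k 1) = F α) : ∃ x, ∀ᶠ α in atTop, F α = x := by
  obtain ⟨c, hc⟩ := eventually_atTop.1 hF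
  let V : AddSubmonoid (Fin n → ℤ) :=
    { carrier := {v | 0 ≤ v ∧ ∀ α, c ≤ α → F (α + v) = F α}
      zero_mem' := ⟨le_rfl, fun α _ => by rw [add_zero]⟩
      add_mem' := fun {v w} hv hw => ⟨add_nonneg hv.1 hw.1, fun α hα => by
        rw [← add_assoc, hw.2 _ (hα.trans (le_add_of_nonneg_right hv.1)), hv.2 _ hα]⟩ }
  have hV : ∀ v : Fin n → ℤ, 0 ≤ v → v ∈ V := fun v hv => by
    rw [← sum_toNat_smul_single hv]
    exact sum_mem fun k _ => nsmul_mem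
      (show Pi.single k 1 ∈ V from ⟨by simp, fun α hα => hc α hα k⟩) _
  refine ⟨F c, ?_⟩
  filter_upwards [eventually_ge_atTop c] with α hα
  have := (hV (α - c) (sub_nonneg.2 hα)).2 c le_rfl
  rwa [add_sub_cancel] at this

/-- The increments of `γ` that are constant far out. -/
def incr (γ : (Fin n → ℤ) → Fin n → ℤ) : AddSubgroup ((Fin n → ℤ) × (Fin n → ℤ)) where
  carrier := {p | ∀ᶠ α in atTop, γ (α + p.1) = γ α + p.2}
  zero_mem' := by simp
  add_mem' {p q} hp hq := by
    filter_upwards [hp, eventually_shift hq p.1] with α h1 h2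
    rw [Prod.fst_add, ← add_assoc, h2, h1, Prod.snd_add, add_assoc]
  neg_mem' {p} hp := by
    filter_upwards [eventually_shift hp (-p.1)] with α h1
    rw [neg_add_cancel_right] at h1
    rw [h1, Prod.fst_neg, Prod.snd_neg, add_neg_cancel_right]

/-- Two maps that are mutually inverse far out, together with vectors along which they increase by
the standard basis vectors. -/
structure InversePair (γ γ' : (Fin n → ℤ) → Fin n → ℤ) (β β' : Fin n → Fin n → ℤ) : Prop where
  nonneg : ∀ᶠ α in atTop, 0 ≤ γ α
  nonneg' : ∀ᶠ α in atTop, 0 ≤ γ' α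
  incr_mem : ∀ i, (β i, Pi.single i 1) ∈ incr γ
  incr_mem' : ∀ i, (β' i, Pi.single i 1) ∈ incr γ'
  inv : ∃ c, ∀ α, c ≤ α → c ≤ γ α → γ' (γ α) = α
  inv' : ∃ c, ∀ α, c ≤ α → c ≤ γ' α → γ (γ' α) = α

variable {γ γ' : (Fin n → ℤ) → Fin n → ℤ} {β β' : Fin n → Fin n → ℤ}

theorem InversePair.symm (H : InversePair γ γ' β β') : InversePair γ' γ β' β :=
  ⟨H.nonneg', H.nonneg, H.incr_mem', H.incr_mem, H.inv', H.inv⟩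

/-- The filter of points `α` such that both `α` and `γ α` are far out. -/
noncomputable def farFilter (γ : (Fin n → ℤ) → Fin n → ℤ) : Filter (Fin n → ℤ) :=
  comap (fun α => (α, γ α)) (atTop ×ˢ atTop)

theorem tendsto_farFilter : Tendsto (fun α => (α, γ α)) (farFilter γ) (atTop ×ˢ atTop) :=
  tendsto_comap

theorem farFilter_le : farFilter γ ≤ atTop :=
  tendsto_fst.comp tendsto_farFilter

theorem tendsto_farFilter_snd : Tendsto γ (farFilter γ) atTop :=
  tendsto_snd.comp tendsto_farFilter

/-- It is not known yet that `γ` tends to infinity, but walking `N` times along `∑ β_i` raises every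
coordinate of `γ` by `N`. -/
theorem InversePair.neBot (H : InversePair γ γ' β β') : (farFilter γ).NeBot := by
  refine comap_neBot_iff.2 fun t ht => ?_
  rw [prod_atTop_atTop_eq] at ht
  obtain ⟨⟨c, c'⟩, hc⟩ := mem_atTop_sets.1 ht
  -- Large enough for `γ α + N ≥ c'` in every coordinate, given only `γ α ≥ 0`.
  let N : ℕ := ∑ k, (c' k).toNat
  have h1 : N • (∑ i, (β i, (Pi.single i 1 : Fin n → ℤ))) ∈ incr γ :=
    nsmul_mem (sum_mem fun i _ => H.incr_mem i) N
  have h2 : ∀ᶠ α in atTop, γ (α + (N • (∑ i, (β i, (Pi.single i 1 : Fin n → ℤ)))).1) =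
    γ α + (N • (∑ i, (β i, (Pi.single i 1 : Fin n → ℤ)))).2 := h1
  obtain ⟨α, ⟨h2, h3⟩, h4⟩ := ((h2.and H.nonneg).and (eventually_ge_atTop
    (c - (N • (∑ i, (β i, (Pi.single i 1 : Fin n → ℤ)))).1))).exists
  refine ⟨_, hc _ ⟨sub_le_iff_le_add.1 h4, ?_⟩⟩
  change c' ≤ γ _
  rw [h2]
  intro k
  have h5 : (N • ∑ i, (β i, (Pi.single i 1 : Fin n → ℤ))).2 k = N := by
    rw [Prod.smul_snd, Prod.snd_sum, Pi.smul_apply, Finset.sum_apply]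
    simp [Pi.single_apply]
  have h6 : (c' k).toNat ≤ N :=
    Finset.single_le_sum (f := fun k => (c' k).toNat) (fun _ _ => Nat.zero_le _)
      (Finset.mem_univ k)
  have h7 : 0 ≤ γ α k := h3 k
  rw [Pi.add_apply, h5]
  have h8 : ((c' k).toNat : ℤ) ≤ N := by exact_mod_cast h6
  linarith [Int.self_le_toNat (c' k)]

/-- The increments of `γ` that are constant along `farFilter γ`. -/
noncomputable def farIncr (γ : (Fin n → ℤ) → Fin n → ℤ) : AddSubmonoid ((Fin n → ℤ) × (Fin n → ℤ)) where
  carrier := {p | ∀ᶠ α in farFilter γ, γ (α + p.1) = γ α + p.2}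
  zero_mem' := by simp
  add_mem' {p q} hp hq := by
    -- Translation by `p.1` preserves the filter because `γ (α + p.1) = γ α + p.2` stays far out.
    -- This argument covers adding `p.1` only, so a submonoid is obtained rather than a subgroup.
    have h1 : Tendsto (fun α => α + p.1) (farFilter γ) (farFilter γ) := by
      refine tendsto_comap_iff.2 (Tendsto.prodMk ?_ ?_)
      · exact (tendsto_atTop_add_const_right atTop p.1 tendsto_id).mono_left farFilter_le
      · refine (tendsto_atTop_add_const_right (farFilter γ) p.2 tendsto_farFilter_snd).congr' ?_
        filter_upwards [hp] with α hp
        exact hp.symm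
    filter_upwards [hp, h1.eventually hq] with α h2 h3
    rw [Prod.fst_add, ← add_assoc, h3, h2, Prod.snd_add, add_assoc]

/-- Where `γ'` inverts `γ`, one has `γ' (γ α + β'_i) = α + e_i`; apply `γ`. Both `α` and `γ α` must
be far out for this, which is what `farFilter` records. -/
theorem InversePair.farIncr_single (H : InversePair γ γ' β β') (i : Fin n) :
    (Pi.single i 1, β' i) ∈ farIncr γ := by
  obtain ⟨c, hc⟩ := H.inv
  obtain ⟨c', hc'⟩ := H.inv'
  have h1 : ∀ᶠ α in atTop, γ' (α + β' i) = γ' α + Pi.single i 1 := H.incr_mem' i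
  change ∀ᶠ α in farFilter γ, _
  filter_upwards [farFilter_le (eventually_ge_atTop (c ⊔ c')),
    tendsto_farFilter_snd.eventually h1,
    tendsto_farFilter_snd.eventually (eventually_ge_atTop (c ⊔ (c' - β' i)))] with α h2 h3 h4
  rw [hc α (le_sup_left.trans h2) (le_sup_left.trans h4)] at h3
  have h5 := hc' (γ α + β' i) (sub_le_iff_le_add.1 (le_sup_right.trans h4))
  rw [h3] at h5
  exact h5 ((le_sup_right.trans h2).trans (le_add_of_nonneg_right (by simp)))

theorem InversePair.mul_eq_one (H : InversePair γ γ' β β') :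
    (Matrix.of β) * (Matrix.of β') = 1 := by
  have hN := H.neBot
  have hS : ∀ v : Fin n → ℕ, (∑ i, v i • (Pi.single i 1 : Fin n → ℤ), ∑ i, v i • β' i) ∈
      farIncr γ := fun v => by
    have : ∑ i, v i • ((Pi.single i 1 : Fin n → ℤ), β' i) ∈ farIncr γ :=
      sum_mem fun i _ => nsmul_mem (H.farIncr_single i) _
    convert this using 1
    ext1 <;> simp [Prod.fst_sum, Prod.snd_sum]
  ext j k
  have h1 : (β j, (Pi.single j 1 : Fin n → ℤ)) ∈ farIncr γ := farFilter_le (H.incr_mem j)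
  -- Only nonnegative combinations are available, so `β_j` is split into positive and negative
  -- parts: `β_j + ∑ β_{ji}⁻ e_i = ∑ β_{ji}⁺ e_i`. The two resulting increments of `γ` give `e_j = ∑
  -- β_{ji} β'_i`.
  have h2 := add_mem h1 (hS fun i => (-β j i).toNat)
  have h3 := hS fun i => (β j i).toNat
  have h4 : β j + ∑ i, (-β j i).toNat • (Pi.single i 1 : Fin n → ℤ) =
      ∑ i, (β j i).toNat • (Pi.single i 1 : Fin n → ℤ) := by
    have h5 : ∑ i, (β j i).toNat • (Pi.single i 1 : Fin n → ℤ) -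
        ∑ i, (-β j i).toNat • (Pi.single i 1 : Fin n → ℤ) = β j := by
      ext l
      simp only [Pi.sub_apply, Finset.sum_apply, Pi.smul_apply]
      rw [Finset.sum_eq_single l, Finset.sum_eq_single l]
      · simp [max_zero_sub_max_neg_zero_eq_self]
      all_goals simp +contextual [eq_comm]
    exact (sub_eq_iff_eq_add.1 h5).symm
  obtain ⟨α, h6, h7⟩ := ((show ∀ᶠ α in farFilter γ, _ from h2).and
    (show ∀ᶠ α in farFilter γ, _ from h3)).exists
  change γ (α + (β j + ∑ i, (-β j i).toNat • (Pi.single i 1 : Fin n → ℤ))) = _ at h6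
  rw [h4] at h6
  have h8 := congrFun (add_left_cancel (h6.symm.trans h7)) k
  simp only [Prod.snd_add, Pi.add_apply, Finset.sum_apply, Pi.smul_apply] at h8
  simp only [nsmul_eq_mul] at h8
  rw [Matrix.mul_apply, Matrix.one_apply]
  have h9 : ∀ i, β j i * β' i k = ((β j i).toNat : ℤ) * β' i k - ((-β j i).toNat : ℤ) * β' i k :=
    fun i => by
      rw [← sub_mul]
      congr 1
      omega
  simp only [Matrix.of_apply, h9, Finset.sum_sub_distrib]
  rw [← h8, add_sub_cancel_right, Pi.single_apply]
  simp [eq_comm]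

/-- Over `ℤ` a one-sided inverse is two-sided, so `e_k` is an integral combination of the `β_j`. As
`incr γ` is a subgroup, the increment now holds along `atTop`, not merely along `farFilter γ`. -/
theorem InversePair.incr_single (H : InversePair γ γ' β β') (k : Fin n) :
    (Pi.single k 1, β' k) ∈ incr γ := by
  have h1 : (Matrix.of β') * (Matrix.of β) = 1 := _root_.mul_eq_one_comm.1 H.mul_eq_one
  have h2 : ∑ j, β' k j • (β j, (Pi.single j 1 : Fin n → ℤ)) ∈ incr γ :=
    sum_mem fun j _ => zsmul_mem (H.incr_mem j) _
  convert h2 using 1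
  ext l
  · have := congrFun (congrFun h1 k) l
    rw [Matrix.mul_apply, Matrix.one_apply] at this
    simp only [Matrix.of_apply] at this
    simp [Prod.fst_sum, this, Pi.single_apply, eq_comm]
  · simp [Prod.snd_sum, Pi.single_apply]

/-- A negative coordinate of `β'_k` would drive `γ` out of the nonnegative cone after finitely many
steps `e_k`. -/
theorem InversePair.nonneg_matrix (H : InversePair γ γ' β β') (k : Fin n) : 0 ≤ β' k := by
  obtain ⟨c, hc⟩ := eventually_atTop.1
    ((show ∀ᶠ α in atTop, _ from H.incr_single k).and H.nonneg)
  have h1 : ∀ N : ℕ, γ (c + N • Pi.single k 1) = γ c + N • β' k := by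
    intro N
    induction N with
    | zero => simp
    | succ N ih =>
      rw [succ_nsmul, ← add_assoc, (hc _ (le_add_of_nonneg_right (nsmul_nonneg (by simp) N))).1, ih,
        succ_nsmul, add_assoc]
  intro j
  by_contra! h2
  have h3 : 0 ≤ γ (c + ((γ c j).toNat + 1) • Pi.single k 1) j :=
    (hc _ (le_add_of_nonneg_right (nsmul_nonneg (by simp) _))).2 j
  rw [h1] at h3
  have h4 : 0 ≤ γ c j := (hc c le_rfl).2 j
  rw [Pi.add_apply, Pi.smul_apply, nsmul_eq_mul, Nat.cast_add, Nat.cast_one] at h3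
  rw [Pi.zero_apply] at h2
  rw [Int.toNat_of_nonneg h4] at h3
  have h5 : β' k j + 1 ≤ 0 := h2
  nlinarith

/-- Every row sum of `B` is at least `1`, while the row sums of `B'` weighted by them equal `1`. So
each row of `B'` has sum at most `1` and is a basis vector; invertibility makes the rows distinct.
-/
theorem exists_perm_of_nonneg {B B' : Matrix (Fin n) (Fin n) ℤ} (hB : ∀ j, 0 ≤ B j)
    (hB' : ∀ j, 0 ≤ B' j) (h1 : B' * B = 1) :
    ∃ τ : Equiv.Perm (Fin n), ∀ k, B' k = Pi.single (τ k) 1 := by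
  have hBB : B * B' = 1 := _root_.mul_eq_one_comm.1 h1
  have hrow : ∀ j, 1 ≤ ∑ l, B j l := fun j => by
    by_contra! hlt
    have h0 : ∑ l, B j l = 0 := le_antisymm (by omega) (Finset.sum_nonneg fun l _ => hB j l)
    have h2 := (Finset.sum_eq_zero_iff_of_nonneg fun l _ => hB j l).1 h0
    have h3 := congrFun (congrFun hBB j) j
    rw [Matrix.mul_apply, Matrix.one_apply_eq, Finset.sum_eq_zero] at h3
    · exact zero_ne_one h3
    · intro l hl; rw [h2 l hl, zero_mul]
  have hsum : ∀ k, ∑ j, B' k j * ∑ l, B j l = 1 := fun k => by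
    simp only [Finset.mul_sum]
    rw [Finset.sum_comm]
    have : ∀ l, ∑ j, B' k j * B j l = if k = l then 1 else 0 := fun l => by
      rw [← Matrix.mul_apply, h1, Matrix.one_apply]
    simp [this]
  have hex : ∀ k, ∃ j, B' k = Pi.single j 1 := fun k => by
    obtain ⟨j, hj⟩ : ∃ j, B' k j ≠ 0 := by
      by_contra! hc
      have := hsum k
      simp [hc] at this
    have hjp : 1 ≤ B' k j := by
      have : 0 ≤ B' k j := hB' k j
      omega
    have h2 : ∑ i, B' k i ≤ 1 := by
      rw [← hsum k]
      exact Finset.sum_le_sum fun i _ => le_mul_of_one_le_right (hB' k i) (hrow i)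
    rw [← Finset.add_sum_erase _ _ (Finset.mem_univ j)] at h2
    have h3 : 0 ≤ ∑ i ∈ Finset.univ.erase j, B' k i := Finset.sum_nonneg fun i _ => hB' k i
    have h4 : ∑ i ∈ Finset.univ.erase j, B' k i = 0 := by omega
    have h5 := (Finset.sum_eq_zero_iff_of_nonneg fun i _ => hB' k i).1 h4
    refine ⟨j, funext fun i => ?_⟩
    by_cases hi : i = j
    · subst hi; rw [Pi.single_eq_same]; omega
    · rw [Pi.single_eq_of_ne hi, h5 i (by simp [hi])]
  choose τ hτ using hex
  have hinj : Function.Injective τ := fun k l hkl => by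
    have h2 : B' k = B' l := by rw [hτ, hτ, hkl]
    have h3 := congrFun (congrFun h1 k) l
    have h4 := congrFun (congrFun h1 l) l
    rw [Matrix.mul_apply] at h3 h4
    rw [h2, h4, Matrix.one_apply_eq, Matrix.one_apply] at h3
    by_contra hne
    simp [hne] at h3
  exact ⟨Equiv.ofBijective τ (Finite.injective_iff_bijective.1 hinj), hτ⟩

theorem InversePair.exists_perm (H : InversePair γ γ' β β') :
    ∃ (τ : Equiv.Perm (Fin n)) (κ : Fin n → ℤ), ∀ᶠ α in atTop, γ α = α ∘ τ.symm + κ := by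
  obtain ⟨τ, hτ⟩ := exists_perm_of_nonneg (B := Matrix.of β) (B' := Matrix.of β')
    H.symm.nonneg_matrix H.nonneg_matrix H.symm.mul_eq_one
  have h1 : ∀ᶠ α in atTop, ∀ k, γ (α + Pi.single k 1) = γ α + Pi.single (τ k) 1 := by
    refine eventually_all.2 fun k => ?_
    have h2 := H.incr_single k
    rw [show β' k = Pi.single (τ k) 1 from hτ k] at h2
    exact h2
  obtain ⟨κ, hκ⟩ := eventually_const_of_single (F := fun α => γ α - α ∘ τ.symm) (by
    filter_upwards [h1] with α h1 k
    rw [h1]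
    have h2 : (α + Pi.single k 1) ∘ τ.symm = α ∘ τ.symm + Pi.single (τ k) 1 := by
      ext j
      simp [Pi.single_apply, Equiv.symm_apply_eq]
    rw [h2, add_sub_add_right_eq_sub])
  refine ⟨τ, κ, ?_⟩
  filter_upwards [hκ] with α hκ
  rw [← hκ, add_sub_cancel]

end lattice

end JacobianAlgebra

namespace JacobianAlgebra

open MvPolynomial Filter

/-! ### Automorphisms far out -/

section far

variable {K : Type*} [Field K] {n : ℕ}

variable {σ : 𝔾 K n} {φ : MvPolynomial (Fin n) K ≃ₗ[K] MvPolynomial (Fin n) K}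

/-- `φ` implements `σ`. -/
def Implements (φ : MvPolynomial (Fin n) K ≃ₗ[K] MvPolynomial (Fin n) K) (σ : 𝔾 K n) : Prop :=
  ∀ a : JacobianAlg K n, (σ a : Module.End K (MvPolynomial (Fin n) K)) = φ.conjAlgEquiv K a

theorem Implements.apply (H : Implements φ σ) (a : JacobianAlg K n)
    (p : MvPolynomial (Fin n) K) : (σ a : Module.End K (MvPolynomial (Fin n) K)) p =
      φ ((a : Module.End K (MvPolynomial (Fin n) K)) (φ.symm p)) := by
  rw [H a]; rfl

theorem Implements.symm_apply (H : Implements φ σ) (a : JacobianAlg K n)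
    (p : MvPolynomial (Fin n) K) :
    φ.symm ((σ a : Module.End K (MvPolynomial (Fin n) K)) p) =
      (a : Module.End K (MvPolynomial (Fin n) K)) (φ.symm p) := by
  rw [H.apply, LinearEquiv.symm_apply_apply]

theorem Implements.symm (H : Implements φ σ) : Implements φ.symm σ⁻¹ := fun a =>
  LinearMap.ext fun p => by
    have h1 := H.symm_apply (σ⁻¹ a) (φ p)
    have h2 : σ (σ⁻¹ a) = a := σ.apply_symm_apply a
    rw [h2, LinearEquiv.symm_apply_apply] at h1
    exact h1.symm

theorem Implements.mul {τ : 𝔾 K n} {ψ : MvPolynomial (Fin n) K ≃ₗ[K] MvPolynomial (Fin n) K}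
    (H : Implements φ σ) (H' : Implements ψ τ) : Implements (ψ.trans φ) (σ * τ) := fun a => by
  rw [AlgEquiv.mul_apply, H, H', conjAlgEquiv_trans_apply]

theorem rename_monZ (τ : Equiv.Perm (Fin n)) (γ : Fin n → ℤ) :
    renameEquiv K τ (monZ K γ) = monZ K (γ ∘ τ.symm) := by
  by_cases hγ : 0 ≤ γ
  · have h1 : 0 ≤ γ ∘ τ.symm := fun i => hγ _
    rw [monZ_of_nonneg hγ, monZ_of_nonneg h1, renameEquiv_apply, rename_monomial]
    congr 2
    ext i
    obtain ⟨j, rfl⟩ := τ.surjective i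
    simp [Finsupp.mapDomain_apply τ.injective]
  · rw [monZ_of_not hγ, map_zero, monZ_of_not]
    intro h1
    exact hγ fun i => by simpa using h1 (τ i)

theorem implements_permHom (τ : Equiv.Perm (Fin n)) :
    Implements (renameEquiv K τ).toLinearEquiv (permHom K n τ) := fun _ => rfl

theorem opX_mul_opH_add_one (i : Fin n) :
    opX K i * (opH K i + 1) = opH K i * opX K i :=
  end_ext fun α => by
    rw [Module.End.mul_apply, LinearMap.add_apply, Module.End.one_apply, Module.End.mul_apply,
      map_add, opH_monomial, opX_monomial, opX_monomial, opH_monomial, ← map_add]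
    simp

theorem x_mul_h_add_one (i : Fin n) : x K i * (h K i + 1) = h K i * x K i :=
  Subtype.ext (opX_mul_opH_add_one i)

theorem Implements.mem_inn_of_mem (H : Implements φ σ) (h1 : φ.toLinearMap ∈ JacobianAlg K n)
    (h2 : φ.symm.toLinearMap ∈ JacobianAlg K n) : σ ∈ innSubgroup K n :=
  ⟨⟨⟨φ.toLinearMap, h1⟩, ⟨φ.symm.toLinearMap, h2⟩,
      Subtype.ext (LinearMap.ext φ.apply_symm_apply),
      Subtype.ext (LinearMap.ext φ.symm_apply_apply)⟩,
    fun a => Subtype.ext (LinearMap.ext fun p => H.apply a p)⟩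

variable [CharZero K]

/-- The weight must coincide far out with the coefficient of `β` in a symbol of `a`, or with zero.
-/
theorem isRat_of_homogeneous (a : JacobianAlg K n) (β : Fin n → ℤ) {f : (Fin n → ℤ) → K}
    (ha : ∀ᶠ α in atTop, (a : Module.End K (MvPolynomial (Fin n) K)) (monZ K α) =
      f α • monZ K (α + β)) : IsRat f := by
  classical
  obtain ⟨S, g, hg, h1⟩ := exists_hasSymbol a
  have h2 : ∀ᶠ α in atTop, (if β ∈ S then g β α else 0) = f α := by
    filter_upwards [ha, h1, eventually_shift (eventually_ge_atTop 0) β] with α h2 h3 h4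
    have h5 := congrArg (coeff (natExp (α + β))) (h3.symm.trans h2)
    rw [coeff_sum, coeff_smul, coeff_monZ h4, if_pos rfl, smul_eq_mul, mul_one] at h5
    rw [← h5]
    simp [coeff_monZ h4]
  refine IsRat.congr ?_ h2
  by_cases hβ : β ∈ S
  · simpa only [if_pos hβ] using hg β
  · simpa only [if_neg hβ] using isRat_const (n := n) (0 : K)

/-- If `b` and `b + 1` have left inverses, then `b` acts diagonally far out. -/
theorem exists_diagonal {a a' b : JacobianAlg K n} (hab : a * b = 1) (hab' : a' * (b + 1) = 1) :
    ∃ f : (Fin n → ℤ) → K, ∀ᶠ α in atTop,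
      (b : Module.End K (MvPolynomial (Fin n) K)) (monZ K α) = f α • monZ K α := by
  obtain ⟨β, f, hf⟩ := exists_homogeneous_of_mul_eq_one hab
  obtain ⟨γ, g, hg⟩ := exists_homogeneous_of_mul_eq_one hab'
  -- If `β ≠ 0`, then `(b + 1) x^α` has two distinct monomials, although `b + 1` is homogeneous far
  -- out.
  have hβ : β = 0 := by
    by_contra h0
    obtain ⟨α, ⟨⟨hf0, h1⟩, hg0, h2⟩, h3, h4⟩ := ((hf.and hg).and ((eventually_ge_atTop 0).and
      (eventually_shift (eventually_ge_atTop 0) β))).exists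
    have h5 : (b : Module.End K (MvPolynomial (Fin n) K)) (monZ K α) + monZ K α =
      g α • monZ K (α + γ) := h2
    rw [h1] at h5
    have h6 := congrArg (coeff (natExp α)) h5
    have h7 := congrArg (coeff (natExp (α + β))) h5
    simp only [coeff_add, coeff_smul, coeff_monZ h3, coeff_monZ h4] at h6 h7
    have h8 : α ≠ α + β := by simpa using h0
    rw [if_neg h8.symm, if_pos trivial, smul_zero, zero_add] at h6
    rw [if_neg h8, if_pos trivial, add_zero, smul_eq_mul, mul_one] at h7
    have h9 : α + γ = α := by
      by_contra h9
      rw [if_neg h9, smul_zero] at h6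
      exact one_ne_zero h6
    rw [h9, if_neg h8, smul_zero] at h7
    exact hf0 h7
  subst hβ
  exact ⟨f, hf.mono fun α h => by simpa using h.2⟩

/-- In characteristic zero the joint eigenvalues `(α_i + 1)_i` separate the monomials. -/
theorem eigenvector_eq_monomial {p : MvPolynomial (Fin n) K} (hp : p ≠ 0) {c : Fin n → K}
    (hc : ∀ i, opH K i p = c i • p) :
    ∃ (d : K) (γ : Fin n → ℤ), d ≠ 0 ∧ 0 ≤ γ ∧ p = d • monZ K γ := by
  obtain ⟨δ, hδ⟩ := MvPolynomial.ne_zero_iff.1 hp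
  have hcoeff : ∀ (i : Fin n) (ε : Fin n →₀ ℕ) (q : MvPolynomial (Fin n) K),
      coeff ε (opH K i q) = (ε i + 1 : K) * coeff ε q := by
    intro i ε q
    have : (lcoeff K ε).comp (opH K i) = (ε i + 1 : K) • lcoeff (R := K) ε := by
      refine (basisMonomials (Fin n) K).ext fun ζ => ?_
      simp only [coe_basisMonomials, LinearMap.comp_apply, opH_monomial, lcoeff_apply,
        LinearMap.smul_apply, coeff_monomial, one_mul, smul_eq_mul]
      split_ifs with h1
      · rw [h1, mul_one]
      · rw [mul_zero]
    exact LinearMap.congr_fun this q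
  have heig : ∀ ε, coeff ε p ≠ 0 → ∀ i, (ε i + 1 : K) = c i := fun ε hε i => by
    have := hcoeff i ε p
    rw [hc i, coeff_smul, smul_eq_mul] at this
    exact (mul_right_cancel₀ hε this).symm
  refine ⟨coeff δ p, fun i => (δ i : ℤ), hδ, fun i => by simp, ?_⟩
  rw [← monomial_eq_monZ, smul_monomial, smul_eq_mul, mul_one]
  ext ε
  rw [coeff_monomial]
  split_ifs with h1
  · rw [h1]
  · by_contra hε
    refine h1 (Finsupp.ext fun i => ?_)
    have := (heig δ hδ i).trans (heig ε hε i).symm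
    exact_mod_cast add_right_cancel this

/-- `H_i` and `H_i + 1` have left inverses `H_i⁻¹` and `y_i H_i⁻¹ x_i`, so `σ(H_i)` is diagonal far
out. Hence `φ⁻¹ x^α` is a joint eigenvector of the `H_i`. -/
theorem Implements.exists_eigenvector (H : Implements φ σ) :
    ∃ (d : (Fin n → ℤ) → K) (γ : (Fin n → ℤ) → Fin n → ℤ),
      ∀ᶠ α in atTop, d α ≠ 0 ∧ 0 ≤ γ α ∧ φ.symm (monZ K α) = d α • monZ K (γ α) := by
  have h1 : ∀ i, ∃ f : (Fin n → ℤ) → K, ∀ᶠ α in atTop,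
      (σ (h K i) : Module.End K (MvPolynomial (Fin n) K)) (monZ K α) = f α • monZ K α :=
    fun i => exists_diagonal (a := σ (hinv K i)) (a' := σ (y K i * hinv K i * x K i))
      (by rw [← map_mul, hinv_mul_h, map_one])
      (by
        rw [← map_one σ, ← map_add, ← map_mul, mul_assoc _ (x K i), x_mul_h_add_one, mul_assoc,
          ← mul_assoc (hinv K i), hinv_mul_h, one_mul, y_mul_x, map_one])
  choose f hf using h1
  have h2 : ∀ᶠ α in atTop, ∃ dγ : K × (Fin n → ℤ), dγ.1 ≠ 0 ∧ 0 ≤ dγ.2 ∧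
      φ.symm (monZ K α) = dγ.1 • monZ K dγ.2 := by
    filter_upwards [eventually_all.2 hf, eventually_ge_atTop 0] with α h2 h3
    obtain ⟨d, γ, hdγ⟩ := eigenvector_eq_monomial (p := φ.symm (monZ K α))
      (c := fun i => f i α) (by simpa using monZ_ne_zero h3) fun i => by
        have h4 := H.symm_apply (h K i) (monZ K α)
        rw [h2 i, map_smul] at h4
        exact h4.symm
    exact ⟨(d, γ), hdγ⟩
  obtain ⟨F, hF⟩ := skolem.1 h2
  exact ⟨fun α => (F α).1, fun α => (F α).2, hF⟩

theorem Implements.exists_incr (H : Implements φ σ) {d : (Fin n → ℤ) → K}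
    {γ : (Fin n → ℤ) → Fin n → ℤ} (hdγ : ∀ᶠ α in atTop, d α ≠ 0 ∧ 0 ≤ γ α ∧
      φ.symm (monZ K α) = d α • monZ K (γ α)) (i : Fin n) :
    ∃ β, (β, Pi.single i 1) ∈ incr γ := by
  obtain ⟨β, u, hu⟩ := exists_homogeneous_of_mul_eq_one (a := σ (y K i)) (b := σ (x K i))
    (by rw [← map_mul, y_mul_x, map_one])
  refine ⟨β, ?_⟩
  change ∀ᶠ α in atTop, γ (α + β) = γ α + Pi.single i 1
  filter_upwards [hu, hdγ, eventually_shift hdγ β] with α ⟨hu0, h1⟩ ⟨hd, hγ, h2⟩ ⟨hd', hγ', h3⟩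
  have h4 := H.symm_apply (x K i) (monZ K α)
  rw [h1, map_smul, h3, h2, smul_smul, map_smul] at h4
  change _ = d α • opX K i (monZ K (γ α)) at h4
  rw [opX_monZ i hγ] at h4
  exact (monZ_smul_inj hγ' (mul_ne_zero hu0 hd') h4).1

theorem Implements.exists_perm (H : Implements φ σ) :
    ∃ (d : (Fin n → ℤ) → K) (τ : Equiv.Perm (Fin n)) (κ : Fin n → ℤ), ∀ᶠ α in atTop,
      d α ≠ 0 ∧ φ.symm (monZ K α) = d α • monZ K (α ∘ τ.symm + κ) := by
  obtain ⟨d, γ, h1⟩ := H.exists_eigenvector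
  obtain ⟨d', γ', h2⟩ := H.symm.exists_eigenvector
  choose β hβ using H.exists_incr h1
  choose β' hβ' using H.symm.exists_incr h2
  rw [LinearEquiv.symm_symm] at h2
  obtain ⟨c, hc⟩ := eventually_atTop.1 ((h1.and h2).and (eventually_ge_atTop 0))
  have hinv : InversePair γ γ' β β' := by
    refine ⟨h1.mono fun _ h => h.2.1, h2.mono fun _ h => h.2.1, hβ, hβ', ⟨c, ?_⟩, ⟨c, ?_⟩⟩
    · intro α hα hγ
      have h3 := φ.apply_symm_apply (monZ K α)
      rw [(hc α hα).1.1.2.2, map_smul, (hc _ hγ).1.2.2.2, smul_smul] at h3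
      exact (monZ_smul_inj (hc α hα).2 one_ne_zero ((one_smul K _).trans h3.symm)).1.symm
    · intro α hα hγ
      have h3 := φ.symm_apply_apply (monZ K α)
      rw [(hc α hα).1.2.2.2, map_smul, (hc _ hγ).1.1.2.2, smul_smul] at h3
      exact (monZ_smul_inj (hc α hα).2 one_ne_zero ((one_smul K _).trans h3.symm)).1.symm
  obtain ⟨τ, κ, h3⟩ := hinv.exists_perm
  refine ⟨d, τ, κ, ?_⟩
  filter_upwards [h1, h3] with α h1 h3
  rw [← h3]
  exact ⟨h1.1, h1.2.2⟩

/-- After composition with a permutation of the variables, every automorphism is implemented by an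
operator whose inverse is a weighted shift far out. -/
theorem exists_normalized (σ : 𝔾 K n) :
    ∃ (τ : Equiv.Perm (Fin n)) (φ : MvPolynomial (Fin n) K ≃ₗ[K] MvPolynomial (Fin n) K)
      (d : (Fin n → ℤ) → K) (κ : Fin n → ℤ), Implements φ (σ * permHom K n τ) ∧
      ∀ᶠ α in atTop, d α ≠ 0 ∧ φ.symm (monZ K α) = d α • monZ K (α + κ) := by
  obtain ⟨φ, H⟩ := exists_conj σ
  have H : Implements φ σ := H
  obtain ⟨d, τ, κ, h1⟩ := H.exists_perm
  refine ⟨τ, _, d, κ ∘ τ, H.mul (implements_permHom τ), ?_⟩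
  filter_upwards [h1] with α ⟨h2, h3⟩
  refine ⟨h2, ?_⟩
  change (renameEquiv K τ).symm (φ.symm (monZ K α)) = _
  rw [h3, map_smul]
  congr 1
  rw [AlgEquiv.symm_apply_eq, rename_monZ]
  congr 1
  ext i
  simp

/-- The two ratios are the weights of `σ(x_i)` and, after a shift, of its left inverse `σ(y_i)`,
both homogeneous far out. -/
theorem Implements.isRat_ratio (H : Implements φ σ) {d : (Fin n → ℤ) → K} {κ : Fin n → ℤ}
    (hd : ∀ᶠ α in atTop, d α ≠ 0 ∧ φ.symm (monZ K α) = d α • monZ K (α + κ)) (i : Fin n) :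
    IsRat (fun α => d (α + Pi.single i 1) * (d α)⁻¹) ∧
      IsRat (fun α => d α * (d (α + Pi.single i 1))⁻¹) := by
  have key : ∀ᶠ α in atTop, (σ (x K i) : Module.End K (MvPolynomial (Fin n) K)) (monZ K α) =
      (d α * (d (α + Pi.single i 1))⁻¹) • monZ K (α + Pi.single i 1) := by
    filter_upwards [hd, eventually_shift hd (Pi.single i 1),
      eventually_shift (eventually_ge_atTop 0) κ] with α ⟨h1, h2⟩ ⟨h3, h4⟩ h5
    apply φ.symm.injective
    rw [H.symm_apply, map_smul, h2, h4, map_smul, smul_smul, mul_assoc, inv_mul_cancel₀ h3, mul_one]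
    change d α • opX K i _ = _
    rw [opX_monZ i h5, add_right_comm]
  refine ⟨?_, isRat_of_homogeneous _ _ key⟩
  have key' : ∀ᶠ α in atTop, (σ (y K i) : Module.End K (MvPolynomial (Fin n) K)) (monZ K α) =
      (d α * (d (α + -Pi.single i 1))⁻¹) • monZ K (α + -Pi.single i 1) := by
    filter_upwards [eventually_shift (key.and hd) (-Pi.single i 1), hd] with α ⟨h1, h3⟩ h2
    rw [neg_add_cancel_right] at h1
    have h4 : (σ (y K i) : Module.End K (MvPolynomial (Fin n) K))
        ((σ (x K i) : Module.End K (MvPolynomial (Fin n) K)) (monZ K (α + -Pi.single i 1))) =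
        monZ K (α + -Pi.single i 1) := by
      have h5 : σ (y K i) * σ (x K i) = 1 := by rw [← map_mul, y_mul_x, map_one]
      exact LinearMap.congr_fun (congrArg Subtype.val h5) _
    rw [h1, map_smul] at h4
    rw [← h4, smul_smul]
    have : d α * (d (α + -Pi.single i 1))⁻¹ * (d (α + -Pi.single i 1) * (d α)⁻¹) = 1 := by
      have := h2.1
      have := h3.1
      field_simp
    rw [this, one_smul]
  refine ((isRat_of_homogeneous _ _ key').shift (Pi.single i 1)).congr (.of_forall fun α => ?_)
  simp only [add_neg_cancel_right]

/-! ### Operators that agree with elements of `𝔸_n` far out -/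

/-- Multiplication by `x^c` moves every monomial far out, and lowering `b` by `c` undoes it.
Intertwining then gives `φ = φ b x^c = σ(b) φ x^c = σ(b) z x^c`. -/
theorem Implements.mem_of_eventually (H : Implements φ σ) {z : JacobianAlg K n}
    (hz : ∀ᶠ α in atTop, φ (monZ K α) =
      (z : Module.End K (MvPolynomial (Fin n) K)) (monZ K α)) :
    φ.toLinearMap ∈ JacobianAlg K n := by
  obtain ⟨c, hc⟩ := eventually_atTop.1 hz
  obtain ⟨b, hb, hbγ⟩ := exists_lowering (K := K) (natExp c)
  have h1 : b * LinearMap.mulLeft K (monomial (natExp c) 1) = 1 := end_ext fun γ => by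
    simp [monomial_mul, hbγ]
  have h2 : φ.toLinearMap * LinearMap.mulLeft K (monomial (natExp c) 1) =
      (z : Module.End K (MvPolynomial (Fin n) K)) *
        LinearMap.mulLeft K (monomial (natExp c) 1) := end_ext fun γ => by
    rw [Module.End.mul_apply, Module.End.mul_apply, LinearMap.mulLeft_apply, monomial_mul, one_mul,
      monomial_eq_monZ]
    refine hc _ fun i => ?_
    simp only [Finsupp.add_apply, natExp_apply]
    omega
  have h3 : φ.toLinearMap * b = (σ ⟨b, hb⟩ : Module.End K (MvPolynomial (Fin n) K)) *
      φ.toLinearMap := LinearMap.ext fun p => by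
    rw [Module.End.mul_apply, Module.End.mul_apply, H.apply]
    simp
  have h4 : φ.toLinearMap = (σ ⟨b, hb⟩ : Module.End K (MvPolynomial (Fin n) K)) *
      ((z : Module.End K (MvPolynomial (Fin n) K)) *
        LinearMap.mulLeft K (monomial (natExp c) 1)) := by
    rw [← h2, ← mul_assoc, ← h3, mul_assoc, h1, mul_one]
  rw [h4]
  exact mul_mem (σ ⟨b, hb⟩).2 (mul_mem z.2 (mulLeft_mem _))

theorem exists_shift (κ : Fin n → ℤ) : ∃ s : JacobianAlg K n, ∀ᶠ α in atTop,
    (s : Module.End K (MvPolynomial (Fin n) K)) (monZ K α) = monZ K (α + κ) := by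
  obtain ⟨b, hb, hbγ⟩ := exists_lowering (K := K) (natExp (-κ))
  refine ⟨⟨b, hb⟩ * mulElt (monomial (natExp κ) 1), ?_⟩
  filter_upwards [eventually_ge_atTop 0, eventually_ge_atTop (-κ)] with α h1 h2
  have h3 : 0 ≤ α + κ := neg_le_iff_add_nonneg.1 h2
  change b (monomial (natExp κ) 1 * monZ K α) = _
  rw [monZ_of_nonneg h1, monZ_of_nonneg h3, monomial_mul, one_mul, hbγ]
  have h4 : ∀ i, 0 ≤ α i := h1
  have h5 : ∀ i, 0 ≤ α i + κ i := h3
  rw [if_pos]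
  · congr 2
    ext i
    have := h4 i
    have := h5 i
    simp only [Finsupp.tsub_apply, Finsupp.add_apply, natExp_apply, Pi.neg_apply, Pi.add_apply]
    omega
  · intro i
    have := h4 i
    have := h5 i
    simp only [Finsupp.add_apply, natExp_apply, Pi.neg_apply]
    omega

/-- `g` is a function that, together with its inverse, is far out the diagonal of a diagonal element
of `𝔸_n`. -/
def IsDiagUnit (g : (Fin n → ℤ) → K) : Prop :=
  ∃ a b : JacobianAlg K n, ∀ᶠ α in atTop, g α ≠ 0 ∧
    (a : Module.End K (MvPolynomial (Fin n) K)) (monZ K α) = g α • monZ K α ∧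
    (b : Module.End K (MvPolynomial (Fin n) K)) (monZ K α) = (g α)⁻¹ • monZ K α

/-- Far out `φ` is a shift by `-κ` followed by the diagonal element for `g⁻¹`, and `φ⁻¹` is the
diagonal element for `g` followed by the shift by `κ`. -/
theorem Implements.mem_inn (H : Implements φ σ) {g : (Fin n → ℤ) → K} (hg : IsDiagUnit g)
    {κ : Fin n → ℤ} (hφ : ∀ᶠ α in atTop, φ.symm (monZ K α) = g α • monZ K (α + κ)) :
    σ ∈ innSubgroup K n := by
  obtain ⟨a, b, hab⟩ := hg
  obtain ⟨s, hs⟩ := exists_shift (K := K) κ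
  obtain ⟨s', hs'⟩ := exists_shift (K := K) (-κ)
  refine H.mem_inn_of_mem (H.mem_of_eventually (z := b * s') ?_)
    (H.symm.mem_of_eventually (z := s * a) ?_)
  · filter_upwards [hs', eventually_shift (hφ.and hab) (-κ)] with α h1 ⟨h2, h3, h4, h5⟩
    change _ = (b : Module.End K (MvPolynomial (Fin n) K))
      ((s' : Module.End K (MvPolynomial (Fin n) K)) (monZ K α))
    rw [h1, h5, ← LinearEquiv.eq_symm_apply, map_smul, h2, smul_smul, inv_mul_cancel₀ h3, one_smul,
      neg_add_cancel_right]
  · filter_upwards [hs, hφ, hab] with α h1 h2 ⟨h3, h4, h5⟩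
    change _ = (s : Module.End K (MvPolynomial (Fin n) K))
      ((a : Module.End K (MvPolynomial (Fin n) K)) (monZ K α))
    rw [h4, map_smul, h1, h2]

end far

end JacobianAlgebra

namespace JacobianAlgebra

open MvPolynomial Filter

/-! ### Growth of rational functions of one variable -/

section growth

open scoped Polynomial

variable {K : Type*} [Field K]

/-- Translation preserves degree and leading coefficient, so degrees give `k = l` and leading
coefficients give `t = 1`. -/
theorem growth_polynomial {p q : K[X]} (hp : p ≠ 0) (hq : q ≠ 0) {t : K} (ht : t ≠ 0) {k l : ℕ}
    (hkl : (Polynomial.X + Polynomial.C 1) ^ k * (Polynomial.taylor 1 p * q) =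
      Polynomial.C t * ((Polynomial.X + Polynomial.C 1) ^ l * (p * Polynomial.taylor 1 q))) :
    k = l ∧ t = 1 := by
  have hX : ∀ m : ℕ, ((Polynomial.X + Polynomial.C 1 : K[X]) ^ m).Monic := fun m =>
    (Polynomial.monic_X_add_C 1).pow m
  have htp : Polynomial.taylor 1 p ≠ 0 := fun h0 => hp ((Polynomial.taylor_eq_zero 1 p).1 h0)
  have htq : Polynomial.taylor 1 q ≠ 0 := fun h0 => hq ((Polynomial.taylor_eq_zero 1 q).1 h0)
  have h1 := congrArg Polynomial.leadingCoeff hkl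
  have h2 := congrArg Polynomial.natDegree hkl
  rw [Polynomial.leadingCoeff_mul, Polynomial.leadingCoeff_mul, Polynomial.leadingCoeff_mul,
    Polynomial.leadingCoeff_mul, Polynomial.leadingCoeff_mul, Polynomial.leadingCoeff_taylor,
    Polynomial.leadingCoeff_taylor, (hX k).leadingCoeff, (hX l).leadingCoeff,
    Polynomial.leadingCoeff_C] at h1
  rw [Polynomial.natDegree_mul (hX k).ne_zero (mul_ne_zero htp hq), Polynomial.natDegree_mul htp hq,
    Polynomial.natDegree_C_mul ht, Polynomial.natDegree_mul (hX l).ne_zero (mul_ne_zero hp htq),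
    Polynomial.natDegree_mul hp htq, Polynomial.natDegree_taylor, Polynomial.natDegree_taylor,
    Polynomial.natDegree_pow, Polynomial.natDegree_pow, Polynomial.natDegree_X_add_C] at h2
  refine ⟨by omega, ?_⟩
  have h3 : p.leadingCoeff * q.leadingCoeff ≠ 0 := by simp [hp, hq]
  rw [one_mul] at h1
  exact (mul_eq_right₀ h3).1 h1.symm

variable [CharZero K]

theorem polynomial_eq_of_eventually {p q : K[X]}
    (hpq : ∀ᶠ s : ℤ in atTop, p.eval (s : K) = q.eval (s : K)) : p = q := by
  obtain ⟨c, hc⟩ := eventually_atTop.1 hpq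
  refine Polynomial.eq_of_infinite_eval_eq p q
    (((Set.Ici_infinite c).image (Int.cast_injective (α := K)).injOn).mono ?_)
  rintro _ ⟨s, hs, rfl⟩
  exact hc s hs

/-- An eventually rational function cannot grow like `t ^ s * (s !) ^ m`. -/
theorem growth {p q : K[X]} (hp : p ≠ 0) (hq : q ≠ 0) {f : ℤ → K}
    (hf : ∀ᶠ s in atTop, f s * q.eval (s : K) = p.eval (s : K)) {t : K} (ht : t ≠ 0) {m : ℤ}
    (hm : ∀ᶠ s in atTop, f (s + 1) = t * (s + 1 : K) ^ m * f s) : m = 0 ∧ t = 1 := by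
  have key := growth_polynomial (k := (-m).toNat) (l := m.toNat) hp hq ht
    (polynomial_eq_of_eventually <| by
      filter_upwards [hf, (tendsto_atTop_add_const_right atTop 1 tendsto_id).eventually hf, hm,
        eventually_ge_atTop 0] with s h1 h2 h3 h4
      have h5 : (s + 1 : K) ≠ 0 := by
        have : s + 1 ≠ 0 := by omega
        exact_mod_cast this
      have h6 : (s + 1 : K) ^ (-m).toNat * (s + 1 : K) ^ m = (s + 1 : K) ^ m.toNat := by
        rw [← zpow_natCast, ← zpow_natCast, ← zpow_add₀ h5]
        congr 1
        omega
      simp only [id] at h2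
      rw [h3] at h2
      push_cast at h2
      simp only [Polynomial.eval_mul, Polynomial.eval_pow, Polynomial.eval_add, Polynomial.eval_X,
        Polynomial.eval_C, Polynomial.taylor_eval]
      rw [← h1, ← h2, ← h6]
      ring)
  exact ⟨by omega, key.2⟩

end growth

/-! ### Factorisation of invertible rational functions -/

section factorisation

open scoped Polynomial

variable {K : Type*} [Field K] {n : ℕ}

theorem prime_linForm (k : Fin n) (m : K) : Prime (X k + C m : MvPolynomial (Fin n) K) := by
  let T : MvPolynomial (Fin n) K ≃ₐ[K] MvPolynomial (Fin n) K :=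
    AlgEquiv.ofAlgHom (aeval fun i => X i + C m) (aeval fun i => X i - C m)
      (by ext i : 1; simp [← algebraMap_eq]) (by ext i : 1; simp [← algebraMap_eq])
  have h1 : T (X k) = X k + C m := aeval_X _ k
  rw [← h1]
  exact (MulEquiv.prime_iff T).2 X_prime

/-- The linear forms are prime: strip them off one at a time, each dividing `p` or `p'`, until a
factorisation of `1` remains. -/
theorem eq_C_mul_of_mul_mem_linForms {q : MvPolynomial (Fin n) K} (hq : q ∈ linForms K n) :
    ∀ p p' : MvPolynomial (Fin n) K, p * p' = q → ∃ c : K, ∃ r ∈ linForms K n, p = C c * r := by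
  induction hq using Submonoid.closure_induction_left with
  | one =>
    intro p p' hp
    obtain ⟨c, -, hc⟩ := isUnit_iff_eq_C_of_isReduced.1 (IsUnit.of_mul_eq_one p' hp)
    exact ⟨c, 1, one_mem _, by rw [hc, mul_one]⟩
  | mul_left l hl q hq ih =>
    intro p p' hp
    obtain ⟨k, m, rfl⟩ := hl
    have hprime := prime_linForm k (m : K)
    rcases hprime.dvd_or_dvd (Dvd.intro q hp.symm) with ⟨p₁, rfl⟩ | ⟨p₁, rfl⟩
    · rw [mul_assoc] at hp
      obtain ⟨c, r, hr, h1⟩ := ih p₁ p' (mul_left_cancel₀ hprime.ne_zero hp)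
      exact ⟨c, (X k + C (m : K)) * r,
        mul_mem (Submonoid.subset_closure ⟨k, m, rfl⟩) hr, by rw [h1]; ring⟩
    · rw [mul_left_comm] at hp
      exact ih p p₁ (mul_left_cancel₀ hprime.ne_zero hp)

/-- Products of linear polynomials `x + m` with `m ∈ ℤ` in one variable. -/
noncomputable def linFormsOne (K : Type*) [Field K] : Submonoid K[X] :=
  Submonoid.closure {p | ∃ m : ℤ, p = Polynomial.X + Polynomial.C (m : K)}

theorem exists_separate {q : MvPolynomial (Fin n) K} (hq : q ∈ linForms K n) :
    ∃ Q : Fin n → K[X], (∀ k, Q k ∈ linFormsOne K) ∧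
      ∀ α : Fin n → ℤ, evalZ K α q = ∏ k, (Q k).eval (α k : K) := by
  induction hq using Submonoid.closure_induction with
  | mem q hq =>
    obtain ⟨k, m, rfl⟩ := hq
    refine ⟨Pi.mulSingle k (Polynomial.X + Polynomial.C (m : K)), fun j => ?_, fun α => ?_⟩
    · by_cases hj : j = k
      · subst hj
        rw [Pi.mulSingle_eq_same]
        exact Submonoid.subset_closure ⟨m, rfl⟩
      · rw [Pi.mulSingle_eq_of_ne hj]
        exact one_mem _
    · rw [Finset.prod_eq_single k]
      · simp [evalZ]
      · intro j _ hj
        simp [Pi.mulSingle_eq_of_ne hj]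
      · simp
  | one => exact ⟨1, fun _ => one_mem _, fun α => by simp⟩
  | mul p q _ _ hp hq =>
    obtain ⟨P, hP, h1⟩ := hp
    obtain ⟨Q, hQ, h2⟩ := hq
    refine ⟨P * Q, fun k => mul_mem (hP k) (hQ k), fun α => ?_⟩
    rw [map_mul, h1, h2, ← Finset.prod_mul_distrib]
    simp

variable [CharZero K]

theorem eval_linFormsOne_ne_zero {q : K[X]} (hq : q ∈ linFormsOne K) :
    ∀ᶠ s : ℤ in atTop, q.eval (s : K) ≠ 0 := by
  induction hq using Submonoid.closure_induction with
  | mem q hq =>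
    obtain ⟨m, rfl⟩ := hq
    filter_upwards [eventually_ge_atTop (1 - m)] with s hs
    have : s + m ≠ 0 := by omega
    simp only [Polynomial.eval_add, Polynomial.eval_X, Polynomial.eval_C]
    exact_mod_cast this
  | one => simp
  | mul p q _ _ hp hq =>
    filter_upwards [hp, hq] with α hp hq
    rw [Polynomial.eval_mul]
    exact mul_ne_zero hp hq

theorem linFormsOne_ne_zero {q : K[X]} (hq : q ∈ linFormsOne K) : q ≠ 0 := by
  rintro rfl
  obtain ⟨s, hs⟩ := (eval_linFormsOne_ne_zero hq).exists
  simp at hs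

/-- From `f g = 1` the numerators satisfy `p p' = q q'`, a product of linear forms. So `p` is itself
such a product up to a scalar, and each form involves one variable only. -/
theorem IsRat.exists_factorisation {f g : (Fin n → ℤ) → K} (hf : IsRat f) (hg : IsRat g)
    (hfg : ∀ᶠ α in atTop, f α * g α = 1) :
    ∃ (c : K) (P Q : Fin n → K[X]), (∀ k, P k ∈ linFormsOne K) ∧ (∀ k, Q k ∈ linFormsOne K) ∧
      ∀ᶠ α in atTop, f α = c * ∏ k, (P k).eval (α k : K) / (Q k).eval (α k : K) := by
  obtain ⟨p, q, hq, h1⟩ := hf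
  obtain ⟨p', q', hq', h2⟩ := hg
  have h3 : p * p' - q * q' = 0 := eq_zero_of_evalZ <| by
    filter_upwards [h1, h2, hfg] with α h1 h2 h3
    rw [map_sub, map_mul, map_mul, ← h1, ← h2, mul_mul_mul_comm, h3, mul_one, sub_self]
  obtain ⟨c, r, hr, rfl⟩ := eq_C_mul_of_mul_mem_linForms (mul_mem hq hq') p p' (sub_eq_zero.1 h3)
  obtain ⟨P, hP, hPr⟩ := exists_separate hr
  obtain ⟨Q, hQ, hQq⟩ := exists_separate hq
  refine ⟨c, P, Q, hP, hQ, ?_⟩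
  filter_upwards [h1, evalZ_linForms_ne_zero hq] with α h1 h4
  rw [Finset.prod_div_distrib, ← hPr, ← hQq, ← mul_div_assoc, eq_div_iff h4, mul_comm, h1, map_mul]
  simp [evalZ]

end factorisation

end JacobianAlgebra

namespace JacobianAlgebra

open MvPolynomial Filter

/-! ### Diagonal units -/

section diagUnit

variable {K : Type*} [Field K] {n : ℕ}

theorem IsDiagUnit.congr {f g : (Fin n → ℤ) → K} (hf : IsDiagUnit f)
    (hfg : ∀ᶠ α in atTop, f α = g α) : IsDiagUnit g := by
  obtain ⟨a, b, h1⟩ := hf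
  refine ⟨a, b, ?_⟩
  filter_upwards [h1, hfg] with α h1 h2
  rwa [← h2]

theorem IsDiagUnit.mul {f g : (Fin n → ℤ) → K} (hf : IsDiagUnit f) (hg : IsDiagUnit g) :
    IsDiagUnit fun α => f α * g α := by
  obtain ⟨a, b, h1⟩ := hf
  obtain ⟨a', b', h2⟩ := hg
  refine ⟨a * a', b * b', ?_⟩
  filter_upwards [h1, h2] with α ⟨hf, ha, hb⟩ ⟨hg, ha', hb'⟩
  refine ⟨mul_ne_zero hf hg, ?_, ?_⟩
  · change (a : Module.End K (MvPolynomial (Fin n) K))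
      ((a' : Module.End K (MvPolynomial (Fin n) K)) (monZ K α)) = _
    rw [ha', map_smul, ha, smul_smul, mul_comm]
  · change (b : Module.End K (MvPolynomial (Fin n) K))
      ((b' : Module.End K (MvPolynomial (Fin n) K)) (monZ K α)) = _
    rw [hb', map_smul, hb, smul_smul, mul_inv, mul_comm]

theorem IsDiagUnit.inv {f : (Fin n → ℤ) → K} (hf : IsDiagUnit f) :
    IsDiagUnit fun α => (f α)⁻¹ := by
  obtain ⟨a, b, h1⟩ := hf
  refine ⟨b, a, ?_⟩
  filter_upwards [h1] with α ⟨hf, ha, hb⟩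
  exact ⟨inv_ne_zero hf, hb, by rw [inv_inv, ha]⟩

theorem isDiagUnit_const {c : K} (hc : c ≠ 0) : IsDiagUnit fun _ : Fin n → ℤ => c :=
  ⟨algebraMap K _ c, algebraMap K _ c⁻¹, .of_forall fun _ => ⟨hc, rfl, rfl⟩⟩

theorem isDiagUnit_prod {ι : Type*} (s : Finset ι) {f : ι → (Fin n → ℤ) → K}
    (hf : ∀ i ∈ s, IsDiagUnit (f i)) : IsDiagUnit fun α => ∏ i ∈ s, f i α := by
  classical
  induction s using Finset.induction_on with
  | empty => simpa using isDiagUnit_const (n := n) (one_ne_zero (α := K))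
  | insert a s ha ih =>
    simp only [Finset.prod_insert ha]
    exact (hf a (by simp)).mul (ih fun i hi => hf i (by simp [hi]))

variable [CharZero K]

theorem IsDiagUnit.shift {f : (Fin n → ℤ) → K} (hf : IsDiagUnit f) (κ : Fin n → ℤ) :
    IsDiagUnit fun α => f (α + κ) := by
  obtain ⟨a, b, h1⟩ := hf
  obtain ⟨s, hs⟩ := exists_shift (K := K) κ
  obtain ⟨s', hs'⟩ := exists_shift (K := K) (-κ)
  refine ⟨s' * a * s, s' * b * s, ?_⟩
  filter_upwards [hs, eventually_shift h1 κ, eventually_shift hs' κ] with α h2 ⟨hf, ha, hb⟩ h3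
  rw [add_neg_cancel_right] at h3
  refine ⟨hf, ?_, ?_⟩
  · change (s' : Module.End K (MvPolynomial (Fin n) K))
      ((a : Module.End K (MvPolynomial (Fin n) K))
        ((s : Module.End K (MvPolynomial (Fin n) K)) (monZ K α))) = _
    rw [h2, ha, map_smul, h3]
  · change (s' : Module.End K (MvPolynomial (Fin n) K))
      ((b : Module.End K (MvPolynomial (Fin n) K))
        ((s : Module.End K (MvPolynomial (Fin n) K)) (monZ K α))) = _
    rw [h2, hb, map_smul, h3]

theorem isDiagUnit_add_int (i : Fin n) (m : ℤ) :
    IsDiagUnit fun α : Fin n → ℤ => ((α i : K) + m) := by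
  have h1 : IsDiagUnit fun α : Fin n → ℤ => ((α i : K) + 1) := by
    refine ⟨h K i, hinv K i, ?_⟩
    filter_upwards [eventually_ge_atTop 0] with α hα
    have h2 : 0 ≤ α i := hα i
    have h3 : α i + 1 ≠ 0 := by omega
    have h4 : 0 ≤ α + Pi.single i 1 := add_nonneg hα (by simp)
    refine ⟨by exact_mod_cast h3, ?_, opHinv_monZ i α⟩
    change opD K i (opX K i (monZ K α)) = _
    rw [opX_monZ i hα, opD_monZ, add_sub_cancel_right]
    simp
  refine (h1.shift (Pi.single i (m - 1))).congr (.of_forall fun α => ?_)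
  simp only [Pi.add_apply, Pi.single_eq_same]
  push_cast
  ring

end diagUnit

/-! ### Functions of one variable that are coboundaries up to `t (s + 1) ^ m` -/

section coboundary

open scoped Polynomial

variable {K : Type*} [Field K] {n : ℕ}

/-- `F(s) = t (s + 1) ^ m G(s + 1) / G(s)` far out, where `G(α_i)` is a diagonal unit. -/
def IsCoboundary (i : Fin n) (F : ℤ → K) : Prop :=
  ∃ (t : Kˣ) (m : ℤ) (G : ℤ → K), IsDiagUnit (fun α : Fin n → ℤ => G (α i)) ∧
    ∀ᶠ s in atTop, G s ≠ 0 ∧ F s * G s = t * (s + 1 : K) ^ m * G (s + 1)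

theorem IsCoboundary.congr {i : Fin n} {F F' : ℤ → K} (hF : IsCoboundary i F)
    (hFF' : ∀ᶠ s in atTop, F s = F' s) : IsCoboundary i F' := by
  obtain ⟨t, m, G, hG, h1⟩ := hF
  refine ⟨t, m, G, hG, ?_⟩
  filter_upwards [h1, hFF'] with s h1 h2
  rwa [← h2]

theorem IsCoboundary.inv {i : Fin n} {F : ℤ → K} (hF : IsCoboundary i F) :
    IsCoboundary i fun s => (F s)⁻¹ := by
  obtain ⟨t, m, G, hG, h1⟩ := hF
  refine ⟨t⁻¹, -m, fun s => (G s)⁻¹, hG.inv, ?_⟩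
  filter_upwards [h1] with s ⟨h1, h3⟩
  refine ⟨inv_ne_zero h1, ?_⟩
  rw [← mul_inv, h3, zpow_neg, Units.val_inv_eq_inv_val, mul_inv, mul_inv]

variable [CharZero K]

theorem IsCoboundary.mul {i : Fin n} {F F' : ℤ → K} (hF : IsCoboundary i F)
    (hF' : IsCoboundary i F') : IsCoboundary i fun s => F s * F' s := by
  obtain ⟨t, m, G, hG, h1⟩ := hF
  obtain ⟨t', m', G', hG', h2⟩ := hF'
  refine ⟨t * t', m + m', fun s => G s * G' s, hG.mul hG', ?_⟩
  filter_upwards [h1, h2, eventually_ge_atTop 0] with s ⟨h1, h3⟩ ⟨h2, h4⟩ h5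
  have h6 : (s + 1 : K) ≠ 0 := by
    have : s + 1 ≠ 0 := by omega
    exact_mod_cast this
  refine ⟨mul_ne_zero h1 h2, ?_⟩
  rw [mul_mul_mul_comm, h3, h4, zpow_add₀ h6, Units.val_mul]
  ring

theorem isCoboundary_const (i : Fin n) {c : K} (hc : c ≠ 0) : IsCoboundary i fun _ => c :=
  ⟨Units.mk0 c hc, 0, fun _ => 1, isDiagUnit_const one_ne_zero, by simp⟩

/-- `s + 1` is the exceptional factor itself, with `G = 1`, and `(s + m + 1)/(s + m)` is the
coboundary of `G(s) = s + m`. Telescoping from `1` in both directions reaches every `m`. -/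
theorem isCoboundary_add_int (i : Fin n) (m : ℤ) : IsCoboundary i fun s : ℤ => (s + m : K) := by
  have hne : ∀ m : ℤ, ∀ᶠ s : ℤ in atTop, (s + m : K) ≠ 0 := fun m => by
    filter_upwards [eventually_ge_atTop (1 - m)] with s hs
    have : s + m ≠ 0 := by omega
    exact_mod_cast this
  have hratio : ∀ m : ℤ, IsCoboundary i fun s : ℤ => ((s + (m + 1 : ℤ) : K) * (s + m : K)⁻¹) := by
    intro m
    refine ⟨1, 0, fun s => s + m, isDiagUnit_add_int i m, ?_⟩
    filter_upwards [hne m] with s h1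
    refine ⟨h1, ?_⟩
    rw [mul_assoc, inv_mul_cancel₀ h1]
    push_cast
    simp
    ring
  have h1 : IsCoboundary i fun s : ℤ => (s + (1 : ℤ) : K) :=
    ⟨1, 1, fun _ => 1, isDiagUnit_const one_ne_zero, .of_forall fun s => by simp⟩
  induction m using Int.inductionOn' (b := 1) with
  | zero => exact h1
  | succ k _ ih =>
    refine ((hratio k).mul ih).congr ?_
    filter_upwards [hne k] with s h2
    rw [mul_assoc, inv_mul_cancel₀ h2, mul_one]
  | pred k _ ih =>
    refine ((hratio (k - 1)).inv.mul ih).congr ?_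
    filter_upwards [hne k, hne (k - 1)] with s h2 h3
    rw [sub_add_cancel, mul_inv, inv_inv, mul_comm (_ : K)⁻¹, mul_assoc, inv_mul_cancel₀ h2, mul_one]

theorem isCoboundary_linFormsOne (i : Fin n) {p : K[X]} (hp : p ∈ linFormsOne K) :
    IsCoboundary i fun s : ℤ => p.eval (s : K) := by
  induction hp using Submonoid.closure_induction with
  | mem p hp =>
    obtain ⟨m, rfl⟩ := hp
    simpa using isCoboundary_add_int (K := K) i m
  | one => simpa using isCoboundary_const (K := K) i one_ne_zero
  | mul p q _ _ hp hq => simpa using hp.mul hq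

end coboundary

/-! ### Weights with rational ratios -/

section weights

open scoped Polynomial

variable {K : Type*} [Field K] {n : ℕ}

theorem eventually_coord (j : Fin n) {p : ℤ → Prop} (hp : ∀ᶠ s in atTop, p s) :
    ∀ᶠ α : Fin n → ℤ in atTop, p (α j) := by
  obtain ⟨c, hc⟩ := eventually_atTop.1 hp
  filter_upwards [eventually_ge_atTop fun _ => c] with α hα
  exact hc _ (hα j)

theorem prod_eval_add_single_mul (F : Fin n → ℤ → K) (α : Fin n → ℤ) (k : Fin n) :
    (∏ j, F j ((α + Pi.single k 1 : Fin n → ℤ) j)) * F k (α k) =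
      (∏ j, F j (α j)) * F k (α k + 1) := by
  rw [← Finset.mul_prod_erase _ _ (Finset.mem_univ k),
    ← Finset.mul_prod_erase _ (fun j => F j (α j)) (Finset.mem_univ k)]
  have : ∏ j ∈ Finset.univ.erase k, F j ((α + Pi.single k 1 : Fin n → ℤ) j) =
      ∏ j ∈ Finset.univ.erase k, F j (α j) := Finset.prod_congr rfl fun j hj => by
    simp [(Finset.mem_erase.1 hj).1]
  rw [this, Pi.add_apply, Pi.single_eq_same]
  ring

/-- The function `∏ t_i ^ α_i (α_i !) ^ m_i` on `ℤ^n`. -/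
noncomputable def weightZ [CharZero K] (t : Fin n → Kˣ) (m : Multiplicative (Fin n → ℤ))
    (α : Fin n → ℤ) : Kˣ :=
  torusWeight t (natExp α) * (xiWeight K n m : (Fin n →₀ ℕ) → Kˣ) (natExp α)

theorem natExp_add_single {α : Fin n → ℤ} (hα : 0 ≤ α) (i : Fin n) :
    natExp (α + Pi.single i 1) = natExp α + Finsupp.single i 1 := by
  ext j
  have : 0 ≤ α j := hα j
  by_cases hj : i = j
  · subst hj; simp; omega
  · simp [hj]

variable [CharZero K]

theorem weightZ_add_single (t : Fin n → Kˣ) (m : Multiplicative (Fin n → ℤ)) {α : Fin n → ℤ}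
    (hα : 0 ≤ α) (i : Fin n) : (weightZ t m (α + Pi.single i 1) : K) =
      t i * ((α i : K) + 1) ^ (m.toAdd i) * weightZ t m α := by
  have h1 : ∀ j, factWeight K j (natExp α + Finsupp.single i 1) ^ (m.toAdd j) =
      factWeight K j (natExp α) ^ (m.toAdd j) * if j = i then
        Units.mk0 ((natExp α i : K) + 1) (Nat.cast_add_one_ne_zero _) ^ (m.toAdd i) else 1 := by
    intro j
    split_ifs with hj
    · subst hj
      rw [← mul_zpow]
      congr 1
      ext
      simp [factWeight, Nat.factorial_succ, mul_comm]
    · rw [mul_one]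
      congr 1
      ext
      simp [factWeight, hj]
  have h2 : ((natExp α i : ℕ) : K) = (α i : K) := by
    rw [natExp_apply, ← Int.cast_natCast, Int.toNat_of_nonneg (hα i)]
  rw [weightZ, natExp_add_single hα, torusWeight_add, torusWeight_single, xiWeight_apply, weightZ,
    xiWeight_apply, Finset.prod_congr rfl fun j _ => h1 j, Finset.prod_mul_distrib,
    Finset.prod_ite_eq' Finset.univ i, if_pos (Finset.mem_univ i)]
  simp only [Units.val_mul, Units.val_zpow_eq_zpow_val, Units.val_mk0, h2]
  ring

/-- Multiplicative cocycles with rational values in separated form: off-diagonal factors are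
constant. -/
theorem factor_const_of_cocycle {d : (Fin n → ℤ) → K} (hd : ∀ᶠ α in atTop, d α ≠ 0)
    {c : Fin n → K} {P Q : Fin n → Fin n → K[X]} (hP : ∀ i k, P i k ∈ linFormsOne K)
    (hQ : ∀ i k, Q i k ∈ linFormsOne K)
    (hc : ∀ᶠ α in atTop, ∀ i, d (α + Pi.single i 1) * (d α)⁻¹ =
      c i * ∏ k, (P i k).eval (α k : K) / (Q i k).eval (α k : K)) {i k : Fin n} (hik : i ≠ k) :
    ∃ x : K, ∀ᶠ s : ℤ in atTop, (P i k).eval (s : K) / (Q i k).eval (s : K) = x := by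
  let F : Fin n → Fin n → ℤ → K := fun i k s => (P i k).eval (s : K) / (Q i k).eval (s : K)
  have hF0 : ∀ i k, ∀ᶠ s in atTop, F i k s ≠ 0 := fun i k => by
    filter_upwards [eval_linFormsOne_ne_zero (hP i k), eval_linFormsOne_ne_zero (hQ i k)]
      with s h1 h2
    exact div_ne_zero h1 h2
  have h1 : ∀ᶠ α : Fin n → ℤ in atTop, F i k (α k + 1) * F k i (α i) =
      F i k (α k) * F k i (α i + 1) := by
    filter_upwards [hd, eventually_shift hd (Pi.single i 1), eventually_shift hd (Pi.single k 1),
      eventually_shift hd (Pi.single i 1 + Pi.single k 1), hc, eventually_shift hc (Pi.single i 1),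
      eventually_shift hc (Pi.single k 1), eventually_coord k (hF0 i k),
      eventually_coord i (hF0 k i)]
      with α d0 d1 d2 d3 h1 h2 h3 h4 h5
    have e1 := h1 i
    have e2 := h1 k
    have e3 := h2 k
    have e4 := h3 i
    rw [add_assoc] at e3 e4
    rw [add_comm (Pi.single k 1)] at e4
    have e5 := prod_eval_add_single_mul (F i) α k
    have e6 := prod_eval_add_single_mul (F k) α i
    change _ = c i * ∏ j, F i j (α j) at e1
    change _ = c k * ∏ j, F k j (α j) at e2
    change _ = c k * ∏ j, F k j ((α + Pi.single i 1 : Fin n → ℤ) j) at e3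
    change _ = c i * ∏ j, F i j ((α + Pi.single k 1 : Fin n → ℤ) j) at e4
    have hA : c i * ∏ j, F i j (α j) ≠ 0 := by
      rw [← e1]; exact mul_ne_zero d1 (inv_ne_zero d0)
    have hB : c k * ∏ j, F k j (α j) ≠ 0 := by
      rw [← e2]; exact mul_ne_zero d2 (inv_ne_zero d0)
    -- The two ways of going from `α` to `α + e_i + e_k` give the same value of `d`.
    have hcomm : (c i * ∏ j, F i j ((α + Pi.single k 1 : Fin n → ℤ) j)) *
        (c k * ∏ j, F k j (α j)) =
        (c k * ∏ j, F k j ((α + Pi.single i 1 : Fin n → ℤ) j)) * (c i * ∏ j, F i j (α j)) := by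
      rw [← e1, ← e2, ← e3, ← e4]
      field_simp
    refine mul_left_cancel₀ (mul_ne_zero hA hB) ?_
    linear_combination (-(c i) * (c k) * (∏ j, F k j (α j)) * F k i (α i)) * e5 +
      (F i k (α k) * F k i (α i)) * hcomm +
      (c i * c k * (∏ j, F i j (α j)) * F i k (α k)) * e6
  obtain ⟨b, hb⟩ := eventually_atTop.1 (h1.and hd)
  obtain ⟨b', hb'⟩ := eventually_atTop.1 (hF0 k i)
  -- By `h1` the step ratio of `F i k` depends on `α k` only and equals that of `F k i`, which
  -- depends on `α i` only. Freezing `α i` shows that the former is a constant `μ`, and a rational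
  -- function cannot grow geometrically unless `μ = 1`.
  let μ : K := F k i (max (b i) b' + 1) / F k i (max (b i) b')
  have h2 : ∀ s, b k ≤ s → F i k (s + 1) = μ * F i k s := by
    intro s hs
    have h3 := (hb (Function.update (Function.update b k s) i (max (b i) b')) (by
      intro j
      by_cases hj : j = i
      · subst hj; simp
      · by_cases hj' : j = k
        · subst hj'; simpa [hj] using hs
        · simp [hj, hj'])).1
    simp only [Function.update_self, Function.update_of_ne hik.symm] at h3
    have h4 := hb' (max (b i) b') (le_max_right _ _)
    change _ = F k i (max (b i) b' + 1) / F k i (max (b i) b') * _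
    rw [div_mul_eq_mul_div, eq_div_iff h4, h3, mul_comm]
  have hμ : μ ≠ 0 := div_ne_zero (hb' _ (show b' ≤ max (b i) b' + 1 by omega))
    (hb' _ (le_max_right _ _))
  have h3 : μ = 1 := (growth (linFormsOne_ne_zero (hP i k)) (linFormsOne_ne_zero (hQ i k))
    (f := F i k) (by
      filter_upwards [eval_linFormsOne_ne_zero (hQ i k)] with s hs
      exact div_mul_cancel₀ _ hs) hμ (m := 0) (by
      filter_upwards [eventually_ge_atTop (b k)] with s hs
      rw [zpow_zero, mul_one, h2 s hs])).2
  refine ⟨F i k (b k), ?_⟩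
  filter_upwards [eventually_ge_atTop (b k)] with s hs
  change F i k s = _
  induction s, hs using Int.leInduction with
  | base => rfl
  | succ s hs ih => rw [h2 s hs, h3, one_mul, ih]

theorem exists_weight {d : (Fin n → ℤ) → K} (hd : ∀ᶠ α in atTop, d α ≠ 0)
    (h1 : ∀ i, IsRat fun α => d (α + Pi.single i 1) * (d α)⁻¹)
    (h2 : ∀ i, IsRat fun α => d α * (d (α + Pi.single i 1))⁻¹) :
    ∃ (t : Fin n → Kˣ) (m : Multiplicative (Fin n → ℤ)),
      IsDiagUnit fun α => d α * (weightZ t m α : K)⁻¹ := by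
  have h3 : ∀ i, ∀ᶠ α in atTop,
      d (α + Pi.single i 1) * (d α)⁻¹ * (d α * (d (α + Pi.single i 1))⁻¹) = 1 := fun i => by
    filter_upwards [hd, eventually_shift hd (Pi.single i 1)] with α h3 h4
    field_simp
  choose c P Q hP hQ hPQ using fun i => (h1 i).exists_factorisation (h2 i) (h3 i)
  have hcc := eventually_all.2 hPQ
  have h4 : ∀ i k, i ≠ k → ∃ x : K, ∀ᶠ s : ℤ in atTop,
      (P i k).eval (s : K) / (Q i k).eval (s : K) = x := fun i k hik =>
    factor_const_of_cocycle hd hP hQ hcc hik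
  have h5 : ∀ i k, ∃ x : K, i ≠ k → ∀ᶠ s : ℤ in atTop,
      (P i k).eval (s : K) / (Q i k).eval (s : K) = x := fun i k => by
    by_cases hik : i = k
    -- A dummy value on the diagonal, so that `x` can be chosen for all pairs.
    · exact ⟨0, fun h => absurd hik h⟩
    · obtain ⟨x, hx⟩ := h4 i k hik
      exact ⟨x, fun _ => hx⟩
  choose x hx using h5
  let e : Fin n → K := fun i => c i * ∏ k ∈ Finset.univ.erase i, x i k
  have h6 : ∀ i, ∀ᶠ α in atTop, d (α + Pi.single i 1) * (d α)⁻¹ =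
      e i * ((P i i).eval (α i : K) / (Q i i).eval (α i : K)) := by
    intro i
    have h7 : ∀ᶠ α : Fin n → ℤ in atTop, ∀ k ∈ Finset.univ.erase i,
        (P i k).eval (α k : K) / (Q i k).eval (α k : K) = x i k :=
      (Finset.eventually_all _).2 fun k hk =>
        eventually_coord k (hx i k (Finset.ne_of_mem_erase hk).symm)
    filter_upwards [hPQ i, h7] with α h8 h9
    rw [h8, ← Finset.mul_prod_erase _ _ (Finset.mem_univ i), Finset.prod_congr rfl h9]
    simp only [e]
    ring
  have he : ∀ i, e i ≠ 0 := fun i h0 => by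
    obtain ⟨α, h7, h8, h9⟩ := ((h6 i).and (hd.and (eventually_shift hd (Pi.single i 1)))).exists
    rw [h0, zero_mul] at h7
    exact mul_ne_zero h9 (inv_ne_zero h8) h7
  have h7 : ∀ i, IsCoboundary i fun s : ℤ => e i * ((P i i).eval (s : K) / (Q i i).eval (s : K)) :=
    fun i => (isCoboundary_const i (he i)).mul
      (((isCoboundary_linFormsOne i (hP i i)).mul (isCoboundary_linFormsOne i (hQ i i)).inv).congr
        (.of_forall fun s => (div_eq_mul_inv _ _).symm))
  choose t m G hG hGF using h7
  refine ⟨t, Multiplicative.ofAdd m, ?_⟩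
  -- `D` has the same step ratios as `d`, so `d / D` is invariant under unit steps and therefore
  -- constant far out.
  let D : (Fin n → ℤ) → K := fun α => weightZ t (Multiplicative.ofAdd m) α * ∏ i, G i (α i)
  have hG0 : ∀ᶠ α : Fin n → ℤ in atTop, ∀ i, G i (α i) ≠ 0 :=
    eventually_all.2 fun i => eventually_coord i ((hGF i).mono fun _ h => h.1)
  have hDd : ∀ᶠ α in atTop, ∀ k, d (α + Pi.single k 1) * (D (α + Pi.single k 1))⁻¹ =
      d α * (D α)⁻¹ := by
    have hGF' : ∀ᶠ α : Fin n → ℤ in atTop, ∀ i, e i *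
        ((P i i).eval (α i : K) / (Q i i).eval (α i : K)) * G i (α i) =
          t i * ((α i : K) + 1) ^ m i * G i (α i + 1) :=
      eventually_all.2 fun i => eventually_coord i ((hGF i).mono fun _ h => h.2)
    have hG1 : ∀ᶠ α : Fin n → ℤ in atTop, ∀ k i, G i ((α + Pi.single k 1 : Fin n → ℤ) i) ≠ 0 :=
      eventually_all.2 fun k => eventually_shift hG0 _
    filter_upwards [eventually_all.2 h6, hGF', hG0, hG1, hd, eventually_ge_atTop 0]
      with α e1 e2 e3 e4 e5 e6 k
    have e7 := e2 k
    rw [← e1 k] at e7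
    have e8 := prod_eval_add_single_mul G α k
    have e9 : ∏ i, G i (α i) ≠ 0 := Finset.prod_ne_zero_iff.2 fun i _ => e3 i
    have e10 : ∏ i, G i ((α + Pi.single k 1 : Fin n → ℤ) i) ≠ 0 :=
      Finset.prod_ne_zero_iff.2 fun i _ => e4 k i
    have e11 := weightZ_add_single t (Multiplicative.ofAdd m) e6 k
    rw [toAdd_ofAdd] at e11
    have w0 : (weightZ t (Multiplicative.ofAdd m) α : K) ≠ 0 := Units.ne_zero _
    have w1 : (weightZ t (Multiplicative.ofAdd m) (α + Pi.single k 1) : K) ≠ 0 := Units.ne_zero _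
    simp only [D]
    rw [← div_eq_mul_inv, ← div_eq_mul_inv, div_eq_div_iff (mul_ne_zero w1 e10) (mul_ne_zero w0 e9)]
    have e12 : d (α + Pi.single k 1) * G k (α k) =
        d α * (t k * ((α k : K) + 1) ^ m k * G k (α k + 1)) := by
      rw [← e7]
      field_simp
    refine mul_right_cancel₀ (e3 k) ?_
    rw [e11]
    linear_combination (weightZ t (Multiplicative.ofAdd m) α * ∏ i, G i (α i)) * e12 -
      (d α * (t k * ((α k : K) + 1) ^ m k * weightZ t (Multiplicative.ofAdd m) α)) * e8
  obtain ⟨y, hy⟩ := eventually_const_of_single (F := fun α => d α * (D α)⁻¹) hDd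
  have hy0 : y ≠ 0 := by
    rintro rfl
    obtain ⟨α, e1, e2, e3⟩ := (hy.and (hd.and hG0)).exists
    exact mul_ne_zero e2 (inv_ne_zero (mul_ne_zero (Units.ne_zero _)
      (Finset.prod_ne_zero_iff.2 fun i _ => e3 i))) e1
  refine ((isDiagUnit_const hy0).mul (isDiagUnit_prod Finset.univ fun i _ => hG i)).congr ?_
  filter_upwards [hy, hG0] with α e1 e2
  have e3 : ∏ i, G i (α i) ≠ 0 := Finset.prod_ne_zero_iff.2 fun i _ => e2 i
  have w0 : (weightZ t (Multiplicative.ofAdd m) α : K) ≠ 0 := Units.ne_zero _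
  rw [← e1]
  simp only [D]
  field_simp

end weights

end JacobianAlgebra

namespace JacobianAlgebra

open MvPolynomial Filter

/-! ### The decomposition of `𝔾_n` -/

section decomposition

variable {K : Type*} [Field K] {n : ℕ}

/-- A unit of `𝔸_n` as an invertible operator on `P_n`. -/
noncomputable def unitEquiv (u : (JacobianAlg K n)ˣ) :
    MvPolynomial (Fin n) K ≃ₗ[K] MvPolynomial (Fin n) K :=
  LinearEquiv.ofLinearMap ((u : JacobianAlg K n) : Module.End K (MvPolynomial (Fin n) K))
    ((u⁻¹ : (JacobianAlg K n)ˣ) : JacobianAlg K n)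
    (congrArg Subtype.val u.mul_inv) (congrArg Subtype.val u.inv_mul)

theorem implements_unitEquiv {σ : 𝔾 K n} {u : (JacobianAlg K n)ˣ}
    (hu : ∀ a, σ a = u * a * (u⁻¹ : (JacobianAlg K n)ˣ)) : Implements (unitEquiv u) σ :=
  fun a => congrArg Subtype.val (hu a)

theorem implements_diagAut (c : diagNormalizer K n) :
    Implements (diagEquiv (c : (Fin n →₀ ℕ) → Kˣ)) (diagAut K n c) := fun _ => rfl

theorem diagEquiv_monZ (c : (Fin n →₀ ℕ) → Kˣ) (α : Fin n → ℤ) :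
    diagEquiv c (monZ K α) = (c (natExp α) : K) • monZ K α := by
  by_cases hα : 0 ≤ α
  · rw [monZ_of_nonneg hα, diagEquiv_monomial, smul_monomial, smul_eq_mul]
  · rw [monZ_of_not hα, map_zero, smul_zero]

variable [CharZero K]

theorem Implements.eq_smul {σ : 𝔾 K n}
    {φ ψ : MvPolynomial (Fin n) K ≃ₗ[K] MvPolynomial (Fin n) K} (hφ : Implements φ σ)
    (hψ : Implements ψ σ) : ∃ k : Kˣ, ∀ p, φ p = (k : K) • ψ p :=
  eq_smul_of_conj_eq φ ψ fun a ha => (hφ ⟨a, ha⟩).symm.trans (hψ ⟨a, ha⟩)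

theorem exists_implements_torus_xi (t : Fin n → Kˣ) (m : Multiplicative (Fin n → ℤ)) :
    ∃ φ : MvPolynomial (Fin n) K ≃ₗ[K] MvPolynomial (Fin n) K,
      Implements φ (torusHom K n t * xiHom K n m) ∧
      ∀ α, φ (monZ K α) = (weightZ t m α : K) • monZ K α := by
  refine ⟨diagEquiv ((⟨torusWeight t, torusWeight_mem t⟩ * xiWeight K n m :
    diagNormalizer K n) : (Fin n →₀ ℕ) → Kˣ), ?_, fun α => ?_⟩
  · rw [torusHom_eq_diagAut, xiHom, MonoidHom.comp_apply, ← map_mul]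
    exact implements_diagAut _
  · rw [diagEquiv_monZ]
    rfl

/-! ### Independence of the factors. -/

theorem eq_one_of_isRat_weightZ {t : Fin n → Kˣ} {m : Multiplicative (Fin n → ℤ)}
    (hw : IsRat fun α => (weightZ t m α : K)) : t = 1 ∧ m = 1 := by
  obtain ⟨p, q, hq, h1⟩ := hw
  obtain ⟨c, hc⟩ := eventually_atTop.1
    ((h1.and (evalZ_linForms_ne_zero hq)).and (eventually_ge_atTop 0))
  have key : ∀ i, m.toAdd i = 0 ∧ (t i : K) = 1 := by
    intro i
    -- Restriction to the line through `c` in direction `e_i`, along which the weight grows like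
    -- `t_i^s (s!)^{m_i}`.
    let E : MvPolynomial (Fin n) K →ₐ[K] Polynomial K :=
      aeval fun j => if j = i then Polynomial.X else Polynomial.C (c j : K)
    have hE : ∀ (s : ℤ) (r : MvPolynomial (Fin n) K),
        (E r).eval (s : K) = evalZ K (Function.update c i s) r := by
      intro s r
      induction r using MvPolynomial.induction_on with
      | C a => simp [E, evalZ]
      | add r r' hr hr' => rw [map_add, Polynomial.eval_add, hr, hr', map_add]
      | mul_X r j hr =>
        rw [map_mul, Polynomial.eval_mul, hr, map_mul]
        congr 1
        by_cases hj : j = i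
        · subst hj; simp [E, evalZ]
        · simp [E, evalZ, hj]
    have hcs : ∀ s, c i ≤ s → c ≤ Function.update c i s := fun s hs =>
      le_update_self_iff.2 hs
    have hne : ∀ s : ℤ, c i ≤ s → (E q).eval (s : K) ≠ 0 ∧ (E p).eval (s : K) ≠ 0 := fun s hs => by
      have h2 := (hc _ (hcs s hs)).1
      rw [hE, hE, ← h2.1]
      exact ⟨h2.2, mul_ne_zero h2.2 (Units.ne_zero _)⟩
    refine growth (p := E p) (q := E q) (fun h0 => (hne (c i) le_rfl).2 (by simp [h0]))
      (fun h0 => (hne (c i) le_rfl).1 (by simp [h0]))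
      (f := fun s => (weightZ t m (Function.update c i s) : K)) ?_ (t i).ne_zero ?_
    · filter_upwards [eventually_ge_atTop (c i)] with s hs
      rw [hE, hE, mul_comm]
      exact (hc _ (hcs s hs)).1.1
    · filter_upwards [eventually_ge_atTop (c i)] with s hs
      have h3 : Function.update c i (s + 1) = Function.update c i s + Pi.single i 1 := by
        ext j
        by_cases hj : j = i
        · subst hj; simp
        · simp [hj]
      rw [h3, weightZ_add_single t m (hc _ (hcs s hs)).2 i, Function.update_self]
  exact ⟨funext fun i => Units.ext (key i).2,
    Multiplicative.toAdd.injective (funext fun i => (key i).1)⟩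

/-- The unit and the diagonal operator implement the same automorphism, hence are proportional. As
an element of `𝔸_n` the unit has a rational symbol, so the weight is rational far out. -/
theorem torus_xi_mem_inn {t : Fin n → Kˣ} {m : Multiplicative (Fin n → ℤ)}
    (h1 : torusHom K n t * xiHom K n m ∈ innSubgroup K n) : t = 1 ∧ m = 1 := by
  obtain ⟨u, hu⟩ := h1
  obtain ⟨φ, hφ, h2⟩ := exists_implements_torus_xi t m
  obtain ⟨k, hk⟩ := (implements_unitEquiv hu).eq_smul hφ
  have h3 : IsRat fun α => (k * weightZ t m α : K) :=
    isRat_of_homogeneous (u : JacobianAlg K n) 0 (.of_forall fun α => by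
      have := hk (monZ K α)
      rw [h2, smul_smul] at this
      rw [add_zero]
      exact this)
  refine eq_one_of_isRat_weightZ (((isRat_const ((k⁻¹ : Kˣ) : K)).mul h3).congr
    (.of_forall fun α => ?_))
  rw [← mul_assoc, Units.inv_mul, one_mul]

theorem isSemidirect_torus_xi_inn :
    IsSemidirect (torusSubgroup K n ⊔ xiSubgroup K n ⊔ innSubgroup K n)
      (torusSubgroup K n ⊔ xiSubgroup K n) (innSubgroup K n) := by
  refine ⟨le_sup_left, le_sup_right, fun g _ b hb => conj_mem_inn g hb, fun g hg => ?_, ?_⟩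
  · obtain ⟨a, ha, b, hb, rfl⟩ := Subgroup.mem_sup_of_normal_right.1 hg
    exact ⟨a, ha, b, hb, rfl⟩
  · rw [eq_bot_iff]
    rintro g ⟨hg, hg'⟩
    obtain ⟨t, m, rfl⟩ := mem_torus_sup_xi.1 hg
    obtain ⟨rfl, rfl⟩ := torus_xi_mem_inn hg'
    rw [map_one, map_one, mul_one]
    exact Subgroup.mem_bot.2 rfl

theorem perm_eq_one_of_mem {τ : Equiv.Perm (Fin n)}
    (hτ : permHom K n τ ∈ torusSubgroup K n ⊔ xiSubgroup K n ⊔ innSubgroup K n) : τ = 1 := by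
  obtain ⟨a, ha, b, ⟨u, hu⟩, hab⟩ := Subgroup.mem_sup_of_normal_right.1 hτ
  obtain ⟨t, m, rfl⟩ := mem_torus_sup_xi.1 ha
  obtain ⟨φ, hφ, h2⟩ := exists_implements_torus_xi t m
  have h3 := hφ.mul (implements_unitEquiv hu)
  rw [hab] at h3
  obtain ⟨k, hk⟩ := h3.eq_smul (implements_permHom τ)
  have hφs : ∀ α, φ.symm (monZ K α) = ((weightZ t m α : Kˣ) : K)⁻¹ • monZ K α := fun α => by
    rw [LinearEquiv.symm_apply_eq, map_smul, h2, smul_smul, inv_mul_cancel₀ (Units.ne_zero _),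
      one_smul]
  have h4 : ∀ α, ((u : JacobianAlg K n) : Module.End K (MvPolynomial (Fin n) K)) (monZ K α) =
      ((k : K) * ((weightZ t m (α ∘ τ.symm) : Kˣ) : K)⁻¹) • monZ K (α ∘ τ.symm) := fun α => by
    have h5 : φ (unitEquiv u (monZ K α)) = (k : K) • renameEquiv K τ (monZ K α) := hk (monZ K α)
    rw [rename_monZ, ← LinearEquiv.eq_symm_apply, map_smul, hφs, smul_smul] at h5
    exact h5
  obtain ⟨S, f, -, hS⟩ := exists_hasSymbol (u : JacobianAlg K n)
  obtain ⟨c, hc⟩ := eventually_atTop.1 hS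
  -- The unit moves `x^α` to a nonzero multiple of `x^{α ∘ τ⁻¹}`, so the displacement must occur in
  -- its finite symbol.
  have h6 : ∀ α, 0 ⊔ c ≤ α → α ∘ τ.symm - α ∈ S := by
    intro α hα
    have h7 : 0 ≤ α ∘ τ.symm := fun i => le_sup_left.trans hα (τ.symm i)
    have h8 := congrArg (coeff (natExp (α ∘ τ.symm)))
      ((h4 α).symm.trans (hc α (le_sup_right.trans hα)))
    rw [coeff_smul, coeff_monZ h7, if_pos rfl, smul_eq_mul, mul_one, coeff_sum] at h8
    obtain ⟨β, hβ, h9⟩ := Finset.exists_ne_zero_of_sum_ne_zero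
      (h8.symm.trans_ne (mul_ne_zero k.ne_zero (inv_ne_zero (Units.ne_zero _))))
    rw [coeff_smul, coeff_monZ h7] at h9
    have h10 : α + β = α ∘ τ.symm := by
      by_contra hne
      rw [if_neg hne, smul_zero] at h9
      exact h9 rfl
    rwa [← h10, add_sub_cancel_left]
  by_contra hne
  obtain ⟨i, hi⟩ : ∃ i, τ.symm i ≠ i := by
    by_contra! hall
    exact hne (Equiv.ext fun i => by rw [Equiv.Perm.one_apply, ← Equiv.eq_symm_apply, hall])
  -- Along the ray in a direction `e_i` moved by `τ⁻¹`, the `i`-th coordinate of the displacement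
  -- decreases by `1` at each step, giving infinitely many elements of the finite set `S`.
  let F : ℕ → S := fun N => ⟨(0 ⊔ c + N • Pi.single i 1) ∘ τ.symm - (0 ⊔ c + N • Pi.single i 1),
    h6 _ (le_add_of_nonneg_right (nsmul_nonneg (by simp) N))⟩
  refine not_injective_infinite_finite F fun N M hNM => ?_
  have h7 := congrFun (congrArg Subtype.val hNM) i
  simpa [F, hi] using h7

/-! ### Existence of the decomposition, and normality. -/

theorem exists_decomposition (σ : 𝔾 K n) : ∃ a ∈ symmSubgroup K n,
    ∃ b ∈ torusSubgroup K n ⊔ xiSubgroup K n ⊔ innSubgroup K n, σ = a * b := by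
  obtain ⟨τ, φ, d, κ, H, hd⟩ := exists_normalized σ
  -- The weight is re-indexed by the target exponent `α + κ`, because `ψ⁻¹` is applied after `φ⁻¹`
  -- and sees that exponent.
  let d' : (Fin n → ℤ) → K := fun α => d (α + -κ)
  have h1 := H.isRat_ratio hd
  obtain ⟨t, m, htm⟩ := exists_weight (d := d') (eventually_shift (hd.mono fun _ h => h.1) (-κ))
    (fun i => ((h1 i).1.shift (-κ)).congr (.of_forall fun α => by
      simp only [d', add_right_comm]))
    (fun i => ((h1 i).2.shift (-κ)).congr (.of_forall fun α => by
      simp only [d', add_right_comm]))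
  obtain ⟨ψ, hψ, h2⟩ := exists_implements_torus_xi (K := K) t m
  have hψs : ∀ α, ψ.symm (monZ K α) = ((weightZ t m α : Kˣ) : K)⁻¹ • monZ K α := fun α => by
    rw [LinearEquiv.symm_apply_eq, map_smul, h2, smul_smul, inv_mul_cancel₀ (Units.ne_zero _),
      one_smul]
  have h3 : σ * permHom K n τ * (torusHom K n t * xiHom K n m) ∈ innSubgroup K n := by
    refine (H.mul hψ).mem_inn (htm.shift κ) (κ := κ) ?_
    filter_upwards [hd] with α ⟨_, h4⟩
    change ψ.symm (φ.symm (monZ K α)) = _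
    rw [h4, map_smul, hψs, smul_smul]
    simp only [d', add_neg_cancel_right]
  have h4 : σ * permHom K n τ ∈ torusSubgroup K n ⊔ xiSubgroup K n ⊔ innSubgroup K n :=
    (Subgroup.mul_mem_cancel_right _
      (Subgroup.mem_sup_left (mem_torus_sup_xi.2 ⟨t, m, rfl⟩))).1 (Subgroup.mem_sup_right h3)
  -- `σ = τ⁻¹ · (τ (σ τ) τ⁻¹)`: the permutation was removed on the right, and normalisation by `S_n`
  -- moves it to the left.
  refine ⟨permHom K n τ⁻¹, ⟨_, rfl⟩, _, permHom_conj_mem τ h4, ?_⟩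
  rw [map_inv]
  group

theorem isSemidirect_symm :
    IsSemidirect (⊤ : Subgroup (𝔾 K n)) (symmSubgroup K n)
      (torusSubgroup K n ⊔ xiSubgroup K n ⊔ innSubgroup K n) := by
  refine ⟨le_top, le_top, fun g _ b hb => ?_, fun g _ => exists_decomposition g, ?_⟩
  · obtain ⟨_, ⟨τ, rfl⟩, a, ha, rfl⟩ := exists_decomposition g
    have h1 := permHom_conj_mem τ (mul_mem (mul_mem ha hb) (inv_mem ha))
    rw [mul_inv_rev]
    simpa only [mul_assoc] using h1
  · rw [eq_bot_iff]
    rintro _ ⟨⟨τ, rfl⟩, hτ⟩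
    rw [perm_eq_one_of_mem hτ, map_one]
    exact Subgroup.mem_bot.2 rfl

end decomposition

end JacobianAlgebra

open JacobianAlgebra in
theorem mainTheorem1 (K : Type*) [Field K] [CharZero K] (n : ℕ) :
    -- `S_n` permutes the variables
    (∀ (τ : Equiv.Perm (Fin n)) (i : Fin n),
      permHom K n τ (x K i) = x K (τ i) ∧ permHom K n τ (y K i) = y K (τ i) ∧
        permHom K n τ (h K i) = h K (τ i) ∧ permHom K n τ (hinv K i) = hinv K (τ i)) ∧
    Function.Injective (permHom K n) ∧
    -- `𝕋^n` rescales the variables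
    (∀ (t : Fin n → Kˣ) (i : Fin n),
      torusHom K n t (x K i) = (t i : K) • x K i ∧
        torusHom K n t (y K i) = ((t i)⁻¹ : K) • y K i ∧
        torusHom K n t (h K i) = h K i ∧ torusHom K n t (hinv K i) = hinv K i) ∧
    Function.Injective (torusHom K n) ∧
    -- the generators of `Ξ_n`: `η_i θ_i` is the composition of the involutions `η_i` and `θ_i` on
    -- the `i`-th tensor factor of `𝔸_n` and the identity on the other factors
    (∀ i : Fin n, ∃ η θ : factor K i ≃ₗ[K] factor K i, IsEta i η ∧ IsTheta i θ ∧
      ∀ a : factor K i, etaTheta K i (a : JacobianAlg K n) = η (θ a)) ∧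
    (∀ i j : Fin n, i ≠ j → ∀ a : factor K j, etaTheta K i (a : JacobianAlg K n) = a) ∧
    (∀ i : Fin n,
      etaTheta K i (x K i) = x K i * h K i ∧ etaTheta K i (y K i) = hinv K i * y K i ∧
        etaTheta K i (h K i) = h K i ∧ etaTheta K i (hinv K i) = hinv K i) ∧
    -- `Ξ_n` is free abelian on `η_1 θ_1, …, η_n θ_n`
    (∃ e : Multiplicative (Fin n → ℤ) ≃* xiSubgroup K n,
      ∀ i : Fin n, (e (Multiplicative.ofAdd (Pi.single i 1)) : 𝔾 K n) = etaTheta K i) ∧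
    -- `𝔾_n = S_n ⋉ ((𝕋^n × Ξ_n) ⋉ Inn(𝔸_n))`
    IsDirect (torusSubgroup K n ⊔ xiSubgroup K n) (torusSubgroup K n) (xiSubgroup K n) ∧
    IsSemidirect (torusSubgroup K n ⊔ xiSubgroup K n ⊔ innSubgroup K n)
      (torusSubgroup K n ⊔ xiSubgroup K n) (innSubgroup K n) ∧
    IsSemidirect (⊤ : Subgroup (𝔾 K n)) (symmSubgroup K n)
      (torusSubgroup K n ⊔ xiSubgroup K n ⊔ innSubgroup K n) := by
  refine ⟨fun τ i => ⟨permHom_x τ i, ?_, ?_, permHom_hinv τ i⟩, permHom_injective,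
    fun t i => ⟨torusHom_x t i, torusHom_y t i, torusHom_h t i, torusHom_hinv t i⟩,
    torusHom_injective,
    fun i => ⟨eta K i, theta K i, isEta_eta i, isTheta_theta i, etaTheta_eq_eta_theta⟩,
    fun i j hij a => etaTheta_factor_of_ne hij a,
    fun i => ⟨etaTheta_x i, etaTheta_y i, etaTheta_h i, etaTheta_hinv i i⟩,
    exists_xiEquiv, isDirect_torus_xi, isSemidirect_torus_xi_inn, isSemidirect_symm⟩
  · rw [y, y, map_mul, permHom_hinv, permHom_der]
  · rw [h_eq, h_eq, map_mul, permHom_x, permHom_der]
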